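/- **Notation.** Let $n\ge 1$, $\langle\xi\rangle=(1+|\xi|^2)^{1/2}$, $\langle\xi;\xi'\rangle=(1+|\xi|^2+|\xi'|^2)^{1/2}$, $D^\alpha=(-i)^{|\alpha|}\partial^\alpha$, and for $\tilde m\in\mathbb N_0$, $0<\tau<1$ let $C^{\tilde m,\tau}(\mathbb R^n)$ be the Hölder space with norm $\max_{|\beta|\le\tilde m}\big(\sup|\partial^\beta f|+\sup_{x\ne y}|\partial^\beta f(x)-\partial^\beta f(y)|/|x-y|^\tau\big)$. The oscillatory integral is $\mathrm{Os}\text{-}\!\iint e^{-iy\cdot\eta}f(y,\eta)\,dy\,đ\eta=\lim_{\varepsilon\to0^+}(2\pi)^{-n}\iint\chi(\varepsilon y,\varepsilon\eta)e^{-iy\cdot\eta}f(y,\eta)\,dy\,d\eta$; it is said to exist if for all $\chi\in\mathcal S(\mathbb R^n\times\mathbb R^n)$ with $\chi(0,0)=1$ the integrals on the right converge absolutely for every $\varepsilon>0$ and the limit exists and does not depend on $\chi$. *Single symbols.* $C^{\tilde m,\tau}S^m_{\rho,\delta}(M)$, $M\in\mathbb N_0\cup\{\infty\}$, is the set of $a:\mathbb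 R^n\times\mathbb R^n\to\mathbb C$ such that for all $|\beta|\le\tilde m$, $|\alpha|\le M$: $\partial_x^\beta a(x,\cdot)\in C^M(\mathbb R^n)$ for all $x$; $\partial_x^\beta\partial_\xi^\alpha a$ is continuous; $|\partial_\xi^\alpha a(x,\xi)|\le C_\alpha\langle\xi\rangle^{m-\rho|\alpha|}$; and $\partial_\xi^\alpha a(\cdot,\xi)\in C^{\tilde m,\tau}(\mathbb R^n)$ with $\|\partial_\xi^\alpha a(\cdot,\xi)\|_{C^{\tilde m,\tau}}\le C_\alpha\langle\xi\rangle^{m-\rho|\alpha|+\delta(\tilde m+\tau)}$. A subset is bounded if the constants $C_\alpha$ can be chosen uniformly on it. Such an $a$ belongs to $C^{\tilde m,\tau}\dot S^m_{\rho,\delta}(M)$ if moreover, for all $|\alpha|\le M$, $|\beta|\le\tilde m$, $|\partial_\xi^\alpha D_x^\beta a(x,\xi)|\le C_{\alpha,\beta}(x)\langle\xi\rangle^{m-\rho|\alpha|+\delta|\beta|}$ with $C_{\alpha,\beta}$ bounded and $C_{\alpha,\beta}(x)\to0$ as $|x|\to\infty$. *Double symbols.* $C^{\tilde m,\tau}S^{m_1,m_2}_{\rho,\delta}(M_1,M_2)$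 is the set of continuous $a(x,\xi,x',\xi')$ on $(\mathbb R^n)^4$ such that for all multi-indices with $|\beta|\le\tilde m$, $|\alpha|\le M_1$, $|\alpha'|\le M_2$ and all $\beta'$, with $b=\partial_\xi^\alpha\partial_{x'}^{\beta'}\partial_{\xi'}^{\alpha'}a$: $b$ is in $C^{\tilde m,\tau}$ as a function of $x$; $\partial_x^\beta b$ is continuous on $(\mathbb R^n)^4$; $$|\partial_x^\beta b|\le C(x)\,\tilde C(x')\,\langle\xi\rangle^{m_1-\rho|\alpha|+\delta|\beta|}\langle\xi'\rangle^{m_2-\rho|\alpha'|}\langle\xi;\xi'\rangle^{\delta|\beta'|}$$ with bounded functions $C,\tilde C$ (depending on the multi-indices); and $$\|b(\cdot,\xi,x',\xi')\|_{C^{\tilde m,\tau}}\le C\,\langle\xi\rangle^{m_1-\rho|\alpha|+\delta(\tilde m+\tau)}\langle\xi'\rangle^{m_2-\rho|\alpha'|}\langle\xi;\xi'\rangle^{\delta|\beta'|}.$$ It belongs to $C^{\tilde m,\tau}\hat S^{m_1,m_2}_{\rho,\delta}(M_1,M_2)$ if the functions $\tilde C$ can be chosen such that also $\tilde C(x')\to0$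 as $|x'|\to\infty$. **Theorem.** Let $0\le\delta\le\rho\le1$ with $\delta\neq1$, $m_1,m_2\in\mathbb R$, $M_1,M_2\in\mathbb N_0\cup\{\infty\}$ with $M_1>n+1$, $\tilde m\in\mathbb N_0$, $0<\tau<1$, and $a\in C^{\tilde m,\tau}S^{m_1,m_2}_{\rho,\delta}(M_1,M_2)$. Then the oscillatory integrals $$a_L(x,\xi):=\mathrm{Os}\text{-}\!\iint e^{-iy\cdot\eta}a(x,\xi+\eta,x+y,\xi)\,dy\,đ\eta,$$ $$r_{\gamma,\theta}(x,\xi):=\mathrm{Os}\text{-}\!\iint e^{-iy\cdot\eta}(\partial_\xi^\gamma D_{x'}^\gamma a)(x,\xi+\theta\eta,x+y,\xi)\,dy\,đ\eta$$ exist for all $x,\xi\in\mathbb R^n$, $|\theta|\le1$ and $|\gamma|\le M_1-(n+1)$. Let $N\ge1$ be an integer with $N\le M_1-(n+1)$ and put $\tilde M_N:=\min\{M_1-N-(n+1),M_2\}$. Then, for all $x,\xi$, $$a_L(x,\xi)=\sum_{|\alpha|<N}\frac1{\alpha!}(\partial_\xi^\alpha D_{x'}^\alpha a)(x,\xi,x,\xi)+R_N(x,\xi),\qquad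 R_N(x,\xi):=N\sum_{|\gamma|=N}\int_0^1\frac{(1-\theta)^{N-1}}{\gamma!}r_{\gamma,\theta}(x,\xi)\,d\theta,$$ where the integrals over $\theta$ exist, $R_N\in C^{\tilde m,\tau}S^{m_1+m_2-(\rho-\delta)N}_{\rho,\delta}(\tilde M_N)$, and for each $|\gamma|=N$ the set $\{r_{\gamma,\theta}:|\theta|\le1\}$ is a bounded subset of $C^{\tilde m,\tau}S^{m_1+m_2-(\rho-\delta)N}_{\rho,\delta}(\tilde M_N)$. If moreover $\partial_\xi^\gamma D_{x'}^\gamma a\in C^{\tilde m,\tau}\hat S^{m_1-\rho,m_2+\delta}_{\rho,\delta}(M_1-1,M_2)$ for all $|\gamma|=1$, then $R_N\in C^{\tilde m,\tau}\dot S^{m_1+m_2-(\rho-\delta)N}_{\rho,\delta}(\tilde M_N)$ for all such $N$. -/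

import Mathlib

open MeasureTheory Filter Topology
open scoped NNReal ENNReal SchwartzMap Nat ContDiff

noncomputable section

namespace NonSmoothSymbol

/-- Euclidean space `ℝⁿ`. -/
abbrev E (n : ℕ) : Type := EuclideanSpace ℝ (Fin n)

/-- Multi-indices in `ℕ₀ⁿ`. -/
abbrev MultiIndex (n : ℕ) : Type := Fin n → ℕ

/-- The length `|α| = α₁ + ⋯ + αₙ`. -/
def len {n : ℕ} (α : MultiIndex n) : ℕ := ∑ j, α j

/-- The factorial `α! = α₁! ⋯ αₙ!`. -/
def mfact {n : ℕ} (α : MultiIndex n) : ℕ := ∏ j, (α j)!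

/-- `⟨ξ⟩ = (1 + |ξ|²)^{1/2}`. -/
def jb {n : ℕ} (ξ : E n) : ℝ := Real.sqrt (1 + ‖ξ‖ ^ 2)

/-- `⟨ξ; ξ'⟩ = (1 + |ξ|² + |ξ'|²)^{1/2}`. -/
def jb₂ {n : ℕ} (ξ ξ' : E n) : ℝ := Real.sqrt (1 + ‖ξ‖ ^ 2 + ‖ξ'‖ ^ 2)

/-- The partial derivative `∂_j f`. -/
def pd {n : ℕ} (j : Fin n) (f : E n → ℂ) : E n → ℂ :=
  fun x => lineDeriv ℝ f x (EuclideanSpace.single j 1)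

/-- `∂^α f = ∂₁^{α₁} ⋯ ∂ₙ^{αₙ} f` (only used for functions that are at least `|α|` times
continuously differentiable). -/
def mpd {n : ℕ} (α : MultiIndex n) (f : E n → ℂ) : E n → ℂ :=
  (List.finRange n).foldr (fun j g => (pd j)^[α j] g) f

/-! ### Hölder norms -/

/-- The norm of `C^{0,τ}(ℝⁿ)`, with value `∞` outside of this space. -/
def holderNorm₀ {n : ℕ} (τ : ℝ≥0) (f : E n → ℂ) : ℝ≥0∞ :=
  (⨆ x, ‖f x‖ₑ) + eHolderNorm τ f

/-- The norm of `C^{k,τ}(ℝⁿ)` of a `k` times continuously differentiable function, with value `∞`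
outside of this space. -/
def holderNorm {n : ℕ} (k : ℕ) (τ : ℝ≥0) (f : E n → ℂ) : ℝ≥0∞ :=
  ⨆ (β : MultiIndex n) (_ : len β ≤ k), holderNorm₀ τ (mpd β f)

/-! ### Single symbols `a(x, ξ)` -/

/-- `∂_x^β a` for `a = a(x, ξ)`. -/
def sx {n : ℕ} (β : MultiIndex n) (a : E n → E n → ℂ) : E n → E n → ℂ :=
  fun x ξ => mpd β (fun z => a z ξ) x

/-- `∂_ξ^α a` for `a = a(x, ξ)`. -/
def sξ {n : ℕ} (α : MultiIndex n) (a : E n → E n → ℂ) : E n → E n → ℂ :=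
  fun x ξ => mpd α (fun ζ => a x ζ) ξ

/-- The two estimates of order `α` in the definition of `C^{k,τ}S^m_{ρ,δ}(ℝⁿ × ℝⁿ; M)`, with
constant `C`. -/
def SymbolBound {n : ℕ} (k : ℕ) (τ : ℝ≥0) (m ρ δ : ℝ) (α : MultiIndex n) (C : ℝ)
    (a : E n → E n → ℂ) : Prop :=
  (∀ x ξ, ‖sξ α a x ξ‖ ≤ C * jb ξ ^ (m - ρ * len α)) ∧
  (∀ ξ, holderNorm k τ (fun x => sξ α a x ξ) ≤
    ENNReal.ofReal (C * jb ξ ^ (m - ρ * len α + δ * (k + τ))))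

/-- The symbol class `C^{k,τ}S^m_{ρ,δ}(ℝⁿ × ℝⁿ; M)`. -/
structure IsSymbol {n : ℕ} (k : ℕ) (τ : ℝ≥0) (m ρ δ : ℝ) (M : ℕ∞)
    (a : E n → E n → ℂ) : Prop where
  contDiff_x : ∀ α : MultiIndex n, (len α : ℕ∞) ≤ M → ∀ ξ,
    ContDiff ℝ k (fun x => sξ α a x ξ)
  contDiff_ξ : ∀ β : MultiIndex n, len β ≤ k → ∀ x,
    ContDiff ℝ (M : WithTop ℕ∞) (fun ξ => sx β a x ξ)
  continuous : ∀ α β : MultiIndex n, (len α : ℕ∞) ≤ M → len β ≤ k →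
    Continuous (fun p : E n × E n => sx β (sξ α a) p.1 p.2)
  bound : ∀ α : MultiIndex n, (len α : ℕ∞) ≤ M → ∃ C : ℝ, SymbolBound k τ m ρ δ α C a

/-- Bounded subsets of `C^{k,τ}S^m_{ρ,δ}(ℝⁿ × ℝⁿ; M)`: every seminorm is bounded on the set. -/
def IsBoundedSymbolSet {n : ℕ} (k : ℕ) (τ : ℝ≥0) (m ρ δ : ℝ) (M : ℕ∞)
    (B : Set (E n → E n → ℂ)) : Prop :=
  (∀ a ∈ B, IsSymbol k τ m ρ δ M a) ∧
  ∀ α : MultiIndex n, (len α : ℕ∞) ≤ M → ∃ C : ℝ, ∀ a ∈ B, SymbolBound k τ m ρ δ α C a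

/-- A bounded function on `ℝⁿ`. -/
def IsBdd {n : ℕ} (C : E n → ℝ) : Prop := ∃ K : ℝ, ∀ x, |C x| ≤ K

/-- A bounded function on `ℝⁿ` that tends to `0` as `|x| → ∞`. -/
def IsDecaying {n : ℕ} (C : E n → ℝ) : Prop := IsBdd C ∧ Tendsto C (cocompact (E n)) (𝓝 0)

/-- The dotted class `C^{k,τ}Ṡ^m_{ρ,δ}(ℝⁿ × ℝⁿ; M)`. -/
structure IsDotSymbol {n : ℕ} (k : ℕ) (τ : ℝ≥0) (m ρ δ : ℝ) (M : ℕ∞)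
    (a : E n → E n → ℂ) : Prop extends IsSymbol k τ m ρ δ M a where
  decay : ∀ α β : MultiIndex n, (len α : ℕ∞) ≤ M → len β ≤ k →
    ∃ C : E n → ℝ, IsDecaying C ∧
      ∀ x ξ, ‖sξ α (sx β a) x ξ‖ ≤ C x * jb ξ ^ (m - ρ * len α + δ * len β)

/-! ### Double symbols `a(x, ξ, x', ξ')` -/

/-- Functions of `(x, ξ, x', ξ')`. -/
abbrev Fun4 (n : ℕ) : Type := E n → E n → E n → E n → ℂ

/-- `∂_x^β a`. -/
def dx {n : ℕ} (β : MultiIndex n) (a : Fun4 n) : Fun4 n :=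
  fun x ξ x' ξ' => mpd β (fun z => a z ξ x' ξ') x

/-- `∂_ξ^α a`. -/
def dξ {n : ℕ} (α : MultiIndex n) (a : Fun4 n) : Fun4 n :=
  fun x ξ x' ξ' => mpd α (fun ζ => a x ζ x' ξ') ξ

/-- `∂_{x'}^{β'} a`. -/
def dx' {n : ℕ} (β' : MultiIndex n) (a : Fun4 n) : Fun4 n :=
  fun x ξ x' ξ' => mpd β' (fun z => a x ξ z ξ') x'

/-- `∂_{ξ'}^{α'} a`. -/
def dξ' {n : ℕ} (α' : MultiIndex n) (a : Fun4 n) : Fun4 n :=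
  fun x ξ x' ξ' => mpd α' (fun ζ => a x ξ x' ζ) ξ'

/-- `|∂_x^β ∂_ξ^α ∂_{x'}^{β'} ∂_{ξ'}^{α'} a(x, ξ, x', ξ')|` is at most
`C(x) C'(x') ⟨ξ⟩^{m₁ - ρ|α| + δ|β|} ⟨ξ'⟩^{m₂ - ρ|α'|} ⟨ξ; ξ'⟩^{δ|β'|}`. -/
def DoubleBound {n : ℕ} (m₁ m₂ ρ δ : ℝ) (β α β' α' : MultiIndex n) (C C' : E n → ℝ)
    (a : Fun4 n) : Prop :=
  ∀ x ξ x' ξ', ‖dx β (dξ α (dx' β' (dξ' α' a))) x ξ x' ξ'‖ ≤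
    C x * C' x' * jb ξ ^ (m₁ - ρ * len α + δ * len β) * jb ξ' ^ (m₂ - ρ * len α') *
      jb₂ ξ ξ' ^ (δ * len β')

/-- The double symbol class `C^{k,τ}S^{m₁,m₂}_{ρ,δ}(ℝⁿ × ℝⁿ × ℝⁿ × ℝⁿ; M₁, M₂)`.
The first three fields say that the derivatives in the other fields exist classically. -/
structure IsDoubleSymbol {n : ℕ} (k : ℕ) (τ : ℝ≥0) (m₁ m₂ ρ δ : ℝ) (M₁ M₂ : ℕ∞)
    (a : Fun4 n) : Prop where
  contDiff_ξ' : ∀ x ξ x', ContDiff ℝ (M₂ : WithTop ℕ∞) (fun ξ' => a x ξ x' ξ')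
  contDiff_x' : ∀ α' : MultiIndex n, (len α' : ℕ∞) ≤ M₂ → ∀ x ξ ξ',
    ContDiff ℝ ∞ (fun x' => dξ' α' a x ξ x' ξ')
  contDiff_ξ : ∀ β' α' : MultiIndex n, (len α' : ℕ∞) ≤ M₂ → ∀ x x' ξ',
    ContDiff ℝ (M₁ : WithTop ℕ∞) (fun ξ => dx' β' (dξ' α' a) x ξ x' ξ')
  contDiff_x : ∀ α β' α' : MultiIndex n, (len α : ℕ∞) ≤ M₁ → (len α' : ℕ∞) ≤ M₂ → ∀ ξ x' ξ',
    ContDiff ℝ k (fun x => dξ α (dx' β' (dξ' α' a)) x ξ x' ξ')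
  continuous : ∀ β α β' α' : MultiIndex n, len β ≤ k → (len α : ℕ∞) ≤ M₁ → (len α' : ℕ∞) ≤ M₂ →
    Continuous (fun p : E n × E n × E n × E n =>
      dx β (dξ α (dx' β' (dξ' α' a))) p.1 p.2.1 p.2.2.1 p.2.2.2)
  bound : ∀ β α β' α' : MultiIndex n, len β ≤ k → (len α : ℕ∞) ≤ M₁ → (len α' : ℕ∞) ≤ M₂ →
    ∃ C C' : E n → ℝ, IsBdd C ∧ IsBdd C' ∧ DoubleBound m₁ m₂ ρ δ β α β' α' C C' a
  holder : ∀ α β' α' : MultiIndex n, (len α : ℕ∞) ≤ M₁ → (len α' : ℕ∞) ≤ M₂ →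
    ∃ C : ℝ, ∀ ξ x' ξ',
      holderNorm k τ (fun x => dξ α (dx' β' (dξ' α' a)) x ξ x' ξ') ≤
        ENNReal.ofReal (C * jb ξ ^ (m₁ - ρ * len α + δ * (k + τ)) * jb ξ' ^ (m₂ - ρ * len α') *
          jb₂ ξ ξ' ^ (δ * len β'))

/-- The hatted double symbol class `C^{k,τ}Ŝ^{m₁,m₂}_{ρ,δ}(ℝⁿ × ℝⁿ × ℝⁿ × ℝⁿ; M₁, M₂)`: the
functions of `x'` in the estimates can be chosen to tend to zero as `|x'| → ∞`. -/
structure IsHatDoubleSymbol {n : ℕ} (k : ℕ) (τ : ℝ≥0) (m₁ m₂ ρ δ : ℝ) (M₁ M₂ : ℕ∞)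
    (a : Fun4 n) : Prop extends IsDoubleSymbol k τ m₁ m₂ ρ δ M₁ M₂ a where
  decay : ∀ β α β' α' : MultiIndex n, len β ≤ k → (len α : ℕ∞) ≤ M₁ → (len α' : ℕ∞) ≤ M₂ →
    ∃ C C' : E n → ℝ, IsBdd C ∧ IsDecaying C' ∧ DoubleBound m₁ m₂ ρ δ β α β' α' C C' a

/-! ### Oscillatory integrals -/

/-- The integrand `χ(εy, εη) e^{-iy·η} f(y, η)`. -/
def oscIntegrand {n : ℕ} (χ : 𝓢(E n × E n, ℂ)) (f : E n → E n → ℂ) (ε : ℝ) (p : E n × E n) : ℂ :=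
  χ (ε • p) * Complex.exp (-Complex.I * ((inner ℝ p.1 p.2 : ℝ) : ℂ)) * f p.1 p.2

/-- The oscillatory integral of `e^{-iy·η} f(y, η)` with respect to `dy đη`, `đη = (2π)^{-n} dη`,
exists and equals `L`: for every Schwartz function `χ` with `χ(0, 0) = 1` the regularized integrals
exist and converge to `L` as `ε → 0`. -/
def HasOscInt {n : ℕ} (f : E n → E n → ℂ) (L : ℂ) : Prop :=
  ∀ χ : 𝓢(E n × E n, ℂ), χ 0 = 1 →
    (∀ ε : ℝ, 0 < ε → Integrable (oscIntegrand χ f ε)) ∧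
    Tendsto (fun ε : ℝ => (((2 * Real.pi) ^ n)⁻¹ : ℂ) * ∫ p, oscIntegrand χ f ε p)
      (𝓝[>] 0) (𝓝 L)

open Classical in
/-- The value of the oscillatory integral (`0` if it does not exist). -/
def oscInt {n : ℕ} (f : E n → E n → ℂ) : ℂ :=
  if h : ∃ L, HasOscInt f L then h.choose else 0

/-! ### The reduced symbol and the remainder -/

/-- `a(x, ξ + θη, x + y, ξ)` as a function of `(y, η)`. -/
def amplitude {n : ℕ} (a : Fun4 n) (θ : ℝ) (x ξ : E n) : E n → E n → ℂ :=
  fun y η => a x (ξ + θ • η) (x + y) ξ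

/-- The reduced symbol `a_L`. -/
def reduced {n : ℕ} (a : Fun4 n) (x ξ : E n) : ℂ :=
  oscInt (fun y η => a x (ξ + η) (x + y) ξ)

/-- `∂_ξ^γ D_{x'}^γ a`, where `D^γ = (-i)^{|γ|} ∂^γ`. -/
def dξDx' {n : ℕ} (γ : MultiIndex n) (a : Fun4 n) : Fun4 n :=
  fun x ξ x' ξ' => (-Complex.I) ^ len γ * dξ γ (dx' γ a) x ξ x' ξ'

/-- `r_{γ,θ}`: the oscillatory integral of
`e^{-iy·η} (∂_ξ^γ D_{x'}^γ a)(x, ξ + θη, x + y, ξ)`. -/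
def rSymb {n : ℕ} (a : Fun4 n) (γ : MultiIndex n) (θ : ℝ) (x ξ : E n) : ℂ :=
  oscInt (amplitude (dξDx' γ a) θ x ξ)

/-- The finite set of multi-indices of length `k`. -/
def ofLen (n k : ℕ) : Finset (MultiIndex n) := Finset.piAntidiag Finset.univ k

/-- The Taylor sum: the sum over `|α| < N` of `(∂_ξ^α D_{x'}^α a)(x, ξ, x, ξ) / α!`. -/
def taylorSum {n : ℕ} (a : Fun4 n) (N : ℕ) (x ξ : E n) : ℂ :=
  ∑ k ∈ Finset.range N, ∑ α ∈ ofLen n k, (1 / (mfact α : ℂ)) * dξDx' α a x ξ x ξ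

/-- The integrand `(1 - θ)^{N-1} / γ! · r_{γ,θ}(x, ξ)` (used for `N ≥ 1` only). -/
def remIntegrand {n : ℕ} (a : Fun4 n) (N : ℕ) (γ : MultiIndex n) (x ξ : E n) (θ : ℝ) : ℂ :=
  ((((1 - θ) ^ (N - 1) / mfact γ : ℝ)) : ℂ) * rSymb a γ θ x ξ

/-- The remainder `R_N`. -/
def remainder {n : ℕ} (a : Fun4 n) (N : ℕ) (x ξ : E n) : ℂ :=
  (N : ℂ) * ∑ γ ∈ ofLen n N, ∫ θ in (0 : ℝ)..1, remIntegrand a N γ x ξ θ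

/-- `M̃_k = min {M₁ - k - (n + 1), M₂}`, where `k + (n + 1) ≤ M₁`. -/
def redOrder (n : ℕ) (M₁ M₂ : ℕ∞) (k : ℕ) : ℕ∞ := min (M₁ - ((k + (n + 1) : ℕ) : ℕ∞)) M₂

end NonSmoothSymbol

end

open NonSmoothSymbol

/-!
The operator with double symbol `a` has the reduced symbol `a_L`, an oscillatory integral over
`(y, η)`. The expansion of `a_L` is Taylor's formula on `[0, 1]` for `θ ↦ r_{0,θ}`, where `r_{0,1} = a_L`
and, by Fourier inversion (`HasOscInt.eq_apply_zero`), `r_{γ,0}(x, ξ)` is the derivative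
`∂_ξ^γ D_{x'}^γ a` at `(x, ξ, x, ξ)`. Differentiation in `θ` produces factors `η_j`, and an integration
by parts turns each of them into `-i ∂_{x'_j}` (`oscInt_coord_mul`, `SymFam.hasDerivAt_oscV_theta`).
Hence `∂_θ r_{γ,θ} = ∑ j, r_{γ + e_j,θ}`, and the sums `∑_{|γ| = l} r_{γ,θ} / γ!` form a sequence to which
the one-dimensional formula `taylor_integral` applies (`SymFam.reduced_eq`).

The analytic part is the proof that the oscillatory integrals exist, may be differentiated, and obey
the bounds of a symbol of the expected order. It rests on an a priori estimate for rapidly decaying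
amplitudes, `exists_norm_integral_osc_le`: integrating by parts `L` times in `y`, where each step gains
`⟨η⟩^{-(1-δ)}`, and `n + 1` times in `η`, where each step gains `⟨y⟩⁻¹`, one bounds the integral by the
estimates for the amplitude alone. This uses `n + 1` derivatives in `ξ` and explains the loss in the
number of derivatives in the theorem. Applied to differences of regularized integrals, the estimate
gives convergence with a rate, `exists_hasOscInt`, for every cutoff and uniformly in
parameters; continuity in parameters and differentiation under the oscillatory integral follow.

The sharp power of `⟨ξ⟩` comes from the substitution `y ↦ λ⁻¹ y`, `η ↦ λ η` with `λ = ⟨ξ⟩^δ`, under which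
oscillatory integrals are invariant (`HasOscInt.scale`). It turns the symbol into an amplitude whose
constants are proportional to the bound to be proved (`AmpFam.reg_scaled`,
`AmpFam.exists_norm_oscInt_le`): a derivative in `η` gains `λ ⟨ξ⟩^{-ρ} ≤ 1`, and a derivative in `y` costs
`λ⁻¹ ⟨ξ⟩^δ = 1`. For the estimates in `x`, the base point `z` of the third argument `z + y` is first
treated as independent of `x`. The Hölder estimate on the diagonal `z = x` combines the Hölder
continuity of the symbol in its first variable with an interpolation between consecutive derivatives
(`SymFam.exists_norm_oscV_diag_sub_le`).

All estimates are carried out for families of functions, by means of the predicate `Reg`, so that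
uniformity in `θ` and in all other parameters needs no separate argument. The weights in the spatial
variable are taken from an abstract class (`WeightClass`) that covers bounded and decaying functions.
The decay of the remainder is therefore obtained from the same lemmas: one of the `N ≥ 1` derivatives
`∂_ξ^γ D_{x'}^γ` is moved into the symbol (`SymFam.dξDx'_dξDx'`), which then is in the class of symbols
with decay in `x'`.
-/

namespace NonSmoothSymbol

variable {n : ℕ}

/-! ### Japanese brackets -/

theorem one_le_jb (ξ : E n) : 1 ≤ jb ξ := by
  unfold jb
  rw [Real.one_le_sqrt]
  nlinarith [sq_nonneg ‖ξ‖]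

theorem jb_pos (ξ : E n) : 0 < jb ξ := lt_of_lt_of_le one_pos (one_le_jb ξ)

theorem norm_le_jb (ξ : E n) : ‖ξ‖ ≤ jb ξ :=
  Real.le_sqrt_of_sq_le (by linarith)

theorem jb_sq (ξ : E n) : jb ξ ^ 2 = 1 + ‖ξ‖ ^ 2 := Real.sq_sqrt (by positivity)

theorem jb_add_le (a b : E n) : jb (a + b) ≤ jb a + ‖b‖ := by
  have h := norm_add_le a b
  refine Real.sqrt_le_iff.2 ⟨add_nonneg (jb_pos a).le (norm_nonneg _), ?_⟩
  have h1 := jb_sq a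
  have h2 := norm_le_jb a
  nlinarith [norm_nonneg a, norm_nonneg b, norm_nonneg (a + b)]

theorem jb_le_one_add (a : E n) : jb a ≤ 1 + ‖a‖ := by
  refine Real.sqrt_le_iff.2 ⟨by positivity, ?_⟩
  nlinarith [norm_nonneg a]

theorem jb_mono {a b : E n} (h : ‖a‖ ≤ ‖b‖) : jb a ≤ jb b :=
  Real.sqrt_le_sqrt (by nlinarith [norm_nonneg a])

theorem continuous_jb : Continuous (jb : E n → ℝ) := by
  unfold jb; fun_prop

theorem continuous_jb_rpow (s : ℝ) : Continuous fun ξ : E n => jb ξ ^ s :=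
  continuous_jb.rpow_const fun ξ => Or.inl (jb_pos ξ).ne'

theorem jb_rpow_pos (ξ : E n) (s : ℝ) : 0 < jb ξ ^ s := Real.rpow_pos_of_pos (jb_pos ξ) s

theorem jb_rpow_le {s t : ℝ} (ξ : E n) (h : s ≤ t) : jb ξ ^ s ≤ jb ξ ^ t :=
  Real.rpow_le_rpow_of_exponent_le (one_le_jb ξ) h

theorem one_le_jb_rpow {s : ℝ} (ξ : E n) (h : 0 ≤ s) : 1 ≤ jb ξ ^ s :=
  Real.one_le_rpow (one_le_jb ξ) h

theorem jb_rpow_add (ξ : E n) (s t : ℝ) : jb ξ ^ (s + t) = jb ξ ^ s * jb ξ ^ t :=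
  Real.rpow_add (jb_pos ξ) s t

theorem jb₂_le (ξ ξ' : E n) : jb₂ ξ ξ' ≤ jb ξ + jb ξ' := by
  refine Real.sqrt_le_iff.2 ⟨add_nonneg (jb_pos _).le (jb_pos _).le, ?_⟩
  have h1 := jb_sq ξ
  have h2 := jb_sq ξ'
  nlinarith [jb_pos ξ, jb_pos ξ']

theorem one_le_jb₂ (ξ ξ' : E n) : 1 ≤ jb₂ ξ ξ' := by
  unfold jb₂
  rw [Real.one_le_sqrt]
  nlinarith [sq_nonneg ‖ξ‖, sq_nonneg ‖ξ'‖]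

theorem integrable_jb_rpow {r : ℝ} (hr : r < -(n : ℝ)) :
    Integrable (fun ξ : E n => jb ξ ^ r) := by
  have h := integrable_rpow_neg_one_add_norm_sq (E := E n) (μ := volume) (r := -r)
    (by simpa using by linarith)
  refine h.congr (Eventually.of_forall fun ξ => ?_)
  simp only [jb, Real.sqrt_eq_rpow]
  rw [← Real.rpow_mul (by positivity)]
  congr 1; ring

/-! ### Regularity with bookkeeping -/

/-- The `j`-th standard basis vector of `ℝⁿ`. -/
noncomputable abbrev bv (j : Fin n) : E n := EuclideanSpace.single j 1

/-- Families `f_t(y, η)` of functions on `ℝⁿ × ℝⁿ`, indexed by `t : T`. -/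
abbrev Fam (n : ℕ) (T : Type) : Type := T → E n → E n → ℂ

variable {T T' : Type}

/-- `g = ∂_{y_j} f` for families of functions of `(y, η)`. -/
def DerivFst (j : Fin n) (f g : Fam n T) : Prop :=
  ∀ t y η, HasLineDerivAt ℝ (fun z => f t z η) (g t y η) y (bv j)

/-- `g = ∂_{η_j} f` for families of functions of `(y, η)`. -/
def DerivSnd (j : Fin n) (f g : Fam n T) : Prop :=
  ∀ t y η, HasLineDerivAt ℝ (fun ζ => f t y ζ) (g t y η) η (bv j)

/-- `Reg L J B f`: the family `f` has all mixed partial derivatives with at most `L` derivatives in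
the first and at most `J` derivatives in the second variable, taken in any order, and each
derivative `g` with `i` derivatives in the first and `l` derivatives in the second variable
satisfies the requirement `B i l g`. Since `f` is a family, a requirement can ask for estimates that
are uniform in the parameter. -/
inductive Reg : ℕ → ℕ → (ℕ → ℕ → Fam n T → Prop) → Fam n T → Prop
  | mk (L J : ℕ) (B : ℕ → ℕ → Fam n T → Prop) (f : Fam n T) (g h : Fin n → Fam n T)
      (hB : B 0 0 f)
      (hg : 0 < L → ∀ j, DerivFst j f (g j))
      (hgR : 0 < L → ∀ j, Reg (L - 1) J (fun i l => B (i + 1) l) (g j))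
      (hh : 0 < J → ∀ j, DerivSnd j f (h j))
      (hhR : 0 < J → ∀ j, Reg L (J - 1) (fun i l => B i (l + 1)) (h j)) : Reg L J B f

theorem DerivFst.unique {j : Fin n} {f g g' : Fam n T} (h : DerivFst j f g)
    (h' : DerivFst j f g') : g = g' := by
  funext t y η
  exact HasDerivAt.unique (h t y η) (h' t y η)

theorem DerivSnd.unique {j : Fin n} {f g g' : Fam n T} (h : DerivSnd j f g)
    (h' : DerivSnd j f g') : g = g' := by
  funext t y η
  exact HasDerivAt.unique (h t y η) (h' t y η)

namespace Reg

variable {L J L' J' : ℕ} {B B' B₁ B₂ : ℕ → ℕ → Fam n T → Prop} {f g : Fam n T}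

theorem base (h : Reg L J B f) : B 0 0 f := by
  cases h; assumption

theorem fst (h : Reg (L + 1) J B f) (j : Fin n) :
    ∃ g, DerivFst j f g ∧ Reg L J (fun i l => B (i + 1) l) g := by
  cases h with
  | mk _ _ _ _ g h hB hg hgR hh hhR => exact ⟨g j, hg (by omega) j, hgR (by omega) j⟩

theorem snd (h : Reg L (J + 1) B f) (j : Fin n) :
    ∃ g, DerivSnd j f g ∧ Reg L J (fun i l => B i (l + 1)) g := by
  cases h with
  | mk _ _ _ _ g h hB hg hgR hh hhR => exact ⟨h j, hh (by omega) j, hhR (by omega) j⟩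

theorem intro (hB : B 0 0 f)
    (hg : ∀ L', L = L' + 1 → ∀ j, ∃ g, DerivFst j f g ∧ Reg L' J (fun i l => B (i + 1) l) g)
    (hh : ∀ J', J = J' + 1 → ∀ j, ∃ g, DerivSnd j f g ∧ Reg L J' (fun i l => B i (l + 1)) g) :
    Reg L J B f := by
  have h1 : ∃ g : Fin n → Fam n T, (0 < L → ∀ j, DerivFst j f (g j)) ∧
      (0 < L → ∀ j, Reg (L - 1) J (fun i l => B (i + 1) l) (g j)) := by
    rcases Nat.eq_zero_or_pos L with h | h
    · exact ⟨fun _ => f, by omega, by omega⟩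
    · choose g hg1 hg2 using hg (L - 1) (by omega)
      exact ⟨g, fun _ => hg1, fun _ => hg2⟩
  have h2 : ∃ g : Fin n → Fam n T, (0 < J → ∀ j, DerivSnd j f (g j)) ∧
      (0 < J → ∀ j, Reg L (J - 1) (fun i l => B i (l + 1)) (g j)) := by
    rcases Nat.eq_zero_or_pos J with h | h
    · exact ⟨fun _ => f, by omega, by omega⟩
    · choose g hg1 hg2 using hh (J - 1) (by omega)
      exact ⟨g, fun _ => hg1, fun _ => hg2⟩
  obtain ⟨g, hg1, hg2⟩ := h1
  obtain ⟨k, hk1, hk2⟩ := h2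
  exact mk L J B f g k hB hg1 hg2 hk1 hk2

theorem mono_order (h : Reg L J B f) (hL : L' ≤ L) (hJ : J' ≤ J) : Reg L' J' B f := by
  induction h generalizing L' J' with
  | mk L J B f g h hB hg hgR hh hhR ih1 ih2 =>
    exact mk _ _ _ _ g h hB (fun h0 => hg (by omega))
      (fun h0 j => ih1 (by omega) j (by omega) hJ) (fun h0 => hh (by omega))
      (fun h0 j => ih2 (by omega) j hL (by omega))

/-- Operators that commute with the partial derivatives preserve regularity. -/
theorem map {B' : ℕ → ℕ → Fam n T' → Prop} {Φ : Fam n T → Fam n T'} (h : Reg L J B f)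
    (hΦ : ∀ i l f, B i l f → B' i l (Φ f))
    (hF : ∀ i l j f g, B i l f → B (i + 1) l g → DerivFst j f g → DerivFst j (Φ f) (Φ g))
    (hS : ∀ i l j f g, B i l f → B i (l + 1) g → DerivSnd j f g → DerivSnd j (Φ f) (Φ g)) :
    Reg L J B' (Φ f) := by
  induction h generalizing B' with
  | mk L J B f g h hB hg hgR hh hhR ih1 ih2 =>
    refine mk _ _ _ _ (fun j => Φ (g j)) (fun j => Φ (h j)) (hΦ _ _ _ hB)
      (fun h0 j => hF _ _ _ _ _ hB (hgR h0 j).base (hg h0 j))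
      (fun h0 j => ih1 h0 j (fun i l f hf => hΦ _ _ _ hf)
        (fun i l j f g hf hg => hF _ _ _ _ _ hf hg)
        (fun i l j f g hf hg => hS _ _ _ _ _ hf hg))
      (fun h0 j => hS _ _ _ _ _ hB (hhR h0 j).base (hh h0 j))
      (fun h0 j => ih2 h0 j (fun i l f hf => hΦ _ _ _ hf)
        (fun i l j f g hf hg => hF _ _ _ _ _ hf hg)
        (fun i l j f g hf hg => hS _ _ _ _ _ hf hg))

theorem mono (h : Reg L J B f) (hB : ∀ i l f, B i l f → B' i l f) : Reg L J B' f :=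
  h.map (Φ := id) hB (fun _ _ _ _ _ _ _ h => h) (fun _ _ _ _ _ _ _ h => h)

end Reg

theorem DerivFst.add {j : Fin n} {f g f' g' : Fam n T} (h : DerivFst j f f')
    (h' : DerivFst j g g') : DerivFst j (f + g) (f' + g') :=
  fun t y η => HasDerivAt.add (h t y η) (h' t y η)

theorem DerivSnd.add {j : Fin n} {f g f' g' : Fam n T} (h : DerivSnd j f f')
    (h' : DerivSnd j g g') : DerivSnd j (f + g) (f' + g') :=
  fun t y η => HasDerivAt.add (h t y η) (h' t y η)

theorem DerivFst.mul {j : Fin n} {f g f' g' : Fam n T} (h : DerivFst j f f')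
    (h' : DerivFst j g g') : DerivFst j (f * g) (f' * g + f * g') :=
  fun t y η => by simpa using! HasDerivAt.mul (h t y η) (h' t y η)

theorem DerivSnd.mul {j : Fin n} {f g f' g' : Fam n T} (h : DerivSnd j f f')
    (h' : DerivSnd j g g') : DerivSnd j (f * g) (f' * g + f * g') :=
  fun t y η => by simpa using! HasDerivAt.mul (h t y η) (h' t y η)

theorem DerivFst.const_mul {j : Fin n} {f f' : Fam n T} (c : T → ℂ) (h : DerivFst j f f') :
    DerivFst j (fun t y η => c t * f t y η) (fun t y η => c t * f' t y η) :=
  fun t y η => HasDerivAt.const_mul (c t) (h t y η)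

theorem DerivSnd.const_mul {j : Fin n} {f f' : Fam n T} (c : T → ℂ) (h : DerivSnd j f f') :
    DerivSnd j (fun t y η => c t * f t y η) (fun t y η => c t * f' t y η) :=
  fun t y η => HasDerivAt.const_mul (c t) (h t y η)

theorem derivFst_zero (j : Fin n) : DerivFst j (0 : Fam n T) 0 :=
  fun _ _ _ => hasDerivAt_const _ _

theorem derivSnd_zero (j : Fin n) : DerivSnd j (0 : Fam n T) 0 :=
  fun _ _ _ => hasDerivAt_const _ _

namespace Reg

variable {L J L' J' : ℕ} {B B' B₁ B₂ : ℕ → ℕ → Fam n T → Prop} {f g : Fam n T}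

theorem add (hB : ∀ i l f g, B i l f → B i l g → B i l (f + g)) (h₁ : Reg L J B f)
    (h₂ : Reg L J B g) : Reg L J B (f + g) := by
  induction h₁ generalizing g with
  | mk L J B f f' f'' hf hg hgR hh hhR ih1 ih2 =>
    cases h₂ with
    | mk _ _ _ _ g' g'' hf' hg' hgR' hh' hhR' =>
      exact mk _ _ _ _ (fun j => f' j + g' j) (fun j => f'' j + g'' j) (hB _ _ _ _ hf hf')
        (fun h0 j => (hg h0 j).add (hg' h0 j))
        (fun h0 j => ih1 h0 j (fun i l f g => hB _ _ f g) (hgR' h0 j))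
        (fun h0 j => (hh h0 j).add (hh' h0 j))
        (fun h0 j => ih2 h0 j (fun i l f g => hB _ _ f g) (hhR' h0 j))

theorem zero (hB : ∀ i l, B i l 0) : Reg L J B (0 : Fam n T) := by
  induction hN : L + J generalizing L J B with
  | zero => exact intro (hB _ _) (by omega) (by omega)
  | succ N ih =>
    refine intro (hB _ _) (fun L' h j => ⟨0, derivFst_zero j, ih (fun _ _ => hB _ _) (by omega)⟩)
      (fun L' h j => ⟨0, derivSnd_zero j, ih (fun _ _ => hB _ _) (by omega)⟩)

theorem sum {ι : Type*} (s : Finset ι) (F : ι → Fam n T)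
    (hB0 : ∀ i l, B i l 0)
    (hB : ∀ i l f g, B i l f → B i l g → B i l (f + g)) (h : ∀ i ∈ s, Reg L J B (F i)) :
    Reg L J B (∑ i ∈ s, F i) := by
  classical
  induction s using Finset.induction_on with
  | empty => simpa using zero hB0
  | insert a s ha ih =>
    rw [Finset.sum_insert ha]
    exact add hB (h a (Finset.mem_insert_self a s))
      (ih fun i hi => h i (Finset.mem_insert_of_mem hi))

/-- The Leibniz rule. -/
theorem mul (hB : ∀ i l f g, B i l f → B i l g → B i l (f + g))
    (hmul : ∀ i l i' l' f g, B₁ i l f → B₂ i' l' g → B (i + i') (l + l') (f * g))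
    (h₁ : Reg L J B₁ f) (h₂ : Reg L J B₂ g) : Reg L J B (f * g) := by
  induction hN : L + J generalizing L J B₁ B₂ B f g with
  | zero =>
    exact intro (by simpa using hmul _ _ _ _ _ _ h₁.base h₂.base) (by omega) (by omega)
  | succ N ih =>
    refine intro (by simpa using hmul _ _ _ _ _ _ h₁.base h₂.base) ?_ ?_
    · rintro L' rfl j
      obtain ⟨f', hf, hf'⟩ := h₁.fst j
      obtain ⟨g', hg, hg'⟩ := h₂.fst j
      refine ⟨_, hf.mul hg, add (fun i l f g => hB _ _ _ _) ?_ ?_⟩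
      · refine ih (fun i l f g => hB _ _ _ _) (fun i l i' l' f g h h' => ?_) hf'
          (h₂.mono_order (Nat.le_succ L') le_rfl) (by omega)
        have := hmul _ _ _ _ _ _ h h'
        rwa [show i + i' + 1 = i + 1 + i' by ring]
      · refine ih (fun i l f g => hB _ _ _ _) (fun i l i' l' f g h h' => ?_)
          (h₁.mono_order (Nat.le_succ L') le_rfl) hg' (by omega)
        exact hmul i l (i' + 1) l' _ _ h h'
    · rintro J' rfl j
      obtain ⟨f', hf, hf'⟩ := h₁.snd j
      obtain ⟨g', hg, hg'⟩ := h₂.snd j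
      refine ⟨_, hf.mul hg, add (fun i l f g => hB _ _ _ _) ?_ ?_⟩
      · refine ih (fun i l f g => hB _ _ _ _) (fun i l i' l' f g h h' => ?_) hf'
          (h₂.mono_order le_rfl (Nat.le_succ J')) (by omega)
        have := hmul _ _ _ _ _ _ h h'
        rwa [show l + l' + 1 = l + 1 + l' by ring]
      · refine ih (fun i l f g => hB _ _ _ _) (fun i l i' l' f g h h' => ?_)
          (h₁.mono_order le_rfl (Nat.le_succ J')) hg' (by omega)
        exact hmul i l i' (l' + 1) _ _ h h'

/-- Reindexing the parameter. -/
theorem reindex {B' : ℕ → ℕ → Fam n T' → Prop} (h : Reg L J B f) (ψ : T' → T)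
    (hB : ∀ i l f, B i l f → B' i l (fun t => f (ψ t))) : Reg L J B' (fun t => f (ψ t)) :=
  h.map (Φ := fun f t => f (ψ t)) hB (fun _ _ _ _ _ _ _ h t => h (ψ t))
    (fun _ _ _ _ _ _ _ h t => h (ψ t))

/-- Multiplication by functions of the parameter. -/
theorem const_mul (h : Reg L J B f) (c : T → ℂ)
    (hB : ∀ i l f, B i l f → B' i l (fun t y η => c t * f t y η)) :
    Reg L J B' (fun t y η => c t * f t y η) :=
  h.map (Φ := fun f t y η => c t * f t y η) hB (fun _ _ _ _ _ _ _ h => h.const_mul c)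
    (fun _ _ _ _ _ _ _ h => h.const_mul c)

end Reg

/-! ### Amplitudes -/

/-- The requirement on the derivatives of an amplitude with weights `⟨η⟩^p ⟨y⟩^q`, uniformly in the
parameter: each derivative in `y` costs a factor `⟨η⟩^δ`, derivatives in `η` cost nothing. -/
def AmpB (δ p q : ℝ) (i _l : ℕ) (f : Fam n T) : Prop :=
  (∀ t, Continuous fun z : E n × E n => f t z.1 z.2) ∧
  ∃ C, 0 ≤ C ∧ ∀ t y η, ‖f t y η‖ ≤ C * (jb η ^ (p + δ * i) * jb y ^ q)

/-- Rapid decay in `(y, η)`, for every parameter. -/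
def RapidB (f : Fam n T) : Prop :=
  ∀ t, ∀ P : ℝ, ∃ C, 0 ≤ C ∧ ∀ y η, ‖f t y η‖ ≤ C * (jb η ^ (-P) * jb y ^ (-P))

theorem AmpB.add {δ p q : ℝ} {i l : ℕ} {f g : Fam n T} (hf : AmpB δ p q i l f)
    (hg : AmpB δ p q i l g) : AmpB δ p q i l (f + g) := by
  obtain ⟨hf0, C, hC, hf⟩ := hf
  obtain ⟨hg0, D, hD, hg⟩ := hg
  refine ⟨fun t => (hf0 t).add (hg0 t), C + D, by positivity, fun t y η => ?_⟩
  rw [add_mul]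
  exact (norm_add_le _ _).trans (add_le_add (hf t y η) (hg t y η))

theorem AmpB.zero {δ p q : ℝ} {i l : ℕ} : AmpB δ p q i l (0 : Fam n T) :=
  ⟨fun _ => continuous_const, 0, le_rfl, fun t y η => by simp⟩

theorem AmpB.mul {δ p q p' q' : ℝ} {i l i' l' l'' : ℕ} {f g : Fam n T} (hf : AmpB δ p q i l f)
    (hg : AmpB δ p' q' i' l' g) : AmpB δ (p + p') (q + q') (i + i') l'' (f * g) := by
  obtain ⟨hf0, C, hC, hf⟩ := hf
  obtain ⟨hg0, D, hD, hg⟩ := hg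
  refine ⟨fun t => (hf0 t).mul (hg0 t), C * D, by positivity, fun t y η => ?_⟩
  have h1 : jb η ^ (p + p' + δ * ((i + i' : ℕ) : ℝ)) = jb η ^ (p + δ * i) * jb η ^ (p' + δ * i') := by
    rw [← jb_rpow_add]; congr 1; push_cast; ring
  rw [h1, jb_rpow_add y q q']
  calc ‖(f * g) t y η‖ = ‖f t y η‖ * ‖g t y η‖ := norm_mul _ _
    _ ≤ _ := mul_le_mul (hf t y η) (hg t y η) (norm_nonneg _) ((norm_nonneg _).trans (hf t y η))
    _ = _ := by ring

theorem AmpB.mono {δ p q p' q' : ℝ} {i l i' l' : ℕ} {f : Fam n T} (hf : AmpB δ p q i l f)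
    (hp : p + δ * i ≤ p' + δ * i') (hq : q ≤ q') : AmpB δ p' q' i' l' f := by
  obtain ⟨hf0, C, hC, hf⟩ := hf
  refine ⟨hf0, C, hC, fun t y η => (hf t y η).trans ?_⟩
  exact mul_le_mul_of_nonneg_left (mul_le_mul (jb_rpow_le η hp) (jb_rpow_le y hq)
    (jb_rpow_pos _ _).le (jb_rpow_pos _ _).le) hC

theorem AmpB.const_mul {δ p q : ℝ} {i l : ℕ} {f : Fam n T} {c : T → ℂ} {K : ℝ}
    (hf : AmpB δ p q i l f) (hc : ∀ t, ‖c t‖ ≤ K) :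
    AmpB δ p q i l (fun t y η => c t * f t y η) := by
  obtain ⟨hf0, C, hC, hf⟩ := hf
  refine ⟨fun t => continuous_const.mul (hf0 t), |K| * C, by positivity, fun t y η => ?_⟩
  rw [norm_mul, mul_assoc]
  exact mul_le_mul ((hc t).trans (le_abs_self K)) (hf t y η) (norm_nonneg _) (abs_nonneg K)

theorem AmpB.reindex {δ p q : ℝ} {i l : ℕ} {f : Fam n T} (hf : AmpB δ p q i l f) (ψ : T' → T) :
    AmpB δ p q i l (fun t => f (ψ t)) := by
  obtain ⟨hf0, C, hC, hf⟩ := hf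
  exact ⟨fun t => hf0 _, C, hC, fun t => hf _⟩

theorem RapidB.add {f g : Fam n T} (hf : RapidB f) (hg : RapidB g) : RapidB (f + g) := by
  intro t P
  obtain ⟨C, hC, hf⟩ := hf t P
  obtain ⟨D, hD, hg⟩ := hg t P
  refine ⟨C + D, by positivity, fun y η => ?_⟩
  rw [add_mul]
  exact (norm_add_le _ _).trans (add_le_add (hf y η) (hg y η))

theorem RapidB.zero : RapidB (0 : Fam n T) :=
  fun t P => ⟨0, le_rfl, fun y η => by simp⟩

theorem RapidB.const_mul {f : Fam n T} (c : T → ℂ) (hf : RapidB f) :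
    RapidB (fun t y η => c t * f t y η) := by
  intro t P
  obtain ⟨C, hC, hf⟩ := hf t P
  refine ⟨‖c t‖ * C, by positivity, fun y η => ?_⟩
  rw [norm_mul, mul_assoc]
  exact mul_le_mul_of_nonneg_left (hf y η) (norm_nonneg _)

theorem RapidB.reindex {f : Fam n T} (hf : RapidB f) (ψ : T' → T) : RapidB (fun t => f (ψ t)) :=
  fun t P => hf (ψ t) P

theorem RapidB.mul_ampB {δ p q : ℝ} {i l : ℕ} {f g : Fam n T} (hg : RapidB g)
    (hf : AmpB δ p q i l f) : RapidB (g * f) := by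
  intro t P
  obtain ⟨-, C, hC, hf⟩ := hf
  obtain ⟨D, hD, hg⟩ := hg t (P + |p + δ * i| + |q|)
  refine ⟨D * C, by positivity, fun y η => ?_⟩
  have h1 : jb η ^ (-(P + |p + δ * i| + |q|)) * jb η ^ (p + δ * i) ≤ jb η ^ (-P) := by
    rw [← jb_rpow_add]
    exact jb_rpow_le η (by linarith [le_abs_self (p + δ * i), abs_nonneg q])
  have h2 : jb y ^ (-(P + |p + δ * i| + |q|)) * jb y ^ q ≤ jb y ^ (-P) := by
    rw [← jb_rpow_add]
    exact jb_rpow_le y (by linarith [le_abs_self q, abs_nonneg (p + δ * i)])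
  have := jb_rpow_pos η (-P)
  have := jb_rpow_pos y (-(P + |p + δ * i| + |q|))
  have := jb_rpow_pos y q
  calc ‖(g * f) t y η‖ = ‖g t y η‖ * ‖f t y η‖ := norm_mul _ _
    _ ≤ _ := mul_le_mul (hg y η) (hf t y η) (norm_nonneg _) ((norm_nonneg _).trans (hg y η))
    _ = D * C * ((jb η ^ (-(P + |p + δ * i| + |q|)) * jb η ^ (p + δ * i)) *
        (jb y ^ (-(P + |p + δ * i| + |q|)) * jb y ^ q)) := by ring
    _ ≤ _ := by gcongr

/-- The requirement for rapidly decaying amplitudes. -/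
def RAmpB (δ p q : ℝ) (i l : ℕ) (f : Fam n T) : Prop := AmpB δ p q i l f ∧ RapidB f

theorem RAmpB.add {δ p q : ℝ} {i l : ℕ} {f g : Fam n T} (hf : RAmpB δ p q i l f)
    (hg : RAmpB δ p q i l g) : RAmpB δ p q i l (f + g) := ⟨hf.1.add hg.1, hf.2.add hg.2⟩

theorem RAmpB.mul {δ p q p' q' : ℝ} {i l i' l' l'' : ℕ} {f g : Fam n T} (hf : AmpB δ p q i l f)
    (hg : RAmpB δ p' q' i' l' g) : RAmpB δ (p + p') (q + q') (i + i') l'' (f * g) :=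
  ⟨hf.mul hg.1, by rw [mul_comm]; exact hg.2.mul_ampB hf⟩

theorem RAmpB.zero {δ p q : ℝ} {i l : ℕ} : RAmpB δ p q i l (0 : Fam n T) :=
  ⟨AmpB.zero, RapidB.zero⟩

/-! ### The coefficients of the integrations by parts -/

/-- `⟨η⟩⁻²` -/
noncomputable def wt (η : E n) : ℂ := (((1 + ‖η‖ ^ 2)⁻¹ : ℝ) : ℂ)

/-- `η_j ⟨η⟩⁻²` -/
noncomputable def wtc (j : Fin n) (η : E n) : ℂ := ((η j * (1 + ‖η‖ ^ 2)⁻¹ : ℝ) : ℂ)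

/-- The identity `1 = ⟨η⟩⁻² + ∑ j, η_j (η_j ⟨η⟩⁻²)`, in which each outer factor `η_j` can be removed
by an integration by parts. -/
theorem wt_add_sum (η : E n) : wt η + ∑ j, (η j : ℂ) * wtc j η = 1 := by
  have h : (1 + ‖η‖ ^ 2)⁻¹ + ∑ j, η j * (η j * (1 + ‖η‖ ^ 2)⁻¹) = 1 := by
    have h1 : ‖η‖ ^ 2 = ∑ j, η j * η j := by
      rw [EuclideanSpace.real_norm_sq_eq]; exact Finset.sum_congr rfl fun j _ => sq _
    have h2 : ∑ j, η j * (η j * (1 + ‖η‖ ^ 2)⁻¹) = ‖η‖ ^ 2 * (1 + ‖η‖ ^ 2)⁻¹ := by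
      rw [h1, Finset.sum_mul]; exact Finset.sum_congr rfl fun j _ => by ring
    rw [h2]
    field_simp
  simp only [wt, wtc]
  exact_mod_cast h

theorem hasLineDerivAt_coord (i j : Fin n) (η : E n) :
    HasLineDerivAt ℝ (fun ζ : E n => ζ j) (if i = j then 1 else 0) η (bv i) := by
  have h := (EuclideanSpace.proj (𝕜 := ℝ) j).hasFDerivAt (x := η)
  have := h.hasLineDerivAt (bv i)
  simpa [bv, Pi.single_apply, eq_comm] using! this

theorem hasLineDerivAt_inv_bracket (i : Fin n) (η : E n) :
    HasLineDerivAt ℝ (fun ζ : E n => (1 + ‖ζ‖ ^ 2)⁻¹)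
      (-2 * η i * ((1 + ‖η‖ ^ 2)⁻¹) ^ 2) η (bv i) := by
  have h := (hasStrictFDerivAt_norm_sq η).hasFDerivAt.hasLineDerivAt (bv i)
  have h1 : HasDerivAt (fun s : ℝ => 1 + ‖η + s • bv i‖ ^ 2) (2 * η i) 0 := by
    have := HasDerivAt.const_add (1 : ℝ) h
    simpa [bv, EuclideanSpace.inner_single_right] using! this
  have h2 := h1.inv (by simp; positivity)
  simp only [zero_smul, add_zero] at h2
  refine HasDerivAt.congr_deriv h2 ?_
  rw [div_eq_mul_inv, inv_pow]
  ring

theorem hasLineDerivAt_wt (i : Fin n) (η : E n) :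
    HasLineDerivAt ℝ (wt : E n → ℂ) (-2 * (wt η * wtc i η)) η (bv i) := by
  refine HasDerivAt.congr_deriv (HasDerivAt.ofReal_comp (hasLineDerivAt_inv_bracket i η)) ?_
  simp only [wt, wtc]; push_cast; ring

theorem hasLineDerivAt_wtc (i j : Fin n) (η : E n) :
    HasLineDerivAt ℝ (wtc j : E n → ℂ)
      ((if i = j then 1 else 0) * wt η + -2 * (wtc i η * wtc j η)) η (bv i) := by
  have h := HasDerivAt.mul (hasLineDerivAt_coord i j η) (hasLineDerivAt_inv_bracket i η)
  refine HasDerivAt.congr_deriv (HasDerivAt.ofReal_comp h) ?_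
  simp only [wt, wtc, zero_smul, add_zero]
  split_ifs <;> push_cast <;> ring

theorem continuous_wt : Continuous (wt : E n → ℂ) := by
  unfold wt
  refine Complex.continuous_ofReal.comp (Continuous.inv₀ (by fun_prop) fun x => ?_)
  positivity

theorem continuous_wtc (j : Fin n) : Continuous (wtc j : E n → ℂ) := by
  unfold wtc
  refine Complex.continuous_ofReal.comp (Continuous.mul (by fun_prop)
    (Continuous.inv₀ (by fun_prop) fun x => ?_))
  positivity

theorem norm_wt_le (η : E n) : ‖wt η‖ ≤ jb η ^ (-1 : ℝ) := by
  rw [wt, Complex.norm_real, Real.norm_of_nonneg (by positivity), ← jb_sq, Real.rpow_neg_one]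
  have := one_le_jb η
  exact inv_anti₀ (by linarith) (by nlinarith)

theorem norm_wtc_le (j : Fin n) (η : E n) : ‖wtc j η‖ ≤ jb η ^ (-1 : ℝ) := by
  rw [wtc, Complex.norm_real, norm_mul, Real.norm_of_nonneg (by positivity : 0 ≤ (1 + ‖η‖ ^ 2)⁻¹),
    ← jb_sq, Real.rpow_neg_one]
  have h1 := jb_pos η
  have h2 : ‖η j‖ ≤ jb η := (PiLp.norm_apply_le η j).trans (norm_le_jb η)
  calc ‖η j‖ * (jb η ^ 2)⁻¹ ≤ jb η * (jb η ^ 2)⁻¹ := by gcongr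
    _ = (jb η)⁻¹ := by field_simp

/-- Regularity of a family of functions whose derivatives are combinations of products of functions
from the family. -/
theorem Reg.of_algebra {ι : Type*} (u : ι → Fam n T) (B : Fam n T → Prop)
    (hadd : ∀ f g, B f → B g → B (f + g)) (hmul : ∀ f g, B f → B g → B (f * g))
    (hsmul : ∀ (c : ℂ) f, B f → B (fun t y η => c * f t y η)) (hu : ∀ a, B (u a))
    (hF : ∀ j a, ∃ (c c' : ℂ) (a₁ a₂ a₃ : ι), DerivFst j (u a)
      ((fun t y η => c * u a₁ t y η) + fun t y η => c' * (u a₂ * u a₃) t y η))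
    (hS : ∀ j a, ∃ (c c' : ℂ) (a₁ a₂ a₃ : ι), DerivSnd j (u a)
      ((fun t y η => c * u a₁ t y η) + fun t y η => c' * (u a₂ * u a₃) t y η))
    (L J : ℕ) (a : ι) : Reg L J (fun _ _ => B) (u a) := by
  induction hN : L + J generalizing L J a with
  | zero => exact intro (hu a) (by omega) (by omega)
  | succ N ih =>
    have key : ∀ (c c' : ℂ) (a₁ a₂ a₃ : ι) L' J', L' + J' = N → Reg L' J' (fun _ _ => B)
        ((fun t y η => c * u a₁ t y η) + fun t y η => c' * (u a₂ * u a₃) t y η) := by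
      intro c c' a₁ a₂ a₃ L' J' h
      refine add (fun _ _ => hadd) ((ih L' J' a₁ h).const_mul (fun _ => c) fun _ _ f => hsmul c f) ?_
      exact (mul (B := fun _ _ => B) (fun _ _ => hadd) (fun _ _ _ _ => hmul) (ih L' J' a₂ h)
        (ih L' J' a₃ h)).const_mul (fun _ => c') fun _ _ f => hsmul c' f
    refine intro (hu a) ?_ ?_
    · rintro L' rfl j
      obtain ⟨c, c', a₁, a₂, a₃, h⟩ := hF j a
      exact ⟨_, h, key _ _ _ _ _ _ _ (by omega)⟩
    · rintro J' rfl j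
      obtain ⟨c, c', a₁, a₂, a₃, h⟩ := hS j a
      exact ⟨_, h, key _ _ _ _ _ _ _ (by omega)⟩

/-- The functions `⟨η⟩⁻²` (index `none`) and `η_j ⟨η⟩⁻²` (index `some j`) have derivatives that are
again polynomials in these functions. -/
theorem hasLineDerivAt_wt_elim (i : Fin n) (a : Option (Fin n)) :
    ∃ (c c' : ℂ) (a₁ a₂ a₃ : Option (Fin n)), ∀ η, HasLineDerivAt ℝ (a.elim (wt : E n → ℂ) wtc)
      (c * a₁.elim wt wtc η + c' * (a₂.elim wt wtc η * a₃.elim wt wtc η)) η (bv i) := by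
  cases a with
  | none =>
    exact ⟨0, -2, none, none, some i, fun η => by simpa using hasLineDerivAt_wt i η⟩
  | some j =>
    exact ⟨if i = j then 1 else 0, -2, none, some i, some j, fun η => hasLineDerivAt_wtc i j η⟩

theorem continuous_wt_elim (a : Option (Fin n)) : Continuous (a.elim (wt : E n → ℂ) wtc) := by
  cases a
  exacts [continuous_wt, continuous_wtc _]

theorem norm_wt_elim_le (a : Option (Fin n)) (η : E n) :
    ‖a.elim (wt : E n → ℂ) wtc η‖ ≤ jb η ^ (-1 : ℝ) := by
  cases a
  exacts [norm_wt_le _, norm_wtc_le _ _]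

theorem AmpB.mul_of_nonpos {δ p q : ℝ} (hp : p ≤ 0) (hq : q ≤ 0) {f g : Fam n T}
    (hf : AmpB δ p q 0 0 f) (hg : AmpB δ p q 0 0 g) : AmpB δ p q 0 0 (f * g) :=
  (hf.mul (l'' := 0) hg).mono (by simp; linarith) (by linarith)

theorem reg_wt_snd {δ : ℝ} (hδ : 0 ≤ δ) (L J : ℕ) (a : Option (Fin n)) :
    Reg L J (AmpB δ (-1) 0) (fun (_ : T) _ η => a.elim (wt : E n → ℂ) wtc η) := by
  refine (Reg.of_algebra (fun (a : Option (Fin n)) (_ : T) _ η => a.elim (wt : E n → ℂ) wtc η)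
    (AmpB δ (-1) 0 0 0) (fun _ _ => AmpB.add) (fun _ _ => AmpB.mul_of_nonpos (by simp) le_rfl)
    (fun c f hf => hf.const_mul (c := fun _ => c) (K := ‖c‖) fun _ => le_rfl) ?_ ?_ ?_ L J a).mono ?_
  · exact fun a => ⟨fun t => (continuous_wt_elim a).comp continuous_snd, 1, zero_le_one,
      fun t y η => by simpa using norm_wt_elim_le a η⟩
  · exact fun j a => ⟨0, 0, a, a, a, fun t y η => by
      simpa [HasLineDerivAt] using! hasDerivAt_const (0 : ℝ) (a.elim (wt : E n → ℂ) wtc η)⟩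
  · intro j a
    obtain ⟨c, c', a₁, a₂, a₃, h⟩ := hasLineDerivAt_wt_elim j a
    exact ⟨c, c', a₁, a₂, a₃, fun t y η => h η⟩
  · exact fun i l f hf => hf.mono (by simp; positivity) le_rfl

theorem reg_wt_fst {δ : ℝ} (hδ : 0 ≤ δ) (L J : ℕ) (a : Option (Fin n)) :
    Reg L J (AmpB δ 0 (-1)) (fun (_ : T) y _ => a.elim (wt : E n → ℂ) wtc y) := by
  refine (Reg.of_algebra (fun (a : Option (Fin n)) (_ : T) y _ => a.elim (wt : E n → ℂ) wtc y)
    (AmpB δ 0 (-1) 0 0) (fun _ _ => AmpB.add) (fun _ _ => AmpB.mul_of_nonpos le_rfl (by simp))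
    (fun c f hf => hf.const_mul (c := fun _ => c) (K := ‖c‖) fun _ => le_rfl) ?_ ?_ ?_ L J a).mono ?_
  · exact fun a => ⟨fun t => (continuous_wt_elim a).comp continuous_fst, 1, zero_le_one,
      fun t y η => by simpa using norm_wt_elim_le a y⟩
  · intro j a
    obtain ⟨c, c', a₁, a₂, a₃, h⟩ := hasLineDerivAt_wt_elim j a
    exact ⟨c, c', a₁, a₂, a₃, fun t y η => h y⟩
  · exact fun j a => ⟨0, 0, a, a, a, fun t y η => by
      simpa [HasLineDerivAt] using! hasDerivAt_const (0 : ℝ) (a.elim (wt : E n → ℂ) wtc y)⟩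
  · exact fun i l f hf => hf.mono (by simp; positivity) le_rfl

/-! ### Integration by parts -/

/-- `e^{-iy·η}` -/
noncomputable def osc (z : E n × E n) : ℂ := Complex.exp (-Complex.I * ((inner ℝ z.1 z.2 : ℝ) : ℂ))

theorem norm_osc (z : E n × E n) : ‖osc z‖ = 1 := by
  rw [osc, Complex.norm_exp]; simp

theorem continuous_osc : Continuous (osc : E n × E n → ℂ) := by
  unfold osc; fun_prop

theorem integrable_of_rapid {u : E n → E n → ℂ} (hc : Continuous fun z : E n × E n => u z.1 z.2)
    {C P : ℝ} (hP : (n : ℝ) < P) (hu : ∀ y η, ‖u y η‖ ≤ C * (jb η ^ (-P) * jb y ^ (-P))) :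
    Integrable fun z : E n × E n => u z.1 z.2 := by
  have h := integrable_jb_rpow (n := n) (r := -P) (by linarith)
  refine ((h.mul_prod h).const_mul C).mono' hc.aestronglyMeasurable
    (Eventually.of_forall fun z => (hu z.1 z.2).trans_eq ?_)
  ring

theorem integrable_osc_mul {u : E n × E n → ℂ} (hu : Integrable u) :
    Integrable fun z => osc z * u z := by
  refine hu.bdd_mul (c := 1) continuous_osc.aestronglyMeasurable
    (Eventually.of_forall fun z => (norm_osc z).le)

theorem hasLineDerivAt_osc_fst (j : Fin n) (z : E n × E n) :
    HasLineDerivAt ℝ (osc : E n × E n → ℂ) (-Complex.I * (z.2 j : ℂ) * osc z) z (bv j, 0) := by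
  have h1 : HasDerivAt (fun s : ℝ => (inner ℝ (z + s • ((bv j, 0) : E n × E n)).1
      (z + s • ((bv j, 0) : E n × E n)).2 : ℝ)) (z.2 j) 0 := by
    have : (fun s : ℝ => (inner ℝ (z + s • ((bv j, 0) : E n × E n)).1
      (z + s • ((bv j, 0) : E n × E n)).2 : ℝ)) = fun s => inner ℝ z.1 z.2 + s * z.2 j := by
      funext s
      simp [inner_add_left, inner_smul_left, bv, EuclideanSpace.inner_single_left]
    rw [this]
    simpa using ((hasDerivAt_id (0 : ℝ)).mul_const (z.2 j)).const_add (inner ℝ z.1 z.2)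
  have h2 := (h1.ofReal_comp.const_mul (-Complex.I)).cexp
  refine HasDerivAt.congr_deriv h2 ?_
  simp [osc]; ring

theorem hasLineDerivAt_osc_snd (j : Fin n) (z : E n × E n) :
    HasLineDerivAt ℝ (osc : E n × E n → ℂ) (-Complex.I * (z.1 j : ℂ) * osc z) z (0, bv j) := by
  have h1 : HasDerivAt (fun s : ℝ => (inner ℝ (z + s • ((0, bv j) : E n × E n)).1
      (z + s • ((0, bv j) : E n × E n)).2 : ℝ)) (z.1 j) 0 := by
    have : (fun s : ℝ => (inner ℝ (z + s • ((0, bv j) : E n × E n)).1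
      (z + s • ((0, bv j) : E n × E n)).2 : ℝ)) = fun s => inner ℝ z.1 z.2 + s * z.1 j := by
      funext s
      simp [inner_add_right, inner_smul_right, bv, EuclideanSpace.inner_single_right]
    rw [this]
    simpa using ((hasDerivAt_id (0 : ℝ)).mul_const (z.1 j)).const_add (inner ℝ z.1 z.2)
  have h2 := (h1.ofReal_comp.const_mul (-Complex.I)).cexp
  refine HasDerivAt.congr_deriv h2 ?_
  simp [osc]; ring

/-- Integration by parts against `e^{-iy·η}` in a direction `v` in which the derivative of the phase
is `-i c`. -/
theorem integral_osc_mul_lineDeriv {u u' : E n × E n → ℂ} {c : E n × E n → ℂ} {v : E n × E n}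
    (ho : ∀ z, HasLineDerivAt ℝ (osc : E n × E n → ℂ) (-Complex.I * c z * osc z) z v)
    (h : ∀ z, HasLineDerivAt ℝ u (u' z) z v) (hu : Integrable u) (hu' : Integrable u')
    (hcu : Integrable fun z => c z * u z) :
    ∫ z, osc z * u' z = Complex.I * ∫ z, osc z * (c z * u z) := by
  have : (volume : Measure (E n × E n)).IsAddHaarMeasure := Measure.prod.instIsAddHaarMeasure _ _
  have := integral_bilinear_hasLineDerivAt_right_eq_neg_left_of_integrable (μ := volume)
    (f := osc) (f' := fun z => -Complex.I * c z * osc z) (g := u) (g' := u')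
    (v := v) (B := ContinuousLinearMap.mul ℝ ℂ) ?_ ?_ ?_ (fun z _ => ho z) (fun z _ => h z)
  · simp only [ContinuousLinearMap.mul_apply'] at this
    rw [this, ← integral_neg, ← integral_const_mul]
    congr 1; funext z; ring
  · simp only [ContinuousLinearMap.mul_apply']
    refine ((integrable_osc_mul hcu).const_mul (-Complex.I)).congr
      (Eventually.of_forall fun z => ?_)
    ring
  · exact integrable_osc_mul hu'
  · exact integrable_osc_mul hu

theorem DerivFst.prod {j : Fin n} {f g : Fam n T} (h : DerivFst j f g) (t : T) (z : E n × E n) :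
    HasLineDerivAt ℝ (fun z : E n × E n => f t z.1 z.2) (g t z.1 z.2) z (bv j, 0) := by
  simpa [HasLineDerivAt] using! h t z.1 z.2

theorem DerivSnd.prod {j : Fin n} {f g : Fam n T} (h : DerivSnd j f g) (t : T) (z : E n × E n) :
    HasLineDerivAt ℝ (fun z : E n × E n => f t z.1 z.2) (g t z.1 z.2) z (0, bv j) := by
  simpa [HasLineDerivAt] using! h t z.1 z.2

theorem RAmpB.integrable {δ p q : ℝ} {i l : ℕ} {f : Fam n T} (hf : RAmpB δ p q i l f) (t : T) :
    Integrable fun z : E n × E n => f t z.1 z.2 := by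
  obtain ⟨C, -, h⟩ := hf.2 t (n + 1)
  exact integrable_of_rapid (hf.1.1 t) (by linarith) h

theorem ampB_coord_snd (δ : ℝ) (j : Fin n) :
    AmpB δ 1 0 0 0 (fun (_ : T) (_ : E n) (η : E n) => (η j : ℂ)) :=
  ⟨fun t => by fun_prop, 1, zero_le_one, fun t y η => by
    simpa using (PiLp.norm_apply_le η j).trans (norm_le_jb η)⟩

theorem ampB_coord_fst (δ : ℝ) (j : Fin n) :
    AmpB δ 0 1 0 0 (fun (_ : T) (y : E n) (_ : E n) => (y j : ℂ)) :=
  ⟨fun t => by fun_prop, 1, zero_le_one, fun t y η => by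
    simpa using (PiLp.norm_apply_le y j).trans (norm_le_jb y)⟩

/-- One integration by parts with the operator `⟨η⟩⁻² (1 - i η · ∂_y)`, which is the transpose of
an operator that preserves `e^{-iy·η}`: the decay in `η` improves by `1 - δ`. -/
theorem exists_parts_fst {δ p q : ℝ} (hδ : 0 ≤ δ) {L J : ℕ} {f : Fam n T}
    (hf : Reg (L + 1) J (RAmpB δ p q) f) :
    ∃ g, Reg L J (RAmpB δ (p - (1 - δ)) q) g ∧
      ∀ t, ∫ z : E n × E n, osc z * g t z.1 z.2 = ∫ z : E n × E n, osc z * f t z.1 z.2 := by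
  choose f' hf' hR using fun j => hf.fst j
  -- `c none = ⟨η⟩⁻²` and `c (some j) = η_j ⟨η⟩⁻²`
  let c : Option (Fin n) → Fam n T := fun a _ _ η => a.elim (wt : E n → ℂ) wtc η
  refine ⟨c none * f + ∑ j, fun t y η => -Complex.I * (c (some j) * f' j) t y η, ?_, fun t => ?_⟩
  · refine Reg.add (fun _ _ _ _ => RAmpB.add) ?_ (Reg.sum _ _ (fun _ _ => RAmpB.zero)
      (fun _ _ _ _ => RAmpB.add) fun j _ => ?_)
    · refine Reg.mul (fun _ _ _ _ => RAmpB.add) (fun i l i' l' f g h h' => ?_)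
        (reg_wt_snd hδ L J none) (hf.mono_order (Nat.le_succ L) le_rfl)
      have := RAmpB.mul (l'' := l + l') h h'
      exact ⟨this.1.mono (by linarith) (by linarith), this.2⟩
    · refine Reg.const_mul (B := RAmpB δ (p - (1 - δ)) q) ?_ (fun _ => -Complex.I)
        fun i l f hf => ⟨hf.1.const_mul (K := 1) (by simp), hf.2.const_mul _⟩
      refine Reg.mul (fun _ _ _ _ => RAmpB.add) (fun i l i' l' f g h h' => ?_)
        (reg_wt_snd hδ L J (some j)) (hR j)
      have := RAmpB.mul (l'' := l + l') h h'
      exact ⟨this.1.mono (by push_cast; linarith) (by linarith), this.2⟩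
  · have hb := hf.base
    have e0 : Integrable fun z : E n × E n => (c none * f) t z.1 z.2 :=
      (RAmpB.mul (l'' := 0) (reg_wt_snd hδ 0 0 none).base hb).integrable t
    have e1 : ∀ j, RAmpB δ (-1 + p) (0 + q) (0 + 0) 0 (c (some j) * f) := fun j =>
      RAmpB.mul (l'' := 0) (reg_wt_snd hδ 0 0 (some j)).base hb
    have e1' : ∀ j, Integrable fun z : E n × E n => (c (some j) * f' j) t z.1 z.2 := fun j =>
      (RAmpB.mul (l'' := 0) (reg_wt_snd hδ 0 0 (some j)).base (hR j).base).integrable t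
    have e2 : ∀ j, Integrable fun z : E n × E n => (z.2 j : ℂ) * (c (some j) * f) t z.1 z.2 :=
      fun j => (RAmpB.mul (l'' := 0) (ampB_coord_snd δ j) (e1 j)).integrable t
    -- the integration by parts that moves the derivative onto the exponential
    have e3 : ∀ j, ∫ z : E n × E n, osc z * (c (some j) * f' j) t z.1 z.2 =
        Complex.I * ∫ z : E n × E n, osc z * ((z.2 j : ℂ) * (c (some j) * f) t z.1 z.2) := by
      intro j
      refine integral_osc_mul_lineDeriv (hasLineDerivAt_osc_fst j) (fun z => ?_)
        ((e1 j).integrable t) (e1' j) (e2 j)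
      refine DerivFst.prod (f := c (some j) * f) (g := c (some j) * f' j) (j := j) (fun t y η => ?_) t z
      exact HasDerivAt.const_mul (wtc j η) (hf' j t y η)
    -- `f = ⟨η⟩⁻² f + ∑ j, η_j (η_j ⟨η⟩⁻² f)`
    have e4 : ∀ z : E n × E n, osc z * f t z.1 z.2 = osc z * (c none * f) t z.1 z.2 +
        ∑ j, osc z * ((z.2 j : ℂ) * (c (some j) * f) t z.1 z.2) := by
      intro z
      have := wt_add_sum z.2
      rw [← Finset.mul_sum, ← mul_add]
      congr 1
      calc f t z.1 z.2 = (wt z.2 + ∑ j, (z.2 j : ℂ) * wtc j z.2) * f t z.1 z.2 := by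
            rw [this, one_mul]
        _ = _ := by
          rw [add_mul, Finset.sum_mul]
          congr 1
          exact Finset.sum_congr rfl fun j _ => mul_assoc _ _ _
    have e5 : ∀ z : E n × E n, osc z * ((c none * f + ∑ j, fun t y η => -Complex.I *
        (c (some j) * f' j) t y η) t z.1 z.2) = osc z * (c none * f) t z.1 z.2 +
        ∑ j, -Complex.I * (osc z * (c (some j) * f' j) t z.1 z.2) := by
      intro z
      simp only [Pi.add_apply, Finset.sum_apply, mul_add, Finset.mul_sum]
      congr 1
      exact Finset.sum_congr rfl fun j _ => by ring
    simp_rw [e4, e5]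
    rw [integral_add (integrable_osc_mul e0) (integrable_finsetSum _ fun j _ =>
      (integrable_osc_mul (e1' j)).const_mul _), integral_add (integrable_osc_mul e0)
      (integrable_finsetSum _ fun j _ => integrable_osc_mul (e2 j)),
      integral_finsetSum _ fun j _ => (integrable_osc_mul (e1' j)).const_mul _,
      integral_finsetSum _ fun j _ => integrable_osc_mul (e2 j)]
    congr 1
    refine Finset.sum_congr rfl fun j _ => ?_
    rw [integral_const_mul, e3 j, ← mul_assoc]
    simp

/-- One integration by parts with the operator `⟨y⟩⁻² (1 - i y · ∂_η)`: the decay in `y` improves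
by one. -/
theorem exists_parts_snd {δ p q : ℝ} (hδ : 0 ≤ δ) {L J : ℕ} {f : Fam n T}
    (hf : Reg L (J + 1) (RAmpB δ p q) f) :
    ∃ g, Reg L J (RAmpB δ p (q - 1)) g ∧
      ∀ t, ∫ z : E n × E n, osc z * g t z.1 z.2 = ∫ z : E n × E n, osc z * f t z.1 z.2 := by
  choose f' hf' hR using fun j => hf.snd j
  -- `c none = ⟨y⟩⁻²` and `c (some j) = y_j ⟨y⟩⁻²`
  let c : Option (Fin n) → Fam n T := fun a _ y _ => a.elim (wt : E n → ℂ) wtc y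
  refine ⟨c none * f + ∑ j, fun t y η => -Complex.I * (c (some j) * f' j) t y η, ?_, fun t => ?_⟩
  · refine Reg.add (fun _ _ _ _ => RAmpB.add) ?_ (Reg.sum _ _ (fun _ _ => RAmpB.zero)
      (fun _ _ _ _ => RAmpB.add) fun j _ => ?_)
    · refine Reg.mul (fun _ _ _ _ => RAmpB.add) (fun i l i' l' f g h h' => ?_)
        (reg_wt_fst hδ L J none) (hf.mono_order le_rfl (Nat.le_succ J))
      have := RAmpB.mul (l'' := l + l') h h'
      exact ⟨this.1.mono (by linarith) (by linarith), this.2⟩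
    · refine Reg.const_mul (B := RAmpB δ p (q - 1)) ?_ (fun _ => -Complex.I)
        fun i l f hf => ⟨hf.1.const_mul (K := 1) (by simp), hf.2.const_mul _⟩
      refine Reg.mul (fun _ _ _ _ => RAmpB.add) (fun i l i' l' f g h h' => ?_)
        (reg_wt_fst hδ L J (some j)) (hR j)
      have := RAmpB.mul (l'' := l + l') h h'
      exact ⟨this.1.mono (by linarith) (by linarith), this.2⟩
  · have hb := hf.base
    have e0 : Integrable fun z : E n × E n => (c none * f) t z.1 z.2 :=
      (RAmpB.mul (l'' := 0) (reg_wt_fst hδ 0 0 none).base hb).integrable t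
    have e1 : ∀ j, RAmpB δ (0 + p) (-1 + q) (0 + 0) 0 (c (some j) * f) := fun j =>
      RAmpB.mul (l'' := 0) (reg_wt_fst hδ 0 0 (some j)).base hb
    have e1' : ∀ j, Integrable fun z : E n × E n => (c (some j) * f' j) t z.1 z.2 := fun j =>
      (RAmpB.mul (l'' := 0) (reg_wt_fst hδ 0 0 (some j)).base (hR j).base).integrable t
    have e2 : ∀ j, Integrable fun z : E n × E n => (z.1 j : ℂ) * (c (some j) * f) t z.1 z.2 :=
      fun j => (RAmpB.mul (l'' := 0) (ampB_coord_fst δ j) (e1 j)).integrable t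
    -- the integration by parts that moves the derivative onto the exponential
    have e3 : ∀ j, ∫ z : E n × E n, osc z * (c (some j) * f' j) t z.1 z.2 =
        Complex.I * ∫ z : E n × E n, osc z * ((z.1 j : ℂ) * (c (some j) * f) t z.1 z.2) := by
      intro j
      refine integral_osc_mul_lineDeriv (hasLineDerivAt_osc_snd j) (fun z => ?_)
        ((e1 j).integrable t) (e1' j) (e2 j)
      refine DerivSnd.prod (f := c (some j) * f) (g := c (some j) * f' j) (j := j) (fun t y η => ?_) t z
      exact HasDerivAt.const_mul (wtc j y) (hf' j t y η)
    -- `f = ⟨y⟩⁻² f + ∑ j, y_j (y_j ⟨y⟩⁻² f)`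
    have e4 : ∀ z : E n × E n, osc z * f t z.1 z.2 = osc z * (c none * f) t z.1 z.2 +
        ∑ j, osc z * ((z.1 j : ℂ) * (c (some j) * f) t z.1 z.2) := by
      intro z
      have := wt_add_sum z.1
      rw [← Finset.mul_sum, ← mul_add]
      congr 1
      calc f t z.1 z.2 = (wt z.1 + ∑ j, (z.1 j : ℂ) * wtc j z.1) * f t z.1 z.2 := by
            rw [this, one_mul]
        _ = _ := by
          rw [add_mul, Finset.sum_mul]
          congr 1
          exact Finset.sum_congr rfl fun j _ => mul_assoc _ _ _
    have e5 : ∀ z : E n × E n, osc z * ((c none * f + ∑ j, fun t y η => -Complex.I *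
        (c (some j) * f' j) t y η) t z.1 z.2) = osc z * (c none * f) t z.1 z.2 +
        ∑ j, -Complex.I * (osc z * (c (some j) * f' j) t z.1 z.2) := by
      intro z
      simp only [Pi.add_apply, Finset.sum_apply, mul_add, Finset.mul_sum]
      congr 1
      exact Finset.sum_congr rfl fun j _ => by ring
    simp_rw [e4, e5]
    rw [integral_add (integrable_osc_mul e0) (integrable_finsetSum _ fun j _ =>
      (integrable_osc_mul (e1' j)).const_mul _), integral_add (integrable_osc_mul e0)
      (integrable_finsetSum _ fun j _ => integrable_osc_mul (e2 j)),
      integral_finsetSum _ fun j _ => (integrable_osc_mul (e1' j)).const_mul _,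
      integral_finsetSum _ fun j _ => integrable_osc_mul (e2 j)]
    congr 1
    refine Finset.sum_congr rfl fun j _ => ?_
    rw [integral_const_mul, e3 j, ← mul_assoc]
    simp

/-- The a priori estimate: the integral of `e^{-iy·η} f_t(y, η)` for rapidly decaying `f_t` is
bounded by the amplitude estimates alone, uniformly in `t`. -/
theorem exists_norm_integral_osc_le {δ p q : ℝ} (hδ : 0 ≤ δ) {L : ℕ} {f : Fam n T}
    (hf : Reg L (n + 1) (RAmpB δ p q) f) (hp : p - L * (1 - δ) < -n) (hq : q < 1) :
    ∃ C, 0 ≤ C ∧ ∀ t, ‖∫ z : E n × E n, osc z * f t z.1 z.2‖ ≤ C := by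
  -- `L` integrations by parts in `y` and `J` integrations by parts in `η`
  have h1 : ∀ L J p q (f : Fam n T), Reg L J (RAmpB δ p q) f → ∃ g, Reg 0 0 (RAmpB δ
      (p - L * (1 - δ)) (q - J)) g ∧
      ∀ t, ∫ z : E n × E n, osc z * g t z.1 z.2 = ∫ z : E n × E n, osc z * f t z.1 z.2 := by
    intro L
    induction L with
    | zero =>
      intro J
      induction J with
      | zero => exact fun p q f hf => ⟨f, by simpa using hf, fun t => rfl⟩
      | succ J ih =>
        intro p q f hf
        obtain ⟨g, hg, hg'⟩ := exists_parts_snd hδ hf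
        obtain ⟨k, hk, hk'⟩ := ih _ _ g hg
        refine ⟨k, ?_, fun t => (hk' t).trans (hg' t)⟩
        convert hk using 2
        push_cast; ring
    | succ L ih =>
      intro J p q f hf
      obtain ⟨g, hg, hg'⟩ := exists_parts_fst hδ hf
      obtain ⟨k, hk, hk'⟩ := ih _ _ _ g hg
      refine ⟨k, ?_, fun t => (hk' t).trans (hg' t)⟩
      convert hk using 2
      push_cast; ring
  obtain ⟨g, hg, hg'⟩ := h1 _ _ _ _ f hf
  obtain ⟨C, hC, h⟩ := hg.base.1.2
  -- what is left is absolutely integrable, since both remaining exponents are less than `-n`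
  refine ⟨∫ z : E n × E n, C * (jb z.1 ^ (q - (n + 1 : ℕ)) * jb z.2 ^ (p - L * (1 - δ))),
    integral_nonneg fun z => mul_nonneg hC (mul_nonneg (jb_rpow_pos _ _).le (jb_rpow_pos _ _).le),
    fun t => ?_⟩
  rw [← hg' t]
  refine norm_integral_le_of_norm_le ?_ (Eventually.of_forall fun z => ?_)
  · exact ((integrable_jb_rpow (by push_cast; linarith)).mul_prod
      (integrable_jb_rpow (by linarith))).const_mul C
  · rw [norm_mul, norm_osc, one_mul]
    refine (h t z.1 z.2).trans_eq ?_
    simp only [CharP.cast_eq_zero, mul_zero, add_zero]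
    ring

/-! ### Schwartz cutoffs -/

theorem exists_schwartz_decay (χ : 𝓢(E n × E n, ℂ)) (P : ℝ) :
    ∃ C, 0 ≤ C ∧ ∀ z, ‖χ z‖ ≤ C * (jb z.2 ^ (-P) * jb z.1 ^ (-P)) := by
  obtain ⟨k, hk⟩ := exists_nat_ge |P|
  refine ⟨2 ^ (2 * k) * (Finset.Iic (2 * k, 0)).sup (fun m => SchwartzMap.seminorm ℝ m.1 m.2) χ,
    by positivity, fun z => ?_⟩
  have h := SchwartzMap.one_add_le_sup_seminorm_apply (𝕜 := ℝ) (m := (2 * k, 0)) (k := 2 * k)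
    (n := 0) le_rfl le_rfl χ z
  rw [norm_iteratedFDeriv_zero] at h
  have h1 : ∀ x : E n, ‖x‖ ≤ ‖z‖ → jb x ^ P ≤ (1 + ‖z‖) ^ k := fun x hx => by
    calc jb x ^ P ≤ jb x ^ (k : ℝ) := jb_rpow_le x ((le_abs_self P).trans hk)
      _ = jb x ^ k := Real.rpow_natCast _ _
      _ ≤ (1 + ‖z‖) ^ k := pow_le_pow_left₀ (jb_pos x).le ((jb_le_one_add x).trans (by linarith)) k
  have h2 := h1 _ (norm_fst_le z)
  have h3 := h1 _ (norm_snd_le z)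
  have h4 := jb_rpow_pos z.1 P
  have h5 := jb_rpow_pos z.2 P
  rw [Real.rpow_neg (jb_pos _).le, Real.rpow_neg (jb_pos _).le, ← mul_inv, ← div_eq_mul_inv,
    le_div_iff₀ (by positivity)]
  calc ‖χ z‖ * (jb z.2 ^ P * jb z.1 ^ P) ≤ ‖χ z‖ * ((1 + ‖z‖) ^ k * (1 + ‖z‖) ^ k) := by gcongr
    _ = (1 + ‖z‖) ^ (2 * k) * ‖χ z‖ := by ring
    _ ≤ _ := h

theorem exists_schwartz_bound (χ : 𝓢(E n × E n, ℂ)) : ∃ C, 0 ≤ C ∧ ∀ z, ‖χ z‖ ≤ C := by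
  obtain ⟨C, hC, h⟩ := exists_schwartz_decay χ 0
  exact ⟨C, hC, fun z => by simpa using h z⟩

theorem jb_smul_ge {ε : ℝ} (hε : 0 < ε) (x : E n) : min ε 1 * jb x ≤ jb (ε • x) := by
  have h0 : 0 ≤ min ε 1 := le_min hε.le zero_le_one
  refine Real.le_sqrt_of_sq_le ?_
  rw [mul_pow, jb_sq, norm_smul, Real.norm_of_nonneg hε.le, mul_pow, mul_add, mul_one]
  have h1 : min ε 1 ^ 2 ≤ 1 := pow_le_one₀ h0 (min_le_right _ _)
  have h2 : min ε 1 ^ 2 ≤ ε ^ 2 := pow_le_pow_left₀ h0 (min_le_left _ _) 2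
  nlinarith [sq_nonneg ‖x‖]

theorem exists_schwartz_smul_decay (χ : 𝓢(E n × E n, ℂ)) {ε : ℝ} (hε : 0 < ε) (P : ℝ) :
    ∃ C, 0 ≤ C ∧ ∀ y η, ‖χ (ε • (y, η))‖ ≤ C * (jb η ^ (-P) * jb y ^ (-P)) := by
  obtain ⟨C, hC, h⟩ := exists_schwartz_decay χ |P|
  set c := min ε 1 with hc
  have hc0 : 0 < c := lt_min hε one_pos
  have h1 : ∀ x : E n, jb (ε • x) ^ (-|P|) ≤ c ^ (-|P|) * jb x ^ (-P) := fun x => by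
    calc jb (ε • x) ^ (-|P|) ≤ (c * jb x) ^ (-|P|) :=
          Real.rpow_le_rpow_of_nonpos (mul_pos hc0 (jb_pos x)) (jb_smul_ge hε x) (by simp)
      _ = c ^ (-|P|) * jb x ^ (-|P|) := Real.mul_rpow hc0.le (jb_pos x).le
      _ ≤ _ := mul_le_mul_of_nonneg_left (jb_rpow_le x (neg_le_neg (le_abs_self P)))
          (Real.rpow_nonneg hc0.le _)
  refine ⟨C * (c ^ (-|P|) * c ^ (-|P|)), by positivity, fun y η => (h _).trans ?_⟩
  rw [mul_assoc]
  refine mul_le_mul_of_nonneg_left ?_ hC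
  calc _ ≤ (c ^ (-|P|) * jb η ^ (-P)) * (c ^ (-|P|) * jb y ^ (-P)) :=
        mul_le_mul (h1 η) (h1 y) (jb_rpow_pos _ _).le ((jb_rpow_pos _ _).le.trans (h1 η))
    _ = _ := by ring

/-- The range of the regularization parameter. -/
abbrev Eps : Type := Set.Ioc (0 : ℝ) 1

/-- The cutoffs `χ(εy, εη)`, `0 < ε ≤ 1`. -/
noncomputable def cut (χ : 𝓢(E n × E n, ℂ)) : Fam n Eps := fun ε y η => χ ((ε : ℝ) • (y, η))

open LineDeriv in
theorem hasDerivAt_schwartz_smul (χ : 𝓢(E n × E n, ℂ)) (ε : ℝ) (z v : E n × E n) :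
    HasDerivAt (fun s : ℝ => χ (ε • (z + s • v))) ((ε : ℂ) * (∂_{v} χ) (ε • z)) 0 := by
  have h := (χ.hasFDerivAt (ε • z)).hasLineDerivAt (ε • v)
  have h1 : HasDerivAt (fun s : ℝ => χ (ε • z + s • ε • v)) _ 0 := h
  have h2 : (fun s : ℝ => χ (ε • z + s • ε • v)) = fun s : ℝ => χ (ε • (z + s • v)) := by
    funext s; rw [smul_add, smul_comm]
  rw [h2] at h1
  refine h1.congr_deriv ?_
  rw [SchwartzMap.lineDerivOp_apply_eq_fderiv, map_smul, Complex.real_smul]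

open LineDeriv in
theorem derivFst_cut (χ : 𝓢(E n × E n, ℂ)) (j : Fin n) :
    DerivFst j (cut χ) (fun ε y η => ((ε : ℝ) : ℂ) * cut (∂_{((bv j, 0) : E n × E n)} χ) ε y η) :=
  fun ε y η => by
    have := hasDerivAt_schwartz_smul χ ε (y, η) (bv j, 0)
    simpa only [Prod.smul_mk, smul_zero, Prod.mk_add_mk, add_zero] using! this

open LineDeriv in
theorem derivSnd_cut (χ : 𝓢(E n × E n, ℂ)) (j : Fin n) :
    DerivSnd j (cut χ) (fun ε y η => ((ε : ℝ) : ℂ) * cut (∂_{((0, bv j) : E n × E n)} χ) ε y η) :=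
  fun ε y η => by
    have := hasDerivAt_schwartz_smul χ ε (y, η) (0, bv j)
    simpa only [Prod.smul_mk, smul_zero, Prod.mk_add_mk, add_zero] using! this

theorem Eps.norm_le_one (ε : Eps) : ‖((ε : ℝ) : ℂ)‖ ≤ 1 := by
  rw [Complex.norm_real, Real.norm_of_nonneg ε.2.1.le]; exact ε.2.2

theorem rapidB_cut (χ : 𝓢(E n × E n, ℂ)) : RapidB (cut χ) :=
  fun ε P => exists_schwartz_smul_decay χ ε.2.1 P

/-- The cutoffs are amplitudes of order zero, uniformly in `ε`: a derivative produces the factor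
`ε ≤ 1` and another Schwartz function. -/
theorem reg_cut {δ : ℝ} (hδ : 0 ≤ δ) (L J : ℕ) (χ : 𝓢(E n × E n, ℂ)) :
    Reg L J (RAmpB δ 0 0) (cut χ) := by
  have hb : ∀ χ : 𝓢(E n × E n, ℂ), RAmpB δ 0 0 0 0 (cut χ) := fun χ => by
    obtain ⟨C, hC, h⟩ := exists_schwartz_bound χ
    exact ⟨⟨fun ε => χ.continuous.comp (by fun_prop), C, hC, fun ε y η => by simpa using! h _⟩,
      rapidB_cut χ⟩
  induction hN : L + J generalizing L J χ with
  | zero => exact Reg.intro (hb χ) (by omega) (by omega)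
  | succ N ih =>
    refine Reg.intro (hb χ) ?_ ?_
    · rintro L' rfl j
      exact ⟨_, derivFst_cut χ j, (ih L' J _ (by omega)).const_mul (fun ε => ((ε : ℝ) : ℂ))
        fun i l f hf => ⟨(hf.1.const_mul Eps.norm_le_one).mono (by push_cast; nlinarith) le_rfl,
          hf.2.const_mul _⟩⟩
    · rintro J' rfl j
      exact ⟨_, derivSnd_cut χ j, (ih L J' _ (by omega)).const_mul (fun ε => ((ε : ℝ) : ℂ))
        fun i l f hf => ⟨(hf.1.const_mul Eps.norm_le_one).mono le_rfl le_rfl, hf.2.const_mul _⟩⟩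

theorem exists_schwartz_holder (χ : 𝓢(E n × E n, ℂ)) (h1 : χ 0 = 1) {s : ℝ} (hs0 : 0 < s)
    (hs1 : s ≤ 1) : ∃ C, 0 ≤ C ∧ ∀ z, ‖χ z - 1‖ ≤ C * ‖z‖ ^ s := by
  obtain ⟨M, hM, hχ⟩ := exists_schwartz_bound χ
  set K := SchwartzMap.seminorm ℝ 0 1 χ
  have hK : 0 ≤ K := apply_nonneg _ _
  refine ⟨K + (M + 1), by positivity, fun z => ?_⟩
  rcases le_total ‖z‖ 1 with hz | hz
  · have h2 : ‖χ z - χ 0‖ ≤ K * ‖z - 0‖ := by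
      refine Convex.norm_image_sub_le_of_norm_fderiv_le (𝕜 := ℝ) (s := Set.univ)
        (fun x _ => χ.differentiableAt) (fun x _ => ?_) convex_univ trivial trivial
      rw [← norm_iteratedFDeriv_one]
      exact SchwartzMap.norm_iteratedFDeriv_le_seminorm ℝ χ 1 x
    rw [h1, sub_zero] at h2
    refine h2.trans ?_
    have h3 : ‖z‖ ≤ ‖z‖ ^ s := by
      rcases (norm_nonneg z).eq_or_lt with h | h
      · rw [← h, Real.zero_rpow hs0.ne']
      · simpa using Real.rpow_le_rpow_of_exponent_ge h hz hs1
    have : 0 ≤ ‖z‖ ^ s := Real.rpow_nonneg (norm_nonneg _) _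
    nlinarith
  · have h3 : 1 ≤ ‖z‖ ^ s := Real.one_le_rpow hz hs0.le
    have h4 : ‖χ z - 1‖ ≤ M + 1 := (norm_sub_le _ _).trans (by simpa using hχ z)
    nlinarith

theorem norm_rpow_le_jb (z : E n × E n) {s : ℝ} (hs : 0 ≤ s) :
    ‖z‖ ^ s ≤ jb z.2 ^ s * jb z.1 ^ s := by
  rw [← Real.mul_rpow (jb_pos _).le (jb_pos _).le]
  refine Real.rpow_le_rpow (norm_nonneg _) ?_ hs
  have h1 := one_le_jb z.1
  have h2 := one_le_jb z.2
  rw [Prod.norm_def]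
  refine max_le ((norm_le_jb _).trans ?_) ((norm_le_jb _).trans ?_) <;> nlinarith

/-- The difference of two cutoffs, divided by a small power of the regularization parameters. -/
noncomputable def cutDiff (s : ℝ) (χ χ' : 𝓢(E n × E n, ℂ)) : Fam n (Eps × Eps) :=
  (fun e y η => (((e.1 : ℝ) + e.2) ^ (-s) : ℝ) * cut χ e.1 y η) +
  fun e y η => (-(((e.1 : ℝ) + e.2) ^ (-s) : ℝ)) * cut χ' e.2 y η

theorem Eps.mul_rpow_le {a b s : ℝ} (ha : 0 < a) (hb : 0 < b) (ha' : a ≤ 1) (hs : 0 ≤ s)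
    (hs1 : s ≤ 1) : (a + b) ^ (-s) * a ≤ 1 := by
  rw [Real.rpow_neg (by positivity), inv_mul_le_one₀ (by positivity)]
  calc a = a ^ (1 : ℝ) := (Real.rpow_one a).symm
    _ ≤ a ^ s := Real.rpow_le_rpow_of_exponent_ge ha ha' hs1
    _ ≤ (a + b) ^ s := Real.rpow_le_rpow ha.le (by linarith) hs

/-- The differences of cutoffs, divided by `(ε + ε')^s`, are amplitudes of order `s`. Without
derivatives this holds since both Schwartz functions are one at the origin; a derivative produces a
factor `ε` or `ε'`, which absorbs the division. -/
theorem reg_cutDiff {δ s : ℝ} (hδ : 0 ≤ δ) (hs : 0 < s) (hs1 : s ≤ 1) (L J : ℕ)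
    {χ χ' : 𝓢(E n × E n, ℂ)} (h : χ 0 = 1) (h' : χ' 0 = 1) :
    Reg L J (RAmpB δ s s) (cutDiff s χ χ') := by
  -- the derivatives: here the factors `ε` and `ε'` give the estimate for each cutoff separately
  have hder : ∀ (L J : ℕ) (ψ ψ' : 𝓢(E n × E n, ℂ)), Reg L J (RAmpB δ s s)
      ((fun (e : Eps × Eps) y η => (((e.1 : ℝ) + e.2) ^ (-s) : ℝ) * ((((e.1 : ℝ) : ℂ)) *
        cut ψ e.1 y η)) + fun e y η => (-(((e.1 : ℝ) + e.2) ^ (-s) : ℝ)) *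
        ((((e.2 : ℝ) : ℂ)) * cut ψ' e.2 y η)) := by
    intro L J ψ ψ'
    refine Reg.add (fun _ _ _ _ => RAmpB.add) ?_ ?_
    · have h1 := (reg_cut hδ L J ψ).reindex (fun e : Eps × Eps => e.1)
        (B' := RAmpB δ 0 0) fun i l f hf => ⟨hf.1.reindex _, hf.2.reindex _⟩
      have h2 := h1.const_mul (B' := RAmpB δ s s)
        (fun e : Eps × Eps => ((((e.1 : ℝ) + e.2) ^ (-s) * e.1 : ℝ) : ℂ)) fun i l f hf =>
          ⟨(hf.1.const_mul (K := 1) fun e => ?_).mono (by linarith) hs.le, hf.2.const_mul _⟩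
      · convert h2 using 4; push_cast; ring
      · have := e.1.2.1
        have := e.2.2.1
        rw [Complex.norm_real, Real.norm_of_nonneg (by positivity)]
        exact Eps.mul_rpow_le e.1.2.1 e.2.2.1 e.1.2.2 hs.le hs1
    · have h1 := (reg_cut hδ L J ψ').reindex (fun e : Eps × Eps => e.2)
        (B' := RAmpB δ 0 0) fun i l f hf => ⟨hf.1.reindex _, hf.2.reindex _⟩
      have h2 := h1.const_mul (B' := RAmpB δ s s)
        (fun e : Eps × Eps => ((-(((e.1 : ℝ) + e.2) ^ (-s) * e.2) : ℝ) : ℂ)) fun i l f hf =>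
          ⟨(hf.1.const_mul (K := 1) fun e => ?_).mono (by linarith) hs.le, hf.2.const_mul _⟩
      · convert h2 using 4; push_cast; ring
      · have := e.1.2.1
        have := e.2.2.1
        rw [Complex.norm_real, norm_neg, Real.norm_of_nonneg (by positivity), add_comm]
        exact Eps.mul_rpow_le e.2.2.1 e.1.2.1 e.2.2.2 hs.le hs1
  -- the function itself: here the estimate comes from a cancellation at the origin
  have hb : RAmpB δ s s 0 0 (cutDiff s χ χ') := by
    refine ⟨⟨fun e => ?_, ?_⟩, ?_⟩
    · unfold cutDiff cut
      have h1 := χ.continuous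
      have h2 := χ'.continuous
      simp only [Pi.add_apply]
      fun_prop
    · obtain ⟨C, hC, h1⟩ := exists_schwartz_holder χ h hs hs1
      obtain ⟨C', hC', h2⟩ := exists_schwartz_holder χ' h' hs hs1
      refine ⟨C + C', by positivity, fun e y η => ?_⟩
      have e1 := e.1.2.1
      have e2 := e.2.2.1
      set a : ℝ := (e.1 : ℝ) with ha
      set b : ℝ := (e.2 : ℝ) with hb
      have h3 : cutDiff s χ χ' e y η = ((a + b) ^ (-s) : ℝ) *
          ((χ (a • (y, η)) - 1) - (χ' (b • (y, η)) - 1)) := by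
        simp only [cutDiff, cut, Pi.add_apply]; ring
      have h4 : ∀ c : ℝ, 0 < c → c ≤ a + b → ‖c • (y, η)‖ ^ s ≤ (a + b) ^ s * ‖(y, η)‖ ^ s := by
        intro c hc hc'
        rw [norm_smul, Real.norm_of_nonneg hc.le, Real.mul_rpow hc.le (norm_nonneg _)]
        gcongr
      rw [h3, norm_mul, Complex.norm_real, Real.norm_of_nonneg (by positivity)]
      have h5 := norm_rpow_le_jb (y, η) hs.le
      have h6 : 0 < (a + b) ^ s := by positivity
      calc (a + b) ^ (-s) * ‖(χ (a • (y, η)) - 1) - (χ' (b • (y, η)) - 1)‖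
          ≤ (a + b) ^ (-s) * (C * ((a + b) ^ s * ‖(y, η)‖ ^ s) + C' * ((a + b) ^ s * ‖(y, η)‖ ^ s)) := by
            gcongr
            refine (norm_sub_le _ _).trans (add_le_add ((h1 _).trans ?_) ((h2 _).trans ?_))
            · exact mul_le_mul_of_nonneg_left (h4 a e1 (by linarith)) hC
            · exact mul_le_mul_of_nonneg_left (h4 b e2 (by linarith)) hC'
        _ = (C + C') * ‖(y, η)‖ ^ s := by
            rw [Real.rpow_neg (by positivity)]; field_simp
        _ ≤ _ := by
            simp only [CharP.cast_eq_zero, mul_zero, add_zero]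
            gcongr
    · exact RapidB.add (((rapidB_cut χ).reindex fun e : Eps × Eps => e.1).const_mul _)
        (((rapidB_cut χ').reindex fun e : Eps × Eps => e.2).const_mul _)
  refine Reg.intro hb ?_ ?_
  · rintro L' rfl j
    refine ⟨_, DerivFst.add (DerivFst.const_mul _ fun e => derivFst_cut χ j e.1)
      (DerivFst.const_mul _ fun e => derivFst_cut χ' j e.2), (hder L' J _ _).mono
      fun i l f hf => ⟨hf.1.mono (by push_cast; linarith) le_rfl, hf.2⟩⟩
  · rintro J' rfl j
    exact ⟨_, DerivSnd.add (DerivSnd.const_mul _ fun e => derivSnd_cut χ j e.1)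
      (DerivSnd.const_mul _ fun e => derivSnd_cut χ' j e.2), (hder L J' _ _).mono
      fun i l f hf => ⟨hf.1.mono le_rfl le_rfl, hf.2⟩⟩

/-! ### Existence of oscillatory integrals -/

/-- The regularized oscillatory integrals. -/
noncomputable def regInt (χ : 𝓢(E n × E n, ℂ)) (f : E n → E n → ℂ) (ε : ℝ) : ℂ :=
  (((2 * Real.pi) ^ n)⁻¹ : ℂ) * ∫ p, oscIntegrand χ f ε p

theorem oscIntegrand_eq (χ : 𝓢(E n × E n, ℂ)) (f : E n → E n → ℂ) (ε : ℝ) (z : E n × E n) :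
    oscIntegrand χ f ε z = osc z * (χ (ε • z) * f z.1 z.2) := by
  unfold oscIntegrand osc; ring

theorem AmpB.integrable_oscIntegrand {δ p q : ℝ} {i l : ℕ} {f : Fam n T} (hf : AmpB δ p q i l f)
    (χ : 𝓢(E n × E n, ℂ)) {ε : ℝ} (hε : 0 < ε) (t : T) : Integrable (oscIntegrand χ (f t) ε) := by
  have h1 : RapidB (fun (_ : T) y η => χ (ε • (y, η))) :=
    fun _ P => exists_schwartz_smul_decay χ hε P
  obtain ⟨C, -, hC⟩ := (h1.mul_ampB hf) t (n + 1)
  have h2 := integrable_of_rapid (u := fun y η => χ (ε • (y, η)) * f t y η)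
    ((χ.continuous.comp (by fun_prop)).mul (hf.1 t)) (by linarith) hC
  exact (integrable_osc_mul h2).congr (Eventually.of_forall fun z => (oscIntegrand_eq _ _ _ _).symm)

/-- A smooth compactly supported bump function, equal to one on the unit ball. -/
noncomputable def bump (n : ℕ) : ContDiffBump (0 : E n) := ⟨1, 2, one_pos, one_lt_two⟩

theorem hasCompactSupport_bump_prod :
    HasCompactSupport (fun z : E n × E n => ((bump n z.1 * bump n z.2 : ℝ) : ℂ)) := by
  refine HasCompactSupport.intro ((isCompact_closedBall (0 : E n) 2).prod
    (isCompact_closedBall (0 : E n) 2)) fun z hz => ?_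
  rw [Set.mem_prod, not_and_or, Metric.mem_closedBall, Metric.mem_closedBall, not_le, not_le] at hz
  rcases hz with h | h
  · rw [(bump n).zero_of_le_dist h.le]; simp
  · rw [(bump n).zero_of_le_dist (x := z.2) h.le]; simp

/-- The cutoff `(y, η) ↦ φ(y) φ(η)` with a smooth bump function `φ`. -/
noncomputable def χ₀ (n : ℕ) : 𝓢(E n × E n, ℂ) :=
  (hasCompactSupport_bump_prod (n := n)).toSchwartzMap (by
    refine Complex.ofRealCLM.contDiff.comp (ContDiff.mul ?_ ?_)
    · exact (bump n).contDiff.comp contDiff_fst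
    · exact (bump n).contDiff.comp contDiff_snd)

theorem χ₀_apply (z : E n × E n) : χ₀ n z = ((bump n z.1 * bump n z.2 : ℝ) : ℂ) := rfl

theorem bump_zero : bump n 0 = 1 := (bump n).one_of_mem_closedBall (by simp [bump])

theorem χ₀_zero : χ₀ n 0 = 1 := by
  rw [χ₀_apply]; simp [bump_zero]

theorem HasOscInt.unique {f : E n → E n → ℂ} {a b : ℂ} (ha : HasOscInt f a) (hb : HasOscInt f b) :
    a = b :=
  tendsto_nhds_unique (ha _ χ₀_zero).2 (hb _ χ₀_zero).2

theorem HasOscInt.oscInt_eq {f : E n → E n → ℂ} {a : ℂ} (ha : HasOscInt f a) : oscInt f = a := by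
  have h : ∃ L, HasOscInt f L := ⟨a, ha⟩
  rw [oscInt, dif_pos h]
  exact h.choose_spec.unique ha

theorem HasOscInt.hasOscInt_oscInt {f : E n → E n → ℂ} {a : ℂ} (ha : HasOscInt f a) :
    HasOscInt f (oscInt f) := by rwa [ha.oscInt_eq]

theorem exists_norm_regInt_le {δ p q : ℝ} (hδ : 0 ≤ δ) {L : ℕ} {f : Fam n T}
    (hf : Reg L (n + 1) (AmpB δ p q) f) (hp : p - L * (1 - δ) < -n) (hq : q < 1)
    (χ : 𝓢(E n × E n, ℂ)) : ∃ C, 0 ≤ C ∧ ∀ t, ∀ ε : Eps, ‖regInt χ (f t) ε‖ ≤ C := by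
  have h1 := (reg_cut hδ L (n + 1) χ).reindex (fun e : T × Eps => e.2)
    (B' := RAmpB δ 0 0) fun i l f hf => ⟨hf.1.reindex _, hf.2.reindex _⟩
  have h2 := hf.reindex (fun e : T × Eps => e.1) (B' := AmpB δ p q) fun i l f hf => hf.reindex _
  have h3 : Reg L (n + 1) (RAmpB δ p q)
      ((fun e : T × Eps => f e.1) * fun e : T × Eps => cut χ e.2) := by
    refine Reg.mul (fun _ _ _ _ => RAmpB.add) (fun i l i' l' f g h h' => ?_) h2 h1
    have := RAmpB.mul (l'' := l + l') h h'
    simpa using this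
  obtain ⟨C, hC, h⟩ := exists_norm_integral_osc_le hδ h3 hp hq
  refine ⟨‖(((2 * Real.pi) ^ n)⁻¹ : ℂ)‖ * C, by positivity, fun t ε => ?_⟩
  rw [regInt, norm_mul]
  refine mul_le_mul_of_nonneg_left ?_ (norm_nonneg _)
  have h4 : ∀ z : E n × E n, oscIntegrand χ (f t) ε z = osc z * ((fun e : T × Eps => f e.1) *
      fun e : T × Eps => cut χ e.2) (t, ε) z.1 z.2 := fun z => by
    rw [oscIntegrand_eq, mul_comm (χ _)]; rfl
  simp_rw [h4]
  exact h (t, ε)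

/-- A quantitative Cauchy property. Since the two cutoffs may be different, it also yields the
independence of the limit from the cutoff. The price is that the amplitude has to leave room for an
additional factor `⟨η⟩^s ⟨y⟩^s`. -/
theorem exists_norm_regInt_sub_le {δ p q s : ℝ} (hδ : 0 ≤ δ) (hs : 0 < s) (hs1 : s ≤ 1) {L : ℕ}
    {f : Fam n T} (hf : Reg L (n + 1) (AmpB δ p q) f) (hp : p + s - L * (1 - δ) < -n)
    (hq : q + s < 1) {χ χ' : 𝓢(E n × E n, ℂ)} (h : χ 0 = 1) (h' : χ' 0 = 1) :
    ∃ C, 0 ≤ C ∧ ∀ t, ∀ ε ε' : Eps, ‖regInt χ (f t) ε - regInt χ' (f t) ε'‖ ≤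
      C * ((ε : ℝ) + ε') ^ s := by
  have h1 := (reg_cutDiff hδ hs hs1 L (n + 1) h h').reindex (fun e : T × (Eps × Eps) => e.2)
    (B' := RAmpB δ s s) fun i l f hf => ⟨hf.1.reindex _, hf.2.reindex _⟩
  have h2 := hf.reindex (fun e : T × (Eps × Eps) => e.1) (B' := AmpB δ p q)
    fun i l f hf => hf.reindex _
  have h3 : Reg L (n + 1) (RAmpB δ (p + s) (q + s))
      ((fun e : T × (Eps × Eps) => f e.1) * fun e : T × (Eps × Eps) => cutDiff s χ χ' e.2) :=
    Reg.mul (fun _ _ _ _ => RAmpB.add) (fun i l i' l' f g h h' => RAmpB.mul h h') h2 h1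
  obtain ⟨C, hC, hb⟩ := exists_norm_integral_osc_le hδ h3 hp hq
  refine ⟨‖(((2 * Real.pi) ^ n)⁻¹ : ℂ)‖ * C, by positivity, fun t ε ε' => ?_⟩
  have hε := ε.2.1
  have hε' := ε'.2.1
  set d : ℝ := ((ε : ℝ) + ε') ^ s with hd
  have hd0 : 0 < d := by positivity
  have e1 := hf.base.integrable_oscIntegrand χ ε.2.1 t
  have e2 := hf.base.integrable_oscIntegrand χ' ε'.2.1 t
  rw [regInt, regInt, ← mul_sub, norm_mul, ← integral_sub e1 e2, mul_assoc]
  refine mul_le_mul_of_nonneg_left ?_ (norm_nonneg _)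
  have h4 : ∀ z : E n × E n, oscIntegrand χ (f t) ε z - oscIntegrand χ' (f t) ε' z =
      (d : ℂ) * (osc z * ((fun e : T × (Eps × Eps) => f e.1) * fun e : T × (Eps × Eps) =>
        cutDiff s χ χ' e.2) (t, (ε, ε')) z.1 z.2) := by
    intro z
    have h5 : ((((ε : ℝ) + ε') ^ (-s) : ℝ) : ℂ) = (d : ℂ)⁻¹ := by
      rw [Real.rpow_neg (by positivity)]; push_cast; rfl
    have hd1 : (d : ℂ) ≠ 0 := by exact_mod_cast hd0.ne'
    rw [oscIntegrand_eq, oscIntegrand_eq]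
    simp only [Pi.mul_apply, cutDiff, Pi.add_apply, h5, cut, Prod.mk.eta]
    field_simp
    ring
  rw [integral_congr_ae (Eventually.of_forall h4), integral_const_mul, norm_mul, Complex.norm_real,
    Real.norm_of_nonneg hd0.le, mul_comm]
  exact mul_le_mul_of_nonneg_right (hb _) hd0.le

/-- Oscillatory integrals of amplitudes exist; the limit is bounded by the amplitude estimates, and
the regularized integrals converge uniformly. -/
theorem exists_hasOscInt {δ p q s : ℝ} (hδ : 0 ≤ δ) (hs : 0 < s) (hs1 : s ≤ 1) {L : ℕ}
    {f : Fam n T} (hf : Reg L (n + 1) (AmpB δ p q) f) (hp : p + s - L * (1 - δ) < -n)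
    (hq : q + s < 1) :
    (∀ t, HasOscInt (f t) (oscInt (f t))) ∧ (∃ C, 0 ≤ C ∧ ∀ t, ‖oscInt (f t)‖ ≤ C) ∧
    ∃ C, 0 ≤ C ∧ ∀ t, ∀ ε : Eps, ‖regInt (χ₀ n) (f t) ε - oscInt (f t)‖ ≤ C * (ε : ℝ) ^ s := by
  -- the limit is constructed along the sequence `ε = 1 / (k + 1)` with the cutoff `χ₀`
  let e : ℕ → Eps := fun k => ⟨1 / ((k : ℝ) + 1), by positivity,
    (div_le_one (by positivity)).2 (by linarith [Nat.cast_nonneg (α := ℝ) k])⟩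
  have he : Tendsto (fun k => ((e k : Eps) : ℝ)) atTop (𝓝 0) :=
    tendsto_one_div_add_atTop_nhds_zero_nat
  obtain ⟨C₀, hC₀, h0⟩ := exists_norm_regInt_sub_le hδ hs hs1 hf hp hq (χ₀_zero (n := n)) χ₀_zero
  have hcau : ∀ t, CauchySeq fun k => regInt (χ₀ n) (f t) (e k) := by
    intro t
    refine cauchySeq_of_le_tendsto_0 (fun N => C₀ * ((e N : ℝ) + e N) ^ s) (fun k m N hk hm => ?_) ?_
    · rw [dist_eq_norm]
      refine (h0 t (e k) (e m)).trans (mul_le_mul_of_nonneg_left ?_ hC₀)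
      have h1 := (e k).2.1
      have h2 := (e m).2.1
      have h3 : ∀ k, N ≤ k → (e k : ℝ) ≤ e N := fun k hk => by
        have : (N : ℝ) ≤ k := by exact_mod_cast hk
        exact one_div_le_one_div_of_le (by positivity) (by linarith)
      exact Real.rpow_le_rpow (by positivity) (add_le_add (h3 k hk) (h3 m hm)) hs.le
    · have := ((he.add he).rpow_const (p := s) (Or.inr hs.le)).const_mul C₀
      simpa [Real.zero_rpow hs.ne'] using this
  choose l hl using fun t => cauchySeq_tendsto_of_complete (hcau t)
  -- the rate of convergence towards this limit for an arbitrary cutoff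
  have hrate : ∀ χ : 𝓢(E n × E n, ℂ), χ 0 = 1 → ∃ C, 0 ≤ C ∧ ∀ t, ∀ ε : Eps,
      ‖regInt χ (f t) ε - l t‖ ≤ C * (ε : ℝ) ^ s := by
    intro χ hχ
    obtain ⟨C, hC, h⟩ := exists_norm_regInt_sub_le hδ hs hs1 hf hp hq hχ (χ₀_zero (n := n))
    refine ⟨C, hC, fun t ε => ?_⟩
    refine le_of_tendsto_of_tendsto' (tendsto_const_nhds.sub (hl t)).norm ?_ fun k => h t ε (e k)
    have := ((tendsto_const_nhds (x := (ε : ℝ))).add he).rpow_const (p := s) (Or.inr hs.le)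
    simpa using this.const_mul C
  have hosc : ∀ t, HasOscInt (f t) (l t) := by
    intro t χ hχ
    refine ⟨fun ε hε => hf.base.integrable_oscIntegrand χ hε t, ?_⟩
    obtain ⟨C, hC, h⟩ := hrate χ hχ
    rw [tendsto_iff_norm_sub_tendsto_zero]
    have h1 : Tendsto (fun ε : ℝ => C * ε ^ s) (𝓝[>] 0) (𝓝 0) := by
      have := ((tendsto_id (x := 𝓝[>] (0 : ℝ))).mono_right nhdsWithin_le_nhds).rpow_const
        (p := s) (Or.inr hs.le)
      simpa [Real.zero_rpow hs.ne'] using this.const_mul C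
    refine squeeze_zero' (Eventually.of_forall fun _ => norm_nonneg _) ?_ h1
    filter_upwards [Ioc_mem_nhdsGT (zero_lt_one (α := ℝ))] with ε hε
    exact h t ⟨ε, hε⟩
  have heq : ∀ t, oscInt (f t) = l t := fun t => (hosc t).oscInt_eq
  simp_rw [heq]
  refine ⟨hosc, ?_, hrate _ χ₀_zero⟩
  obtain ⟨C, hC, h⟩ := hrate _ (χ₀_zero (n := n))
  obtain ⟨C', hC', h'⟩ := exists_norm_regInt_le hδ hf (by linarith) (by linarith) (χ₀ n)
  refine ⟨C' + C, by positivity, fun t => ?_⟩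
  have h1 := h t ⟨1, one_pos, le_rfl⟩
  have h2 := h' t ⟨1, one_pos, le_rfl⟩
  simp only [Real.one_rpow, mul_one] at h1 h2
  calc ‖l t‖ = ‖regInt (χ₀ n) (f t) 1 - (regInt (χ₀ n) (f t) 1 - l t)‖ := by congr 1; ring
    _ ≤ _ := (norm_sub_le _ _).trans (add_le_add h2 h1)

/-! ### Scaling of oscillatory integrals -/

/-- The map `(y, η) ↦ (c y, c⁻¹ η)`. -/
noncomputable def scaleEquiv (c : ℝˣ) : (E n × E n) ≃L[ℝ] (E n × E n) :=
  (ContinuousLinearEquiv.smulLeft c).prodCongr (ContinuousLinearEquiv.smulLeft c⁻¹)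

theorem scaleEquiv_apply (c : ℝˣ) (z : E n × E n) :
    scaleEquiv c z = ((c : ℝ) • z.1, (c : ℝ)⁻¹ • z.2) := by
  simp only [scaleEquiv, ContinuousLinearEquiv.prodCongr_apply,
    ContinuousLinearEquiv.smulLeft_apply_apply, Units.smul_def, Units.val_inv_eq_inv_val]

theorem measurePreserving_scaleEquiv (c : ℝˣ) :
    MeasurePreserving (scaleEquiv c : E n × E n → E n × E n) := by
  refine ⟨(scaleEquiv c).continuous.measurable, ?_⟩
  have h1 : (scaleEquiv c : E n × E n → E n × E n) =
      Prod.map (fun y => (c : ℝ) • y) (fun y => (c : ℝ)⁻¹ • y) := by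
    funext z; exact scaleEquiv_apply c z
  rw [h1, Measure.volume_eq_prod, ← Measure.map_prod_map _ _ (measurable_const_smul _)
    (measurable_const_smul _), Measure.map_addHaar_smul _ c.ne_zero,
    Measure.map_addHaar_smul _ (inv_ne_zero c.ne_zero), Measure.prod_smul_left,
    Measure.prod_smul_right, smul_smul, ← ENNReal.ofReal_mul (abs_nonneg _), ← abs_mul]
  have : ((c : ℝ) ^ Module.finrank ℝ (E n))⁻¹ * ((c : ℝ)⁻¹ ^ Module.finrank ℝ (E n))⁻¹ = 1 := by
    rw [inv_pow, inv_inv]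
    exact inv_mul_cancel₀ (pow_ne_zero _ c.ne_zero)
  rw [this]; simp

theorem osc_scaleEquiv (c : ℝˣ) (z : E n × E n) : osc (scaleEquiv c z) = osc z := by
  rw [osc, osc, scaleEquiv_apply]
  simp [inner_smul_left, inner_smul_right]

/-- Oscillatory integrals are invariant under `(y, η) ↦ (c y, c⁻¹ η)`: the measure and the phase are
preserved, and the cutoff is replaced by another Schwartz function that is one at the origin. -/
theorem HasOscInt.scale {f : E n → E n → ℂ} {a : ℂ} (h : HasOscInt f a) (c : ℝˣ) :
    HasOscInt (fun y η => f ((c : ℝ) • y) ((c : ℝ)⁻¹ • η)) a := by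
  intro χ hχ
  let χ' : 𝓢(E n × E n, ℂ) :=
    SchwartzMap.compCLMOfContinuousLinearEquiv ℂ (scaleEquiv c⁻¹) χ
  have hχ' : χ' 0 = 1 := by simp [χ', hχ]
  have key : ∀ ε : ℝ, (fun z => oscIntegrand χ' f ε (scaleEquiv c z)) =
      oscIntegrand χ (fun y η => f ((c : ℝ) • y) ((c : ℝ)⁻¹ • η)) ε := by
    intro ε
    funext z
    rw [oscIntegrand_eq, oscIntegrand_eq, osc_scaleEquiv]
    have h1 : χ' (ε • scaleEquiv c z) = χ (ε • z) := by
      simp only [χ', SchwartzMap.compCLMOfContinuousLinearEquiv_apply, Function.comp_apply,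
        map_smul]
      congr 2
      simp [scaleEquiv_apply]
    rw [h1, scaleEquiv_apply]
  have hm := measurePreserving_scaleEquiv (n := n) c
  have he := (scaleEquiv (n := n) c).toHomeomorph.measurableEmbedding
  refine ⟨fun ε hε => ?_, ?_⟩
  · rw [← key]
    exact (hm.integrable_comp_emb he).2 ((h χ' hχ').1 ε hε)
  · refine (h χ' hχ').2.congr fun ε => ?_
    rw [← key, ← hm.integral_comp he]

/-! ### Dependence on parameters -/

theorem AmpB.integrable_cut {δ p q : ℝ} {i l : ℕ} {f : Fam n T} (hf : AmpB δ p q i l f)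
    (χ : 𝓢(E n × E n, ℂ)) {ε : ℝ} (hε : 0 < ε) (t : T) :
    Integrable (fun z : E n × E n => χ (ε • z) * f t z.1 z.2) := by
  have h1 : RapidB (fun (_ : T) y η => χ (ε • (y, η))) :=
    fun _ P => exists_schwartz_smul_decay χ hε P
  obtain ⟨C, -, hC⟩ := (h1.mul_ampB hf) t (n + 1)
  exact integrable_of_rapid (u := fun y η => χ (ε • (y, η)) * f t y η)
    ((χ.continuous.comp (by fun_prop)).mul (hf.1 t)) (by linarith) hC

/-- An integrable bound for the regularized integrands that is uniform in the parameter. -/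
theorem AmpB.exists_bound_oscIntegrand {δ p q : ℝ} {i l : ℕ} {f : Fam n T}
    (hf : AmpB δ p q i l f) (χ : 𝓢(E n × E n, ℂ)) {ε : ℝ} (hε : 0 < ε) :
    ∃ g : E n × E n → ℝ, Integrable g ∧ ∀ t z, ‖oscIntegrand χ (f t) ε z‖ ≤ g z := by
  obtain ⟨-, C, hC, h⟩ := hf
  let w : Fam n Unit := fun _ y η => ((jb η ^ (p + δ * i) * jb y ^ q : ℝ) : ℂ)
  have hw0 : ∀ y η : E n, 0 ≤ jb η ^ (p + δ * i) * jb y ^ q := fun y η =>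
    mul_nonneg (jb_rpow_pos _ _).le (jb_rpow_pos _ _).le
  have hw : AmpB δ p q i l w := by
    refine ⟨fun _ => Complex.continuous_ofReal.comp
      (((continuous_jb_rpow _).comp continuous_snd).mul
        ((continuous_jb_rpow _).comp continuous_fst)), 1, zero_le_one, fun t y η => ?_⟩
    rw [one_mul, Complex.norm_real, Real.norm_of_nonneg (hw0 y η)]
  refine ⟨fun z => C * ‖χ (ε • z) * w () z.1 z.2‖, (hw.integrable_cut χ hε ()).norm.const_mul C,
    fun t z => ?_⟩
  rw [oscIntegrand_eq, norm_mul, norm_osc, one_mul, norm_mul]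
  beta_reduce
  rw [norm_mul]
  have h1 := h t z.1 z.2
  have h2 : ‖w () z.1 z.2‖ = jb z.2 ^ (p + δ * i) * jb z.1 ^ q := by
    rw [Complex.norm_real, Real.norm_of_nonneg (hw0 _ _)]
  rw [h2]
  calc ‖χ (ε • z)‖ * ‖f t z.1 z.2‖ ≤ ‖χ (ε • z)‖ * (C * (jb z.2 ^ (p + δ * i) * jb z.1 ^ q)) := by
        gcongr
    _ = _ := by ring

theorem AmpB.continuous_oscIntegrand {δ p q : ℝ} {i l : ℕ} {f : Fam n T}
    (hf : AmpB δ p q i l f) (χ : 𝓢(E n × E n, ℂ)) (ε : ℝ) (t : T) :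
    Continuous (oscIntegrand χ (f t) ε) := by
  have h : oscIntegrand χ (f t) ε = fun z => osc z * (χ (ε • z) * f t z.1 z.2) :=
    funext fun z => oscIntegrand_eq _ _ _ _
  rw [h]
  exact continuous_osc.mul ((χ.continuous.comp (by fun_prop)).mul (hf.1 t))

theorem tendsto_const_mul_rpow (C : ℝ) {s : ℝ} (hs : 0 < s) :
    Tendsto (fun ε : ℝ => C * ε ^ s) (𝓝[>] 0) (𝓝 0) := by
  have := ((tendsto_id (x := 𝓝[>] (0 : ℝ))).mono_right nhdsWithin_le_nhds).rpow_const
    (p := s) (Or.inr hs.le)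
  simpa [Real.zero_rpow hs.ne'] using this.const_mul C

theorem tendstoUniformly_regInt {f : Fam n T} {s C : ℝ} (hs : 0 < s)
    (h : ∀ t, ∀ ε : Eps, ‖regInt (χ₀ n) (f t) ε - oscInt (f t)‖ ≤ C * (ε : ℝ) ^ s) :
    TendstoUniformly (fun ε t => regInt (χ₀ n) (f t) ε) (fun t => oscInt (f t)) (𝓝[>] 0) := by
  rw [Metric.tendstoUniformly_iff]
  intro r hr
  filter_upwards [Ioc_mem_nhdsGT (zero_lt_one (α := ℝ)),
    (tendsto_const_mul_rpow C hs).eventually (gt_mem_nhds hr)] with ε hε hε' t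
  rw [dist_comm, dist_eq_norm]
  exact (h t ⟨ε, hε⟩).trans_lt hε'

/-- Continuity in the parameter: the regularized integrals are continuous by dominated convergence,
and they converge uniformly. -/
theorem continuous_oscInt [TopologicalSpace T] [FirstCountableTopology T] {δ p q s : ℝ}
    (hδ : 0 ≤ δ) (hs : 0 < s) (hs1 : s ≤ 1) {L : ℕ}
    {f : Fam n T} (hf : Reg L (n + 1) (AmpB δ p q) f) (hp : p + s - L * (1 - δ) < -n)
    (hq : q + s < 1) (hc : ∀ y η, Continuous fun t => f t y η) :
    Continuous fun t => oscInt (f t) := by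
  obtain ⟨-, -, C, hC, h⟩ := exists_hasOscInt hδ hs hs1 hf hp hq
  refine (tendstoUniformly_regInt hs h).continuous (Eventually.frequently ?_)
  filter_upwards [self_mem_nhdsWithin] with ε hε
  obtain ⟨g, hg, hgb⟩ := hf.base.exists_bound_oscIntegrand (χ₀ n) hε
  unfold regInt
  refine continuous_const.mul (continuous_of_dominated (bound := g)
    (fun t => (hf.base.continuous_oscIntegrand _ _ t).aestronglyMeasurable)
    (fun t => Eventually.of_forall (hgb t)) hg (Eventually.of_forall fun z => ?_))
  simp_rw [oscIntegrand_eq]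
  exact continuous_const.mul (continuous_const.mul (hc z.1 z.2))

/-- Differentiation of oscillatory integrals with respect to a real parameter. -/
theorem hasDerivAt_oscInt {δ p q s : ℝ} (hδ : 0 ≤ δ) (hs : 0 < s) (hs1 : s ≤ 1) {L : ℕ}
    {f g : ℝ → E n → E n → ℂ} {O : Set ℝ} (hO : IsOpen O)
    (hf : Reg L (n + 1) (AmpB δ p q) fun t : O => f t)
    (hg : Reg L (n + 1) (AmpB δ p q) fun t : O => g t)
    (hp : p + s - L * (1 - δ) < -n) (hq : q + s < 1)
    (hfg : ∀ t ∈ O, ∀ y η, HasDerivAt (fun r => f r y η) (g t y η) t) {t : ℝ} (ht : t ∈ O) :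
    HasDerivAt (fun r => oscInt (f r)) (oscInt (g t)) t := by
  obtain ⟨h1, -, -⟩ := exists_hasOscInt hδ hs hs1 hf hp hq
  obtain ⟨-, -, C, hC, h2⟩ := exists_hasOscInt hδ hs hs1 hg hp hq
  refine hasDerivAt_of_tendstoUniformlyOn (l := 𝓝[>] (0 : ℝ)) hO
    (f := fun ε r => regInt (χ₀ n) (f r) ε) (f' := fun ε r => regInt (χ₀ n) (g r) ε)
    (g' := fun r => oscInt (g r)) ?_ ?_
    (fun r hr => (h1 ⟨r, hr⟩ _ χ₀_zero).2) ht
  · rw [tendstoUniformlyOn_iff_tendstoUniformly_comp_coe]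
    exact tendstoUniformly_regInt (f := fun r : O => g r) hs h2
  · filter_upwards [self_mem_nhdsWithin] with ε hε r hr
    obtain ⟨b, hb, hbb⟩ := hg.base.exists_bound_oscIntegrand (χ₀ n) hε
    refine HasDerivAt.const_mul _ (hasDerivAt_integral_of_dominated_loc_of_deriv_le (bound := b)
      (F' := fun r => oscIntegrand (χ₀ n) (g r) ε) (hO.mem_nhds hr) ?_ ?_ ?_ ?_ hb ?_).2
    · filter_upwards [hO.mem_nhds hr] with x hx
      exact (hf.base.continuous_oscIntegrand _ _ ⟨x, hx⟩).aestronglyMeasurable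
    · exact hf.base.integrable_oscIntegrand _ hε ⟨r, hr⟩
    · exact (hg.base.continuous_oscIntegrand _ _ ⟨r, hr⟩).aestronglyMeasurable
    · exact Eventually.of_forall fun z x hx => hbb ⟨x, hx⟩ z
    · refine Eventually.of_forall fun z x hx => ?_
      simp_rw [oscIntegrand_eq]
      exact ((hfg x hx z.1 z.2).const_mul _).const_mul _

/-! ### Two identities for oscillatory integrals -/

/-- Integration by parts in the regularized integrals; the derivative of the cutoff contributes a
term with a factor `ε`. -/
theorem AmpB.regInt_coord_mul {δ p q : ℝ} {f f' : Fam n T} {j : Fin n}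
    (hf : AmpB δ p q 0 0 f) (hf' : DerivFst j f f') {i l : ℕ} (hfb : AmpB δ p q i l f')
    {χ χ' : 𝓢(E n × E n, ℂ)} (hχ : ∀ (ε : ℝ) z, HasDerivAt
      (fun s : ℝ => χ (ε • (z + s • ((bv j, 0) : E n × E n)))) ((ε : ℂ) * χ' (ε • z)) 0)
    (t : T) {ε : ℝ} (hε : 0 < ε) :
    regInt χ (fun y η => (η j : ℂ) * f t y η) ε =
      -Complex.I * ((ε : ℂ) * regInt χ' (f t) ε + regInt χ (f' t) ε) := by
  have hc : AmpB δ (1 + p) (0 + q) (0 + 0) 0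
      ((fun (_ : T) (_ : E n) (η : E n) => (η j : ℂ)) * f) :=
    AmpB.mul (ampB_coord_snd δ j) hf
  have e1 : ∫ z : E n × E n, osc z * ((ε : ℂ) * (χ' (ε • z) * f t z.1 z.2) +
      χ (ε • z) * f' t z.1 z.2) =
      Complex.I * ∫ z : E n × E n, osc z * ((z.2 j : ℂ) * (χ (ε • z) * f t z.1 z.2)) := by
    have i1 : Integrable fun z : E n × E n => (ε : ℂ) * (χ' (ε • z) * f t z.1 z.2) +
        χ (ε • z) * f' t z.1 z.2 :=
      ((hf.integrable_cut χ' hε t).const_mul _).add (hfb.integrable_cut _ hε t)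
    have i2 : Integrable fun z : E n × E n => (z.2 j : ℂ) * (χ (ε • z) * f t z.1 z.2) :=
      (hc.integrable_cut χ hε t).congr (Eventually.of_forall fun z => by
        simp only [Pi.mul_apply]; ring)
    have i3 : ∀ z : E n × E n, HasLineDerivAt ℝ (fun z : E n × E n => χ (ε • z) * f t z.1 z.2)
        ((ε : ℂ) * (χ' (ε • z) * f t z.1 z.2) + χ (ε • z) * f' t z.1 z.2) z (bv j, 0) := by
      intro z
      have := HasDerivAt.mul (hχ ε z) (hf'.prod t z)
      refine HasDerivAt.congr_deriv this ?_
      rw [zero_smul, add_zero]; ring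
    exact integral_osc_mul_lineDeriv (hasLineDerivAt_osc_fst j) i3 (hf.integrable_cut _ hε t) i1 i2
  have e2 : ∀ z : E n × E n, oscIntegrand χ (fun y η => (η j : ℂ) * f t y η) ε z =
      osc z * ((z.2 j : ℂ) * (χ (ε • z) * f t z.1 z.2)) := fun z => by
    rw [oscIntegrand_eq]; ring
  have e3 : ∫ z : E n × E n, osc z * ((ε : ℂ) * (χ' (ε • z) * f t z.1 z.2) +
      χ (ε • z) * f' t z.1 z.2) =
      (ε : ℂ) * (∫ z, oscIntegrand χ' (f t) ε z) + ∫ z, oscIntegrand χ (f' t) ε z := by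
    rw [← integral_const_mul, ← integral_add
      ((hf.integrable_oscIntegrand _ hε t).const_mul _) (hfb.integrable_oscIntegrand _ hε t)]
    congr 1; funext z
    rw [oscIntegrand_eq, oscIntegrand_eq]; ring
  have e4 : ∫ z, oscIntegrand χ (fun y η => (η j : ℂ) * f t y η) ε z =
      -Complex.I * ((ε : ℂ) * (∫ z, oscIntegrand χ' (f t) ε z) +
        ∫ z, oscIntegrand χ (f' t) ε z) := by
    rw [← e3, e1, integral_congr_ae (Eventually.of_forall e2), ← mul_assoc]
    simp
  rw [regInt, e4, regInt, regInt]; ring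

/-- `Os-∬ e^{-iy·η} η_j f = Os-∬ e^{-iy·η} (-i ∂_{y_j} f)`. -/
theorem oscInt_coord_mul {δ p q : ℝ} (hδ : 0 ≤ δ) {L : ℕ} {f f' : Fam n T} {j : Fin n}
    (hf : Reg L (n + 1) (AmpB δ p q) f) (hp : p - L * (1 - δ) < -n) (hq : q < 1)
    (hf' : DerivFst j f f') {i l : ℕ} (hfb : AmpB δ p q i l f') (t : T) {a b : ℂ}
    (ha : HasOscInt (fun y η => (η j : ℂ) * f t y η) a) (hb : HasOscInt (f' t) b) :
    a = -Complex.I * b := by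
  obtain ⟨χ', hχ'⟩ : ∃ χ' : 𝓢(E n × E n, ℂ), ∀ (ε : ℝ) z, HasDerivAt
      (fun s : ℝ => χ₀ n (ε • (z + s • ((bv j, 0) : E n × E n)))) ((ε : ℂ) * χ' (ε • z)) 0 :=
    ⟨_, fun ε z => hasDerivAt_schwartz_smul (χ₀ n) ε z (bv j, 0)⟩
  obtain ⟨C, hC, hbd⟩ := exists_norm_regInt_le hδ hf hp hq χ'
  have h1 := (ha _ χ₀_zero).2
  have h2 := (hb _ χ₀_zero).2
  have h3 : Tendsto (fun ε : ℝ => (ε : ℂ) * regInt χ' (f t) ε) (𝓝[>] 0) (𝓝 0) := by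
    refine squeeze_zero_norm' ?_ (tendsto_const_mul_rpow C one_pos)
    filter_upwards [Ioc_mem_nhdsGT (zero_lt_one (α := ℝ))] with ε hε
    rw [norm_mul, Complex.norm_real, Real.norm_of_nonneg hε.1.le, Real.rpow_one, mul_comm]
    exact mul_le_mul_of_nonneg_right (hbd t ⟨ε, hε⟩) hε.1.le
  have h4 : Tendsto (fun ε : ℝ => -Complex.I * (((ε : ℂ) * regInt χ' (f t) ε) +
      regInt (χ₀ n) (f' t) ε)) (𝓝[>] 0) (𝓝 (-Complex.I * (0 + b))) :=
    (h3.add h2).const_mul _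
  rw [zero_add] at h4
  refine tendsto_nhds_unique h1 (h4.congr' ?_)
  filter_upwards [self_mem_nhdsWithin] with ε hε
  exact (hf.base.regInt_coord_mul hf' hfb hχ' t hε).symm

/-- The bump function as a Schwartz function on `ℝⁿ`. -/
noncomputable def bumpS (n : ℕ) : 𝓢(E n, ℂ) :=
  HasCompactSupport.toSchwartzMap (f := fun y : E n => ((bump n y : ℝ) : ℂ))
    ((bump n).hasCompactSupport.comp_left (g := fun r : ℝ => (r : ℂ)) Complex.ofReal_zero)
    (Complex.ofRealCLM.contDiff.comp (bump n).contDiff)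

theorem bumpS_apply (y : E n) : bumpS n y = ((bump n y : ℝ) : ℂ) := rfl

open FourierTransform in
/-- The Fourier transform with the kernel `e^{-iu·v}` of the bump function. -/
noncomputable def bumpHat (u : E n) : ℂ := 𝓕 (bumpS n) ((2 * Real.pi)⁻¹ • u)

open FourierTransform in
theorem bumpHat_eq (u : E n) : bumpHat u = ∫ v, osc (u, v) * bumpS n v := by
  rw [bumpHat, SchwartzMap.fourier_coe, Real.fourier_eq']
  congr 1; funext v
  rw [smul_eq_mul, osc]
  congr 2
  simp only [inner_smul_right, real_inner_comm v u]
  push_cast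
  field_simp

open FourierTransform in
theorem integrable_bumpHat : Integrable (bumpHat : E n → ℂ) :=
  ((𝓕 (bumpS n)).integrable).comp_smul (by positivity)

open FourierTransform in
theorem integral_bumpHat : ∫ u : E n, bumpHat u = (2 * Real.pi) ^ n := by
  have h1 : 𝓕⁻ (𝓕 (bumpS n)) = bumpS n := FourierPair.fourierInv_fourier_eq _
  have h2 : 𝓕⁻ (𝓕 (bumpS n)) 0 = 1 := by rw [h1, bumpS_apply, bump_zero]; simp
  rw [SchwartzMap.fourierInv_coe, Real.fourierInv_eq'] at h2
  simp only [inner_zero_right, mul_zero, Complex.ofReal_zero, zero_mul, Complex.exp_zero,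
    one_smul] at h2
  unfold bumpHat
  rw [Measure.integral_comp_smul, h2, finrank_euclideanSpace_fin, inv_pow, inv_inv,
    abs_of_pos (by positivity)]
  simp

/-- Fourier inversion: `Os-∬ e^{-iy·η} g(y) = g(0)`. -/
theorem HasOscInt.eq_apply_zero {g : E n → ℂ} (hg : Continuous g) {K : ℝ} (hK : ∀ y, ‖g y‖ ≤ K)
    {a : ℂ} (ha : HasOscInt (fun y _ => g y) a) : a = g 0 := by
  obtain ⟨M, hM, hMb⟩ := exists_schwartz_bound (χ₀ n)
  have hφ : ∀ y : E n, ‖bumpS n y‖ ≤ 1 := fun y => by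
    rw [bumpS_apply, Complex.norm_real, Real.norm_of_nonneg (bump n).nonneg]
    exact (bump n).le_one
  -- after the substitution `(y, η) ↦ (ε y, ε⁻¹ η)` the cutoff in `η` no longer depends on `ε`, and
  -- the integral over `η` is a Fourier transform
  have h1 : ∀ ε : ℝ, 0 < ε → ∫ p, oscIntegrand (χ₀ n) (fun y _ => g y) ε p =
      ∫ u, bumpS n (ε • ε • u) * g (ε • u) * bumpHat u := by
    intro ε hε
    set c : ℝˣ := Units.mk0 ε hε.ne'
    have hm := measurePreserving_scaleEquiv (n := n) c
    have he := (scaleEquiv (n := n) c).toHomeomorph.measurableEmbedding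
    have e1 : ∀ z : E n × E n, oscIntegrand (χ₀ n) (fun y _ => g y) ε (scaleEquiv c z) =
        (bumpS n (ε • ε • z.1) * g (ε • z.1)) * (osc z * bumpS n z.2) := by
      intro z
      rw [oscIntegrand_eq, osc_scaleEquiv, scaleEquiv_apply, χ₀_apply, bumpS_apply, bumpS_apply]
      simp only [c, Units.val_mk0, Prod.smul_mk, smul_inv_smul₀ hε.ne']
      push_cast; ring
    have e2 : Integrable fun z : E n × E n =>
        (bumpS n (ε • ε • z.1) * g (ε • z.1)) * (osc z * bumpS n z.2) := by
      have := (hm.integrable_comp_emb he).2 ((ha _ χ₀_zero).1 ε hε)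
      exact this.congr (Eventually.of_forall e1)
    rw [← hm.integral_comp he, integral_congr_ae (Eventually.of_forall e1),
      Measure.volume_eq_prod, integral_prod _ (by simpa [Measure.volume_eq_prod] using e2)]
    congr 1; funext u
    exact (integral_const_mul (bumpS n (ε • ε • u) * g (ε • u))
      (fun v => osc (u, v) * bumpS n v)).trans (by rw [bumpHat_eq])
  -- the limit, by dominated convergence
  have h2 : Tendsto (fun ε : ℝ => ∫ u, bumpS n (ε • ε • u) * g (ε • u) * bumpHat u) (𝓝[>] 0)
      (𝓝 (∫ u, g 0 * bumpHat (n := n) u)) := by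
    have hbc : Continuous (bumpHat : E n → ℂ) :=
      (SchwartzMap.continuous _).comp (continuous_const_smul _)
    refine tendsto_integral_filter_of_dominated_convergence (fun u => K * ‖bumpHat u‖) ?_ ?_
      (integrable_bumpHat.norm.const_mul K) ?_
    · exact Eventually.of_forall fun ε => Continuous.aestronglyMeasurable
        ((((bumpS n).continuous.comp (by fun_prop)).mul (hg.comp (by fun_prop))).mul hbc)
    · refine Eventually.of_forall fun ε => Eventually.of_forall fun u => ?_
      rw [norm_mul, norm_mul]
      have := hφ (ε • ε • u)
      have := hK (ε • u)
      have := norm_nonneg (g (ε • u))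
      exact mul_le_mul_of_nonneg_right (by nlinarith) (norm_nonneg _)
    · refine Eventually.of_forall fun u => ?_
      have hc : Continuous fun ε : ℝ => bumpS n (ε • ε • u) * g (ε • u) * bumpHat u :=
        (((bumpS n).continuous.comp (by fun_prop)).mul (hg.comp (by fun_prop))).mul
          continuous_const
      have h3 := (hc.tendsto 0).mono_left (nhdsWithin_le_nhds (s := Set.Ioi 0))
      simpa [bumpS_apply, bump_zero] using h3
  rw [integral_const_mul, integral_bumpHat] at h2
  have h3 := (ha _ χ₀_zero).2
  have h4 := h2.const_mul ((((2 * Real.pi) ^ n)⁻¹ : ℂ))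
  have h5 : (((2 * Real.pi) ^ n)⁻¹ : ℂ) * (g 0 * (2 * Real.pi) ^ n) = g 0 := by
    have : ((2 * Real.pi : ℂ)) ^ n ≠ 0 := pow_ne_zero _ (by simp [Real.pi_ne_zero])
    field_simp
  rw [h5] at h4
  refine tendsto_nhds_unique h3 (h4.congr' ?_)
  filter_upwards [self_mem_nhdsWithin] with ε hε
  rw [h1 ε hε]

/-! ### Iterated partial derivatives -/

/-- The multi-index with entry one at `j`. -/
abbrev ej (j : Fin n) : MultiIndex n := Pi.single j 1

theorem len_add (α β : MultiIndex n) : len (α + β) = len α + len β := by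
  simp [len, Finset.sum_add_distrib]

theorem len_ej (j : Fin n) : len (ej j) = 1 := by
  simp [len]

theorem len_add_ej (α : MultiIndex n) (j : Fin n) : len (α + ej j) = len α + 1 := by
  rw [len_add, len_ej]

theorem len_zero : len (0 : MultiIndex n) = 0 := by simp [len]

theorem exists_eq_add_ej {α : MultiIndex n} {k : ℕ} (h : len α = k + 1) :
    ∃ β j, α = β + ej j ∧ len β = k := by
  obtain ⟨j, hj⟩ : ∃ j, α j ≠ 0 := by
    by_contra! h0
    simp [len, h0] at h
  have h1 : α = (α - ej j) + ej j := by
    refine (tsub_add_cancel_of_le ?_).symm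
    intro i
    by_cases hi : i = j
    · subst hi; simp; omega
    · simp [Pi.single_eq_of_ne hi]
  refine ⟨α - ej j, j, h1, ?_⟩
  have := len_add_ej (α - ej j) j
  rw [← h1] at this
  omega

theorem eq_zero_of_len_eq_zero {α : MultiIndex n} (h : len α = 0) : α = 0 := by
  funext j
  have : ∀ j ∈ Finset.univ, α j = 0 := Finset.sum_eq_zero_iff.1 h
  exact this j (Finset.mem_univ j)

theorem pd_eq {f : E n → ℂ} {f' : E n → ℂ} {j : Fin n}
    (h : ∀ x, HasLineDerivAt ℝ f (f' x) x (bv j)) : pd j f = f' :=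
  funext fun x => (h x).lineDeriv

theorem pd_eq_fderiv {f : E n → ℂ} (hf : Differentiable ℝ f) (j : Fin n) :
    pd j f = fun x => fderiv ℝ f x (bv j) :=
  pd_eq fun x => (hf x).hasFDerivAt.hasLineDerivAt _

theorem hasLineDerivAt_pd {f : E n → ℂ} (hf : Differentiable ℝ f) (j : Fin n) (x : E n) :
    HasLineDerivAt ℝ f (pd j f x) x (bv j) := by
  rw [pd_eq_fderiv hf]
  exact (hf x).hasFDerivAt.hasLineDerivAt _

theorem contDiff_pd {f : E n → ℂ} {k : ℕ} (hf : ContDiff ℝ (k + 1 : ℕ) f) (j : Fin n) :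
    ContDiff ℝ k (pd j f) := by
  rw [pd_eq_fderiv (hf.differentiable (by simp))]
  exact (hf.fderiv_right (m := k) (by norm_cast)).clm_apply contDiff_const

theorem pd_comm {f : E n → ℂ} (hf : ContDiff ℝ 2 f) (i j : Fin n) :
    pd i (pd j f) = pd j (pd i f) := by
  have hd : Differentiable ℝ f := hf.differentiable (by norm_num)
  have h1 : ∀ i, ContDiff ℝ 1 (pd i f) := fun i => contDiff_pd (k := 1) (by exact_mod_cast hf) i
  have h2 : ∀ i, Differentiable ℝ (pd i f) := fun i => (h1 i).differentiable (by norm_num)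
  rw [pd_eq_fderiv (h2 j), pd_eq_fderiv (h2 i)]
  funext x
  have h3 : DifferentiableAt ℝ (fderiv ℝ f) x :=
    ((hf.fderiv_right (m := 1) (by norm_num)).differentiable (by norm_num)) x
  have h4 : ∀ i j, fderiv ℝ (pd j f) x (bv i) = fderiv ℝ (fderiv ℝ f) x (bv i) (bv j) := by
    intro i j
    rw [pd_eq_fderiv hd, fderiv_clm_apply h3 (differentiableAt_const _)]
    simp
  rw [h4, h4]
  exact (hf.contDiffAt.isSymmSndFDerivAt (by simp)).eq _ _

theorem contDiff_pd_iterate {k : ℕ} (m : ℕ) {f : E n → ℂ} (hf : ContDiff ℝ (k + m : ℕ) f)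
    (j : Fin n) : ContDiff ℝ k ((pd j)^[m] f) := by
  induction m generalizing f with
  | zero => exact hf
  | succ m ih => exact ih (contDiff_pd (k := k + m) (by exact_mod_cast hf) j)

theorem pd_iterate_comm {m : ℕ} {f : E n → ℂ} (hf : ContDiff ℝ (m + 1 : ℕ) f) (i j : Fin n) :
    (pd i)^[m] (pd j f) = pd j ((pd i)^[m] f) := by
  induction m generalizing f with
  | zero => rfl
  | succ m ih =>
    rw [Function.iterate_succ_apply, Function.iterate_succ_apply,
      pd_comm (hf.of_le (by norm_cast; omega)) i j,
      ih (contDiff_pd (k := m + 1) (by exact_mod_cast hf) i)]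

theorem contDiff_foldr_pd (α : MultiIndex n) (l : List (Fin n)) {k : ℕ} {f : E n → ℂ}
    (hf : ContDiff ℝ (k + (l.map α).sum : ℕ) f) :
    ContDiff ℝ k (l.foldr (fun j g => (pd j)^[α j] g) f) := by
  induction l generalizing k with
  | nil => simpa using hf
  | cons i l ih =>
    rw [List.foldr_cons]
    refine contDiff_pd_iterate _ (ih ?_) i
    simpa [add_assoc] using hf

theorem foldr_pd_add_of_notMem (α : MultiIndex n) (j : Fin n) (l : List (Fin n)) (hj : j ∉ l)
    (f : E n → ℂ) : l.foldr (fun i g => (pd i)^[(α + ej j) i] g) f =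
      l.foldr (fun i g => (pd i)^[α i] g) f := by
  induction l with
  | nil => rfl
  | cons i l ih =>
    rw [List.mem_cons, not_or] at hj
    rw [List.foldr_cons, List.foldr_cons, ih hj.2]
    simp [Pi.single_eq_of_ne (Ne.symm hj.1)]

theorem foldr_pd_add (α : MultiIndex n) (j : Fin n) (l : List (Fin n)) (hl : l.Nodup) (hj : j ∈ l)
    {f : E n → ℂ} (hf : ContDiff ℝ ((l.map α).sum + 1 : ℕ) f) :
    l.foldr (fun i g => (pd i)^[(α + ej j) i] g) f =
      pd j (l.foldr (fun i g => (pd i)^[α i] g) f) := by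
  induction l with
  | nil => simp at hj
  | cons i l ih =>
    rw [List.nodup_cons] at hl
    rw [List.foldr_cons, List.foldr_cons]
    by_cases hij : i = j
    · subst hij
      rw [foldr_pd_add_of_notMem α i l hl.1, Pi.add_apply, show ej i i = 1 from Pi.single_eq_same i 1,
        Function.iterate_succ_apply']
    · have hj' : j ∈ l := by
        rcases List.mem_cons.1 hj with h | h
        · exact absurd h.symm hij
        · exact h
      rw [List.map_cons, List.sum_cons] at hf
      rw [ih hl.2 hj' (hf.of_le (by norm_cast; omega)), Pi.add_apply,
        show ej j i = 0 from Pi.single_eq_of_ne hij 1, add_zero]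
      refine pd_iterate_comm (contDiff_foldr_pd α l (k := α i + 1) ?_) i j
      rwa [show α i + 1 + (l.map α).sum = α i + (l.map α).sum + 1 by omega]

theorem sum_map_finRange (α : MultiIndex n) : ((List.finRange n).map α).sum = len α := by
  simp [len, List.sum_ofFn, ← List.ofFn_eq_map]

theorem mpd_zero (f : E n → ℂ) : mpd 0 f = f := by
  unfold mpd
  induction List.finRange n with
  | nil => rfl
  | cons i l ih => rw [List.foldr_cons, ih]; rfl

theorem mpd_add_ej {α : MultiIndex n} {f : E n → ℂ} (hf : ContDiff ℝ (len α + 1 : ℕ) f)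
    (j : Fin n) : mpd (α + ej j) f = pd j (mpd α f) :=
  foldr_pd_add α j _ (List.nodup_finRange n) (List.mem_finRange j) (by rwa [sum_map_finRange])

theorem contDiff_mpd {α : MultiIndex n} {k : ℕ} {f : E n → ℂ}
    (hf : ContDiff ℝ (k + len α : ℕ) f) : ContDiff ℝ k (mpd α f) :=
  contDiff_foldr_pd α _ (by rwa [sum_map_finRange])

theorem hasLineDerivAt_mpd {α : MultiIndex n} {f : E n → ℂ} (hf : ContDiff ℝ (len α + 1 : ℕ) f)
    (j : Fin n) (x : E n) : HasLineDerivAt ℝ (mpd α f) (mpd (α + ej j) f x) x (bv j) := by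
  rw [mpd_add_ej hf]
  refine hasLineDerivAt_pd ?_ j x
  exact (contDiff_mpd (k := 1) (by rwa [add_comm])).differentiable (by norm_num)

/-- A family of functions, indexed by multi-indices, that is closed under partial derivatives
consists of the iterated partial derivatives of its members. -/
theorem mpd_eq_of_family {G : MultiIndex n → E n → ℂ} (M : ℕ)
    (h : ∀ γ, len γ < M → ∀ j x, HasLineDerivAt ℝ (G γ) (G (γ + ej j) x) x (bv j))
    (α γ : MultiIndex n) (hγ : len γ + len α ≤ M) : mpd α (G γ) = G (γ + α) := by
  have h1 : ∀ (j : Fin n) (m : ℕ) γ, len γ + m ≤ M →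
      (pd j)^[m] (G γ) = G (γ + Pi.single j m) := by
    intro j m
    induction m with
    | zero => intro γ _; simp
    | succ m ih =>
      intro γ hm
      rw [Function.iterate_succ_apply, pd_eq (h γ (by omega) j), ih _ (by rw [len_add_ej]; omega),
        add_assoc, ← Pi.single_add, add_comm 1 m]
  have h2 : ∀ l : List (Fin n), l.Nodup → len γ + (l.map α).sum ≤ M →
      l.foldr (fun j g => (pd j)^[α j] g) (G γ) =
        G (γ + (l.map fun j => (Pi.single j (α j) : MultiIndex n)).sum) ∧
        len (γ + (l.map fun j => (Pi.single j (α j) : MultiIndex n)).sum) =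
          len γ + (l.map α).sum := by
    intro l
    induction l with
    | nil => intro _ _; simp
    | cons i l ih =>
      intro hl hm
      rw [List.nodup_cons] at hl
      rw [List.map_cons, List.sum_cons] at hm
      obtain ⟨e1, e2⟩ := ih hl.2 (by omega)
      have e3 : len (Pi.single i (α i) : MultiIndex n) = α i := by simp [len]
      rw [List.foldr_cons, e1, h1 _ _ _ (by omega)]
      simp only [List.map_cons, List.sum_cons]
      refine ⟨by congr 1; abel, ?_⟩
      rw [show γ + ((Pi.single i (α i) : MultiIndex n) +
        (l.map fun j => (Pi.single j (α j) : MultiIndex n)).sum) =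
        (γ + (l.map fun j => (Pi.single j (α j) : MultiIndex n)).sum) + Pi.single i (α i) by abel,
        len_add, e2, e3]
      omega
  unfold mpd
  rw [(h2 _ (List.nodup_finRange n) (by rwa [sum_map_finRange])).1]
  congr 2
  rw [← List.ofFn_eq_map, List.sum_ofFn]
  exact Finset.univ_sum_single α

theorem pd_const_mul (c : ℂ) (j : Fin n) (f : E n → ℂ) :
    pd j (fun x => c * f x) = fun x => c * pd j f x :=
  funext fun _ => deriv_const_mul_field c

theorem mpd_const_mul (c : ℂ) (α : MultiIndex n) (f : E n → ℂ) :
    mpd α (fun x => c * f x) = fun x => c * mpd α f x := by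
  unfold mpd
  have h1 : ∀ (j : Fin n) (m : ℕ) (f : E n → ℂ),
      (pd j)^[m] (fun x => c * f x) = fun x => c * (pd j)^[m] f x := by
    intro j m
    induction m with
    | zero => intro f; rfl
    | succ m ih =>
      intro f
      rw [Function.iterate_succ_apply, pd_const_mul, ih, Function.iterate_succ_apply]
  induction List.finRange n with
  | nil => rfl
  | cons i l ih => rw [List.foldr_cons, ih, h1, List.foldr_cons]

/-! ### Interchanging partial derivatives -/

/-- A version of Schwarz's theorem: the mixed derivative is only assumed to exist in one order. -/
theorem hasDerivAt_swap {u w p q : ℝ → E n → ℂ} {v : E n}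
    (h1 : ∀ s x, HasDerivAt (fun r => u r x) (w s x) s)
    (hp : ∀ s x, HasLineDerivAt ℝ (u s) (p s x) x v)
    (hq : ∀ s x, HasLineDerivAt ℝ (w s) (q s x) x v)
    (hwc : Continuous fun z : ℝ × E n => w z.1 z.2)
    (hqc : Continuous fun z : ℝ × E n => q z.1 z.2) (s : ℝ) (x : E n) :
    HasDerivAt (fun r => p r x) (q s x) s := by
  have hw : ∀ x, Continuous fun σ => w σ x := fun x => hwc.comp (by fun_prop : Continuous fun σ : ℝ => (σ, x))
  have hq' : ∀ x, Continuous fun σ => q σ x := fun x => hqc.comp (by fun_prop : Continuous fun σ : ℝ => (σ, x))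
  -- integrate `w` in the real parameter and differentiate under the integral in the direction `v`
  have key : ∀ r, p r x = p s x + ∫ σ in s..r, q σ x := by
    intro r
    obtain ⟨C, hC⟩ := (isCompact_uIcc (a := s) (b := r)).prod (isCompact_closedBall (0 : ℝ) 1)
      |>.exists_bound_of_continuousOn (f := fun z : ℝ × ℝ => q z.1 (x + z.2 • v))
        (hqc.comp (by fun_prop : Continuous fun z : ℝ × ℝ => (z.1, x + z.2 • v))).continuousOn
    have e1 : HasDerivAt (fun t : ℝ => ∫ σ in s..r, w σ (x + t • v)) (∫ σ in s..r, q σ x) 0 := by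
      have := (intervalIntegral.hasDerivAt_integral_of_dominated_loc_of_deriv_le (𝕜 := ℝ)
        (μ := volume) (a := s) (b := r) (F := fun t σ => w σ (x + t • v))
        (F' := fun t σ => q σ (x + t • v)) (x₀ := 0) (bound := fun _ => C)
        (Metric.closedBall_mem_nhds (0 : ℝ) one_pos)
        (Eventually.of_forall fun t => (hw _).aestronglyMeasurable)
        ((hw _).intervalIntegrable _ _) (hq' _).aestronglyMeasurable
        (Eventually.of_forall fun σ hσ t ht => hC (σ, t) ⟨Set.uIoc_subset_uIcc hσ, ht⟩)
        intervalIntegrable_const (Eventually.of_forall fun σ _ t _ => ?_)).2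
      · simpa using this
      · have := hq σ (x + t • v)
        have h2 : HasDerivAt (fun r : ℝ => w σ (x + t • v + r • v)) (q σ (x + t • v)) (t - t) := by
          rw [sub_self]; exact this
        have := h2.comp_sub_const t t
        refine this.congr_of_eventuallyEq (Eventually.of_forall fun r => ?_)
        simp only
        congr 1
        module
    have e2 : HasDerivAt (fun t : ℝ => u r (x + t • v) - u s (x + t • v)) (p r x - p s x) 0 :=
      HasDerivAt.sub (hp r x) (hp s x)
    have e3 : (fun t : ℝ => u r (x + t • v) - u s (x + t • v)) =
        fun t : ℝ => ∫ σ in s..r, w σ (x + t • v) := by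
      funext t
      exact (intervalIntegral.integral_eq_sub_of_hasDerivAt (fun σ _ => h1 σ _)
        ((hw _).intervalIntegrable _ _)).symm
    rw [e3] at e2
    rw [← e2.unique e1]; ring
  have h2 : HasDerivAt (fun r => p s x + ∫ σ in s..r, q σ x) (q s x) s :=
    ((hq' x).integral_hasStrictDerivAt s s).hasDerivAt.const_add _
  exact h2.congr_of_eventuallyEq (Eventually.of_forall key)

/-- Partial derivatives with respect to different variables can be interchanged if the derivatives
in one order exist and are continuous. -/
theorem hasLineDerivAt_mpd_param {u w : E n → E n → ℂ} {v : E n} {β : MultiIndex n} {K : ℕ}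
    (hK : len β ≤ K) (hu : ∀ p, ContDiff ℝ K (u p)) (hw : ∀ p, ContDiff ℝ K (w p))
    (h : ∀ p x, HasLineDerivAt ℝ (fun r => u r x) (w p x) p v)
    (hc : ∀ γ, len γ ≤ K → Continuous fun z : E n × E n => mpd γ (w z.1) z.2) (p x : E n) :
    HasLineDerivAt ℝ (fun r => mpd β (u r) x) (mpd β (w p) x) p v := by
  have key : ∀ (k : ℕ) (β : MultiIndex n), len β = k → k ≤ K → ∀ s x, HasDerivAt
      (fun r : ℝ => mpd β (u (p + r • v)) x) (mpd β (w (p + s • v)) x) s := by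
    intro k
    induction k with
    | zero =>
      intro β hβ _ s x
      rw [eq_zero_of_len_eq_zero hβ]
      simp only [mpd_zero]
      have h2 : HasDerivAt (fun r : ℝ => u (p + s • v + r • v) x) (w (p + s • v) x) (s - s) := by
        rw [sub_self]; exact h _ _
      refine (h2.comp_sub_const s s).congr_of_eventuallyEq (Eventually.of_forall fun r => ?_)
      simp only
      congr 1
      module
    | succ k ih =>
      intro β hβ hk s x
      obtain ⟨γ, j, rfl, hγ⟩ := exists_eq_add_ej hβ
      have hle : ((len γ + 1 : ℕ) : WithTop ℕ∞) ≤ (K : WithTop ℕ∞) := by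
        rw [hγ]; exact_mod_cast hk
      refine hasDerivAt_swap (u := fun r => mpd γ (u (p + r • v)))
        (w := fun r => mpd γ (w (p + r • v))) (v := bv j) (ih γ hγ (by omega))
        (fun s x => hasLineDerivAt_mpd ((hu _).of_le hle) j x)
        (fun s x => hasLineDerivAt_mpd ((hw _).of_le hle) j x) ?_ ?_ s x
      · exact (hc γ (by omega)).comp (g := fun z : E n × E n => mpd γ (w z.1) z.2)
          (f := fun z : ℝ × E n => (p + z.1 • v, z.2)) (by fun_prop)
      · exact (hc (γ + ej j) (by omega)).comp
          (g := fun z : E n × E n => mpd (γ + ej j) (w z.1) z.2)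
          (f := fun z : ℝ × E n => (p + z.1 • v, z.2)) (by fun_prop)
  have := key _ β rfl hK 0 x
  simpa using! this

/-! ### Classes of weights -/

/-- The properties of the classes of bounded functions and of bounded decaying functions that are
used in the estimates. -/
structure WeightClass (W : (E n → ℝ) → Prop) : Prop where
  zero : W 0
  add : ∀ {C D}, W C → W D → W (C + D)
  dom : ∀ {C D} (K : ℝ), W C → (∀ x, |D x| ≤ K * |C x|) → W D
  bdd : ∀ {C}, W C → IsBdd C
  /-- Translations can be controlled at the cost of a small power of the translation. -/
  smear : ∀ {C} {q : ℝ}, W C → 0 < q →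
    ∃ ψ, W ψ ∧ (∀ z, 0 < ψ z) ∧ ∀ z y, |C (z + y)| ≤ ψ z * jb y ^ q

theorem weightClass_isBdd : WeightClass (IsBdd (n := n)) where
  zero := ⟨0, fun x => by simp⟩
  add := fun ⟨K, hK⟩ ⟨K', hK'⟩ => ⟨K + K', fun x => (abs_add_le _ _).trans
    (add_le_add (hK x) (hK' x))⟩
  dom := fun K ⟨K', hK'⟩ h => ⟨|K| * K', fun x => (h x).trans
    (mul_le_mul (le_abs_self K) (hK' x) (abs_nonneg _) (abs_nonneg _))⟩
  bdd := id
  smear := fun {C q} ⟨K, hK⟩ hq => by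
    have hK0 : 0 ≤ K := (abs_nonneg _).trans (hK 0)
    refine ⟨fun _ => K + 1, ⟨K + 1, fun _ => by rw [abs_of_nonneg (by linarith)]⟩,
      fun _ => by linarith, fun z y => (hK _).trans ?_⟩
    have := one_le_jb_rpow y hq.le
    nlinarith

theorem tendsto_jb_rpow_neg {q : ℝ} (hq : 0 < q) :
    Tendsto (fun z : E n => jb z ^ (-q)) (cocompact (E n)) (𝓝 0) := by
  have h1 : Tendsto (jb : E n → ℝ) (cocompact (E n)) atTop :=
    tendsto_atTop_mono norm_le_jb tendsto_norm_cocompact_atTop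
  exact (tendsto_rpow_neg_atTop hq).comp h1

theorem weightClass_isDecaying : WeightClass (IsDecaying (n := n)) where
  zero := ⟨weightClass_isBdd.zero, tendsto_const_nhds⟩
  add := fun hC hD => ⟨weightClass_isBdd.add hC.1 hD.1, by
    have h := hC.2.add hD.2
    rw [add_zero] at h
    exact h⟩
  dom := fun {C D} K hC h => ⟨weightClass_isBdd.dom K hC.1 h, by
    refine squeeze_zero_norm h ?_
    simpa using hC.2.abs.const_mul K⟩
  bdd := fun h => h.1
  smear := fun {C q} ⟨⟨K, hK⟩, hC⟩ hq => by
    have hK0 : 0 ≤ K := (abs_nonneg _).trans (hK 0)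
    -- The weight `ψ z = sup_y |C (z + y)| ⟨y⟩^{-q}` decays, since for large `z` either `z + y` or
    -- `y` is large. Below, `⟨z⟩⁻¹` is added to make it positive.
    let ψ : E n → ℝ := fun z => ⨆ y, |C (z + y)| * jb y ^ (-q)
    have hle : ∀ z y, |C (z + y)| * jb y ^ (-q) ≤ K := fun z y => by
      have h1 : jb y ^ (-q) ≤ 1 := Real.rpow_le_one_of_one_le_of_nonpos (one_le_jb y) (by linarith)
      have h2 := jb_rpow_pos y (-q)
      have := hK (z + y)
      have := abs_nonneg (C (z + y))
      nlinarith
    have hbd : ∀ z, BddAbove (Set.range fun y => |C (z + y)| * jb y ^ (-q)) := fun z =>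
      ⟨K, by rintro _ ⟨y, rfl⟩; exact hle z y⟩
    have hw0 : ∀ z, 0 ≤ ψ z := fun z =>
      Real.iSup_nonneg fun y => mul_nonneg (abs_nonneg _) (jb_rpow_pos _ _).le
    have hw1 : ∀ z, ψ z ≤ K := fun z => ciSup_le fun y => hle z y
    have hψ : Tendsto ψ (cocompact (E n)) (𝓝 0) := by
      rw [Metric.tendsto_nhds]
      intro ε hε
      have h1 : ∀ᶠ x in cocompact (E n), |C x| < ε / 2 := by
        have := hC.abs
        rw [abs_zero] at this
        exact this.eventually (gt_mem_nhds (by linarith))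
      obtain ⟨R, hR⟩ : ∃ R : ℝ, ∀ x, R ≤ ‖x‖ → |C x| < ε / 2 := by
        rw [← Metric.cobounded_eq_cocompact, ← comap_norm_atTop] at h1
        obtain ⟨R, hR⟩ := (eventually_atTop.1 (eventually_comap.1 h1))
        exact ⟨R, fun x hx => hR _ hx x rfl⟩
      have h2 : ∀ᶠ z in cocompact (E n), K * (‖z‖ - R) ^ (-q) < ε / 2 := by
        have h3 : Tendsto (fun z : E n => ‖z‖ - R) (cocompact (E n)) atTop :=
          tendsto_atTop_add_const_right _ (-R) (tendsto_norm_cocompact_atTop (E := E n))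
        have h4 := ((tendsto_rpow_neg_atTop hq).comp h3).const_mul K
        rw [mul_zero] at h4
        exact h4.eventually (gt_mem_nhds (by linarith))
      have h5 : ∀ᶠ z in cocompact (E n), R + 1 ≤ ‖z‖ :=
        (tendsto_norm_cocompact_atTop (E := E n)).eventually_ge_atTop _
      filter_upwards [h2, h5] with z hz hz'
      rw [dist_zero_right, Real.norm_of_nonneg (hw0 z)]
      refine (ciSup_le fun y => ?_).trans_lt (half_lt_self hε)
      rcases le_or_gt R ‖z + y‖ with h | h
      · have h1 : jb y ^ (-q) ≤ 1 :=
          Real.rpow_le_one_of_one_le_of_nonpos (one_le_jb y) (by linarith)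
        have h2 := jb_rpow_pos y (-q)
        have := hR _ h
        have := abs_nonneg (C (z + y))
        nlinarith
      · have h6 : ‖z‖ - R ≤ jb y := by
          have : ‖z‖ ≤ ‖z + y‖ + ‖y‖ := by
            calc ‖z‖ = ‖(z + y) - y‖ := by rw [add_sub_cancel_right]
              _ ≤ _ := norm_sub_le _ _
          linarith [norm_le_jb y]
        have h7 : jb y ^ (-q) ≤ (‖z‖ - R) ^ (-q) :=
          Real.rpow_le_rpow_of_nonpos (by linarith) h6 (by linarith)
        exact (mul_le_mul (hK _) h7 (jb_rpow_pos _ _).le hK0).trans hz.le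
    refine ⟨fun z => ψ z + jb z ^ (-1 : ℝ), ⟨⟨K + 1, fun z => ?_⟩, ?_⟩,
      fun z => add_pos_of_nonneg_of_pos (hw0 z) (jb_rpow_pos _ _), fun z y => ?_⟩
    · have h1 : jb z ^ (-1 : ℝ) ≤ 1 :=
        Real.rpow_le_one_of_one_le_of_nonpos (one_le_jb z) (by linarith)
      rw [abs_of_nonneg (add_nonneg (hw0 z) (jb_rpow_pos _ _).le)]
      linarith [hw1 z]
    · simpa using hψ.add (tendsto_jb_rpow_neg one_pos)
    · have h1 : |C (z + y)| * jb y ^ (-q) ≤ ψ z := le_ciSup (hbd z) y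
      have h2 := jb_rpow_pos y q
      have h3 := jb_rpow_pos z (-1)
      rw [Real.rpow_neg (jb_pos y).le, ← div_eq_mul_inv, div_le_iff₀ h2] at h1
      nlinarith

theorem WeightClass.finset_sum {W : (E n → ℝ) → Prop} (hW : WeightClass W) {ι : Type*}
    (s : Finset ι) (C : ι → E n → ℝ) (h : ∀ i ∈ s, W (C i)) : W (∑ i ∈ s, C i) := by
  classical
  induction s using Finset.induction_on with
  | empty => simpa using hW.zero
  | insert a s ha ih =>
    rw [Finset.sum_insert ha]
    exact hW.add (h a (Finset.mem_insert_self a s))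
      (ih fun i hi => h i (Finset.mem_insert_of_mem hi))

/-! ### Families of derivatives of double symbols -/

/-- A family `F β α β' α'` of functions of `(x, ξ, x', ξ')` that plays the role of
`∂_x^β ∂_ξ^α ∂_{x'}^{β'} ∂_{ξ'}^{α'} a` for a double symbol `a`: each partial derivative is given by
a shift of the corresponding multi-index, independently of the order of differentiation. The weights
in `x'` are taken from the class `W`. -/
structure SymFam (k : ℕ) (τ : ℝ≥0) (m₁ m₂ ρ δ : ℝ) (M₁ M₂ : ℕ∞) (W : (E n → ℝ) → Prop)
    (F : MultiIndex n → MultiIndex n → MultiIndex n → MultiIndex n → Fun4 n) : Prop where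
  cont : ∀ β α β' α', len β ≤ k → (len α : ℕ∞) ≤ M₁ → (len α' : ℕ∞) ≤ M₂ →
    Continuous fun p : E n × E n × E n × E n => F β α β' α' p.1 p.2.1 p.2.2.1 p.2.2.2
  deriv_x : ∀ β α β' α', len β + 1 ≤ k → (len α : ℕ∞) ≤ M₁ → (len α' : ℕ∞) ≤ M₂ →
    ∀ j x ξ x' ξ', HasLineDerivAt ℝ (fun z => F β α β' α' z ξ x' ξ')
      (F (β + ej j) α β' α' x ξ x' ξ') x (bv j)
  deriv_ξ : ∀ β α β' α', len β ≤ k → ((len α + 1 : ℕ) : ℕ∞) ≤ M₁ → (len α' : ℕ∞) ≤ M₂ →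
    ∀ j x ξ x' ξ', HasLineDerivAt ℝ (fun z => F β α β' α' x z x' ξ')
      (F β (α + ej j) β' α' x ξ x' ξ') ξ (bv j)
  deriv_x' : ∀ β α β' α', len β ≤ k → (len α : ℕ∞) ≤ M₁ → (len α' : ℕ∞) ≤ M₂ →
    ∀ j x ξ x' ξ', HasLineDerivAt ℝ (fun z => F β α β' α' x ξ z ξ')
      (F β α (β' + ej j) α' x ξ x' ξ') x' (bv j)
  deriv_ξ' : ∀ β α β' α', len β ≤ k → (len α : ℕ∞) ≤ M₁ → ((len α' + 1 : ℕ) : ℕ∞) ≤ M₂ →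
    ∀ j x ξ x' ξ', HasLineDerivAt ℝ (fun z => F β α β' α' x ξ x' z)
      (F β α β' (α' + ej j) x ξ x' ξ') ξ' (bv j)
  bound : ∀ β α β' α', len β ≤ k → (len α : ℕ∞) ≤ M₁ → (len α' : ℕ∞) ≤ M₂ →
    ∃ C : E n → ℝ, W C ∧ (∀ x', 0 ≤ C x') ∧ ∀ x ξ x' ξ', ‖F β α β' α' x ξ x' ξ'‖ ≤
      C x' * (jb ξ ^ (m₁ - ρ * len α + δ * len β) * jb ξ' ^ (m₂ - ρ * len α') *
        jb₂ ξ ξ' ^ (δ * len β'))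
  holder : ∀ β α β' α', len β ≤ k → (len α : ℕ∞) ≤ M₁ → (len α' : ℕ∞) ≤ M₂ →
    ∃ C : ℝ, 0 ≤ C ∧ ∀ x₁ x₂ ξ x' ξ', ‖F β α β' α' x₁ ξ x' ξ' - F β α β' α' x₂ ξ x' ξ'‖ ≤
      C * (jb ξ ^ (m₁ - ρ * len α + δ * (k + τ)) * jb ξ' ^ (m₂ - ρ * len α') *
        jb₂ ξ ξ' ^ (δ * len β')) * ‖x₁ - x₂‖ ^ (τ : ℝ)

/-- The family of all derivatives of `a`. -/
noncomputable def allDeriv (a : Fun4 n) (β α β' α' : MultiIndex n) : Fun4 n :=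
  dx β (dξ α (dx' β' (dξ' α' a)))

theorem dx_zero (a : Fun4 n) : dx 0 a = a := by
  funext x ξ x' ξ'; simp only [dx, mpd_zero]

theorem dξ_zero (a : Fun4 n) : dξ 0 a = a := by
  funext x ξ x' ξ'; simp only [dξ, mpd_zero]

theorem dx'_zero (a : Fun4 n) : dx' 0 a = a := by
  funext x ξ x' ξ'; simp only [dx', mpd_zero]

theorem dξ'_zero (a : Fun4 n) : dξ' 0 a = a := by
  funext x ξ x' ξ'; simp only [dξ', mpd_zero]

theorem norm_sub_le_of_eHolderNorm_le {τ : ℝ≥0} {f : E n → ℂ} {R : ℝ} (hR : 0 ≤ R)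
    (h : eHolderNorm τ f ≤ ENNReal.ofReal R) (x y : E n) :
    ‖f x - f y‖ ≤ R * ‖x - y‖ ^ (τ : ℝ) := by
  have h1 : MemHolder τ f := eHolderNorm_lt_top.1 (h.trans_lt ENNReal.ofReal_lt_top)
  have h2 : nnHolderNorm τ f ≤ R.toNNReal := by
    rw [← ENNReal.coe_le_coe, h1.coe_nnHolderNorm_eq_eHolderNorm]; exact h
  have h3 := h1.holderWith.dist_le x y
  rw [dist_eq_norm, dist_eq_norm] at h3
  refine h3.trans (mul_le_mul_of_nonneg_right ?_ (Real.rpow_nonneg (norm_nonneg _) _))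
  have : (nnHolderNorm τ f : ℝ) ≤ (R.toNNReal : ℝ) := by exact_mod_cast h2
  rwa [Real.coe_toNNReal R hR] at this

theorem natCast_le_of_succ_le {a : ℕ} {M : ℕ∞} (h : ((a + 1 : ℕ) : ℕ∞) ≤ M) : (a : ℕ∞) ≤ M :=
  le_trans (by exact_mod_cast Nat.le_succ a) h

theorem natCast_le_of_add_le {a b : ℕ} {M : ℕ∞} (h : ((a + b : ℕ) : ℕ∞) ≤ M) : (a : ℕ∞) ≤ M :=
  le_trans (by exact_mod_cast Nat.le_add_right a b) h

/-- The derivatives of a double symbol form a closed family: a partial derivative in any of the four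
variables can be moved past the derivatives in the variables that are taken later, one variable at a
time. -/
theorem IsDoubleSymbol.symFam {k : ℕ} {τ : ℝ≥0} {m₁ m₂ ρ δ : ℝ} {M₁ M₂ : ℕ∞} {a : Fun4 n}
    (ha : IsDoubleSymbol k τ m₁ m₂ ρ δ M₁ M₂ a) {W : (E n → ℝ) → Prop} (hW : WeightClass W)
    (hb : ∀ β α β' α' : MultiIndex n, len β ≤ k → (len α : ℕ∞) ≤ M₁ → (len α' : ℕ∞) ≤ M₂ →
      ∃ C C' : E n → ℝ, IsBdd C ∧ W C' ∧ DoubleBound m₁ m₂ ρ δ β α β' α' C C' a) :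
    SymFam k τ m₁ m₂ ρ δ M₁ M₂ W (allDeriv a) := by
  have hz : ∀ M : ℕ∞, (len (0 : MultiIndex n) : ℕ∞) ≤ M := fun M => by simp [len_zero]
  have cast : ∀ {l : ℕ} {M : ℕ∞}, (l : ℕ∞) ≤ M → (l : WithTop ℕ∞) ≤ (M : WithTop ℕ∞) :=
    fun h => by exact_mod_cast h
  -- the derivatives without the ones in `x`, and without the ones in `x` and `ξ`, are continuous
  have c3 : ∀ α β' α', (len α : ℕ∞) ≤ M₁ → (len α' : ℕ∞) ≤ M₂ →
      Continuous (fun p : E n × E n × E n × E n =>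
        dξ α (dx' β' (dξ' α' a)) p.1 p.2.1 p.2.2.1 p.2.2.2) := fun α β' α' h h' => by
    have := ha.continuous 0 α β' α' (by simp [len_zero]) h h'
    rwa [dx_zero] at this
  have c2 : ∀ β' α', (len α' : ℕ∞) ≤ M₂ → Continuous (fun p : E n × E n × E n × E n =>
        dx' β' (dξ' α' a) p.1 p.2.1 p.2.2.1 p.2.2.2) := fun β' α' h' => by
    have := c3 0 β' α' (hz _) h'
    rwa [dξ_zero] at this
  -- derivatives in a variable that is the last one to have been differentiated
  have a1 : ∀ α' j, ((len α' + 1 : ℕ) : ℕ∞) ≤ M₂ → ∀ x ξ x' ξ', HasLineDerivAt ℝ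
      (fun z => dξ' α' a x ξ x' z) (dξ' (α' + ej j) a x ξ x' ξ') ξ' (bv j) :=
    fun α' j h x ξ x' ξ' => hasLineDerivAt_mpd ((ha.contDiff_ξ' x ξ x').of_le (cast h)) j ξ'
  have b2 : ∀ β' α' j, (len α' : ℕ∞) ≤ M₂ → ∀ x ξ x' ξ', HasLineDerivAt ℝ
      (fun z => dx' β' (dξ' α' a) x ξ z ξ') (dx' (β' + ej j) (dξ' α' a) x ξ x' ξ') x' (bv j) :=
    fun β' α' j h x ξ x' ξ' => hasLineDerivAt_mpd
      ((ha.contDiff_x' α' h x ξ ξ').of_le (by exact_mod_cast le_top)) j x'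
  have c4 : ∀ α β' α' j, ((len α + 1 : ℕ) : ℕ∞) ≤ M₁ → (len α' : ℕ∞) ≤ M₂ → ∀ x ξ x' ξ',
      HasLineDerivAt ℝ (fun z => dξ α (dx' β' (dξ' α' a)) x z x' ξ')
        (dξ (α + ej j) (dx' β' (dξ' α' a)) x ξ x' ξ') ξ (bv j) :=
    fun α β' α' j h h' x ξ x' ξ' => hasLineDerivAt_mpd
      ((ha.contDiff_ξ β' α' h' x x' ξ').of_le (cast h)) j ξ
  -- a derivative in `ξ'` is moved past the ones in `x'`
  have a2 : ∀ β' α' j, ((len α' + 1 : ℕ) : ℕ∞) ≤ M₂ → ∀ x ξ x' ξ', HasLineDerivAt ℝ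
      (fun z => dx' β' (dξ' α' a) x ξ x' z) (dx' β' (dξ' (α' + ej j) a) x ξ x' ξ') ξ' (bv j) := by
    intro β' α' j h x ξ x' ξ'
    have h1 : (len (α' + ej j) : ℕ∞) ≤ M₂ := by rwa [len_add_ej]
    refine hasLineDerivAt_mpd_param (u := fun p z => dξ' α' a x ξ z p)
      (w := fun p z => dξ' (α' + ej j) a x ξ z p) le_rfl
      (fun p => (ha.contDiff_x' α' (natCast_le_of_succ_le h) x ξ p).of_le (by exact_mod_cast le_top))
      (fun p => (ha.contDiff_x' _ h1 x ξ p).of_le (by exact_mod_cast le_top))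
      (fun p z => a1 α' j h x ξ z p) (fun γ _ => ?_) ξ' x'
    exact (c2 γ _ h1).comp (by fun_prop : Continuous fun z : E n × E n => (x, ξ, z.2, z.1))
  -- a derivative in `x'` is moved past the ones in `ξ`
  have b3 : ∀ α β' α' j, (len α : ℕ∞) ≤ M₁ → (len α' : ℕ∞) ≤ M₂ → ∀ x ξ x' ξ', HasLineDerivAt ℝ
      (fun z => dξ α (dx' β' (dξ' α' a)) x ξ z ξ')
      (dξ α (dx' (β' + ej j) (dξ' α' a)) x ξ x' ξ') x' (bv j) := by
    intro α β' α' j h h' x ξ x' ξ'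
    refine hasLineDerivAt_mpd_param (u := fun p z => dx' β' (dξ' α' a) x z p ξ')
      (w := fun p z => dx' (β' + ej j) (dξ' α' a) x z p ξ') le_rfl
      (fun p => (ha.contDiff_ξ β' α' h' x p ξ').of_le (cast h))
      (fun p => (ha.contDiff_ξ _ α' h' x p ξ').of_le (cast h))
      (fun p z => b2 β' α' j h' x z p ξ') (fun γ hγ => ?_) x' ξ
    exact (c3 γ _ α' (le_trans (by exact_mod_cast hγ) h) h').comp
      (by fun_prop : Continuous fun z : E n × E n => (x, z.2, z.1, ξ'))
  -- a derivative in `ξ'` is moved past the ones in `ξ`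
  have a3 : ∀ α β' α' j, (len α : ℕ∞) ≤ M₁ → ((len α' + 1 : ℕ) : ℕ∞) ≤ M₂ → ∀ x ξ x' ξ',
      HasLineDerivAt ℝ (fun z => dξ α (dx' β' (dξ' α' a)) x ξ x' z)
        (dξ α (dx' β' (dξ' (α' + ej j) a)) x ξ x' ξ') ξ' (bv j) := by
    intro α β' α' j h h' x ξ x' ξ'
    have h1 : (len (α' + ej j) : ℕ∞) ≤ M₂ := by rwa [len_add_ej]
    refine hasLineDerivAt_mpd_param (u := fun p z => dx' β' (dξ' α' a) x z x' p)
      (w := fun p z => dx' β' (dξ' (α' + ej j) a) x z x' p) le_rfl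
      (fun p => (ha.contDiff_ξ β' α' (natCast_le_of_succ_le h') x x' p).of_le (cast h))
      (fun p => (ha.contDiff_ξ _ _ h1 x x' p).of_le (cast h))
      (fun p z => a2 β' α' j h' x z x' p) (fun γ hγ => ?_) ξ' ξ
    exact (c3 γ β' _ (le_trans (by exact_mod_cast hγ) h) h1).comp
      (by fun_prop : Continuous fun z : E n × E n => (x, z.2, x', z.1))
  -- finally, the derivatives in `ξ`, `x'` and `ξ'` are moved past the ones in `x`
  refine ⟨ha.continuous, ?_, ?_, ?_, ?_, ?_, ?_⟩
  · intro β α β' α' h h1 h2 j x ξ x' ξ'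
    exact hasLineDerivAt_mpd ((ha.contDiff_x α β' α' h1 h2 ξ x' ξ').of_le (by exact_mod_cast h)) j x
  · intro β α β' α' h h1 h2 j x ξ x' ξ'
    have h3 : (len (α + ej j) : ℕ∞) ≤ M₁ := by rwa [len_add_ej]
    refine hasLineDerivAt_mpd_param (u := fun p z => dξ α (dx' β' (dξ' α' a)) z p x' ξ')
      (w := fun p z => dξ (α + ej j) (dx' β' (dξ' α' a)) z p x' ξ') le_rfl
      (fun p => (ha.contDiff_x α β' α' (natCast_le_of_succ_le h1) h2 p x' ξ').of_le
        (by exact_mod_cast h))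
      (fun p => (ha.contDiff_x _ β' α' h3 h2 p x' ξ').of_le (by exact_mod_cast h))
      (fun p z => c4 α β' α' j h1 h2 z p x' ξ') (fun γ hγ => ?_) ξ x
    exact (ha.continuous γ _ β' α' (hγ.trans h) h3 h2).comp
      (by fun_prop : Continuous fun z : E n × E n => (z.2, z.1, x', ξ'))
  · intro β α β' α' h h1 h2 j x ξ x' ξ'
    refine hasLineDerivAt_mpd_param (u := fun p z => dξ α (dx' β' (dξ' α' a)) z ξ p ξ')
      (w := fun p z => dξ α (dx' (β' + ej j) (dξ' α' a)) z ξ p ξ') le_rfl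
      (fun p => (ha.contDiff_x α β' α' h1 h2 ξ p ξ').of_le (by exact_mod_cast h))
      (fun p => (ha.contDiff_x α _ α' h1 h2 ξ p ξ').of_le (by exact_mod_cast h))
      (fun p z => b3 α β' α' j h1 h2 z ξ p ξ') (fun γ hγ => ?_) x' x
    exact (ha.continuous γ α _ α' (hγ.trans h) h1 h2).comp
      (by fun_prop : Continuous fun z : E n × E n => (z.2, ξ, z.1, ξ'))
  · intro β α β' α' h h1 h2 j x ξ x' ξ'
    have h3 : (len (α' + ej j) : ℕ∞) ≤ M₂ := by rwa [len_add_ej]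
    refine hasLineDerivAt_mpd_param (u := fun p z => dξ α (dx' β' (dξ' α' a)) z ξ x' p)
      (w := fun p z => dξ α (dx' β' (dξ' (α' + ej j) a)) z ξ x' p) le_rfl
      (fun p => (ha.contDiff_x α β' α' h1 (natCast_le_of_succ_le h2) ξ x' p).of_le
        (by exact_mod_cast h))
      (fun p => (ha.contDiff_x α β' _ h1 h3 ξ x' p).of_le (by exact_mod_cast h))
      (fun p z => a3 α β' α' j h1 h2 z ξ x' p) (fun γ hγ => ?_) ξ' x
    exact (ha.continuous γ α β' _ (hγ.trans h) h1 h3).comp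
      (by fun_prop : Continuous fun z : E n × E n => (z.2, ξ, x', z.1))
  · intro β α β' α' h h1 h2
    obtain ⟨C, C', ⟨K, hK⟩, hC', hbd⟩ := hb β α β' α' h h1 h2
    have hK0 : 0 ≤ K := (abs_nonneg _).trans (hK 0)
    refine ⟨fun x' => K * |C' x'|, hW.dom K hC' fun x => le_of_eq (abs_of_nonneg (by positivity)),
      fun x' => by positivity,
      fun x ξ x' ξ' => (hbd x ξ x' ξ').trans ?_⟩
    · have h5 : C x * C' x' ≤ K * |C' x'| := by
        refine (le_abs_self _).trans ?_
        rw [abs_mul]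
        exact mul_le_mul_of_nonneg_right (hK x) (abs_nonneg _)
      have h6 := jb_rpow_pos ξ (m₁ - ρ * len α + δ * len β)
      have h7 := jb_rpow_pos ξ' (m₂ - ρ * len α')
      have h8 : 0 < jb₂ ξ ξ' ^ (δ * len β') :=
        Real.rpow_pos_of_pos (lt_of_lt_of_le one_pos (one_le_jb₂ _ _)) _
      rw [mul_assoc, mul_assoc, ← mul_assoc (jb ξ ^ _)]
      exact mul_le_mul_of_nonneg_right h5 (by positivity)
  · intro β α β' α' h h1 h2
    obtain ⟨C, hC⟩ := ha.holder α β' α' h1 h2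
    refine ⟨|C|, abs_nonneg C, fun x₁ x₂ ξ x' ξ' => ?_⟩
    have h6 := jb_rpow_pos ξ (m₁ - ρ * len α + δ * (k + τ))
    have h7 := jb_rpow_pos ξ' (m₂ - ρ * len α')
    have h8 : 0 < jb₂ ξ ξ' ^ (δ * len β') :=
      Real.rpow_pos_of_pos (lt_of_lt_of_le one_pos (one_le_jb₂ _ _)) _
    refine norm_sub_le_of_eHolderNorm_le (f := fun z => allDeriv a β α β' α' z ξ x' ξ')
      (by positivity) ?_ x₁ x₂
    calc eHolderNorm τ (fun z => allDeriv a β α β' α' z ξ x' ξ')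
        ≤ holderNorm₀ τ (fun z => allDeriv a β α β' α' z ξ x' ξ') := le_add_self
      _ ≤ holderNorm k τ (fun x => dξ α (dx' β' (dξ' α' a)) x ξ x' ξ') :=
          le_iSup₂ (f := fun (β : MultiIndex n) (_ : len β ≤ k) =>
            holderNorm₀ τ (mpd β fun x => dξ α (dx' β' (dξ' α' a)) x ξ x' ξ')) β h
      _ ≤ _ := (hC ξ x' ξ').trans (ENNReal.ofReal_le_ofReal ?_)
    rw [mul_assoc, mul_assoc, ← mul_assoc (jb ξ ^ _)]
    exact mul_le_mul_of_nonneg_right (le_abs_self C) (by positivity)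

/-! ### Amplitudes of arbitrary order -/

/-- Families of amplitudes of some finite order in `η`, with derivatives of all orders in `y`. The
exponent `1 / 4` of `⟨y⟩` is a choice: bounded and decaying weights have to be allowed to grow a
little under translations, and together with the rate of convergence `s = 1 / 2` the exponent has to
stay below one. -/
def IsAmp (δ : ℝ) (f : Fam n T) : Prop := ∃ p : ℝ, ∀ L, Reg L (n + 1) (AmpB δ p (1 / 4)) f

theorem IsAmp.add {δ : ℝ} {f g : Fam n T} (hf : IsAmp δ f) (hg : IsAmp δ g) :
    IsAmp δ (f + g) := by
  obtain ⟨p, hf⟩ := hf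
  obtain ⟨p', hg⟩ := hg
  refine ⟨max p p', fun L => Reg.add (fun _ _ _ _ => AmpB.add) ((hf L).mono fun i l f h => ?_)
    ((hg L).mono fun i l f h => ?_)⟩
  · exact h.mono (add_le_add (le_max_left _ _) le_rfl) le_rfl
  · exact h.mono (add_le_add (le_max_right _ _) le_rfl) le_rfl

theorem IsAmp.zero {δ : ℝ} : IsAmp δ (0 : Fam n T) :=
  ⟨0, fun _ => Reg.zero fun _ _ => AmpB.zero⟩

theorem IsAmp.sum {δ : ℝ} {ι : Type*} (s : Finset ι) {F : ι → Fam n T}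
    (h : ∀ i ∈ s, IsAmp δ (F i)) : IsAmp δ (∑ i ∈ s, F i) := by
  classical
  induction s using Finset.induction_on with
  | empty => simpa using IsAmp.zero
  | insert a s ha ih =>
    rw [Finset.sum_insert ha]
    exact (h a (Finset.mem_insert_self a s)).add
      (ih fun i hi => h i (Finset.mem_insert_of_mem hi))

theorem derivSnd_coord (i j : Fin n) : DerivSnd i (fun (_ : T) (_ η : E n) => (η j : ℂ))
    (fun _ _ _ => if i = j then 1 else 0) := by
  intro t y η
  have h := HasDerivAt.ofReal_comp (hasLineDerivAt_coord i j η)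
  refine HasDerivAt.congr_deriv h ?_
  split_ifs <;> simp

theorem derivFst_coord (i j : Fin n) : DerivFst i (fun (_ : T) (_ η : E n) => (η j : ℂ)) 0 :=
  fun _ _ _ => hasDerivAt_const _ _

theorem derivSnd_const (i : Fin n) (c : ℂ) : DerivSnd i (fun (_ : T) (_ _ : E n) => c) 0 :=
  fun _ _ _ => hasDerivAt_const _ _

theorem derivFst_const (i : Fin n) (c : ℂ) : DerivFst i (fun (_ : T) (_ _ : E n) => c) 0 :=
  fun _ _ _ => hasDerivAt_const _ _

theorem ampB_const {δ p q : ℝ} (hδ : 0 ≤ δ) (hp : 0 ≤ p) (hq : 0 ≤ q) {i l : ℕ} (c : ℂ) :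
    AmpB δ p q i l (fun (_ : T) (_ _ : E n) => c) :=
  ⟨fun _ => continuous_const, ‖c‖, norm_nonneg _, fun t y η => le_mul_of_one_le_right
    (norm_nonneg _) (one_le_mul_of_one_le_of_one_le (one_le_jb_rpow _ (by positivity))
      (one_le_jb_rpow _ hq))⟩

theorem reg_coord {δ : ℝ} (hδ : 0 ≤ δ) (L J : ℕ) (j : Fin n) :
    Reg L J (AmpB δ 1 0) (fun (_ : T) (_ η : E n) => (η j : ℂ)) := by
  have hc : ∀ c : ℂ, ∀ L J i l, Reg L J (fun i' l' => AmpB δ 1 0 (i' + i) (l' + l))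
      (fun (_ : T) (_ _ : E n) => c) := fun c L J i l =>
    Reg.intro (ampB_const hδ zero_le_one le_rfl c)
      (fun L' _ i => ⟨0, derivFst_const i c, Reg.zero fun _ _ => AmpB.zero⟩)
      (fun J' _ i => ⟨0, derivSnd_const i c, Reg.zero fun _ _ => AmpB.zero⟩)
  induction J with
  | zero =>
    exact Reg.intro (ampB_coord_snd δ j)
      (fun L' _ i => ⟨0, derivFst_coord i j, Reg.zero fun _ _ => AmpB.zero⟩) (by omega)
  | succ J ih =>
    refine Reg.intro (ampB_coord_snd δ j)
      (fun L' _ i => ⟨0, derivFst_coord i j, Reg.zero fun _ _ => AmpB.zero⟩)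
      (fun J' _ i => ⟨_, derivSnd_coord i j, ?_⟩)
    exact (hc _ L J' 0 1)

theorem IsAmp.coord_mul {δ : ℝ} (hδ : 0 ≤ δ) {f : Fam n T} (hf : IsAmp δ f) (j : Fin n) :
    IsAmp δ (fun t y η => (η j : ℂ) * f t y η) := by
  obtain ⟨p, hf⟩ := hf
  refine ⟨1 + p, fun L => ?_⟩
  have h := Reg.mul (B := AmpB δ (1 + p) (0 + 1 / 4)) (fun _ _ _ _ => AmpB.add)
    (fun _ _ _ _ _ _ h h' => h.mul h') (reg_coord (T := T) hδ L (n + 1) j) (hf L)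
  rw [zero_add] at h
  exact h

/-- The number of integrations by parts in `y` that makes the integrals over `η` converge. -/
theorem exists_order {δ : ℝ} (hδ : δ < 1) (p : ℝ) (n : ℕ) :
    ∃ L : ℕ, p + 1 / 2 - L * (1 - δ) < -n := by
  obtain ⟨L, hL⟩ := exists_nat_gt ((p + 1 / 2 + n) / (1 - δ))
  rw [div_lt_iff₀ (by linarith)] at hL
  exact ⟨L, by linarith⟩

theorem IsAmp.hasOscInt {δ : ℝ} (hδ₀ : 0 ≤ δ) (hδ₁ : δ < 1) {f : Fam n T} (hf : IsAmp δ f) (t : T) :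
    HasOscInt (f t) (oscInt (f t)) := by
  obtain ⟨p, hf⟩ := hf
  obtain ⟨L, hL⟩ := exists_order hδ₁ p n
  exact (exists_hasOscInt hδ₀ (by norm_num) (by norm_num) (hf L) hL (by norm_num)).1 t

theorem IsAmp.continuous_oscInt [TopologicalSpace T] [FirstCountableTopology T] {δ : ℝ}
    (hδ₀ : 0 ≤ δ) (hδ₁ : δ < 1) {f : Fam n T} (hf : IsAmp δ f)
    (hc : ∀ y η, Continuous fun t => f t y η) : Continuous fun t => oscInt (f t) := by
  obtain ⟨p, hf⟩ := hf
  obtain ⟨L, hL⟩ := exists_order hδ₁ p n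
  exact NonSmoothSymbol.continuous_oscInt hδ₀ (by norm_num) (by norm_num) (hf L) hL (by norm_num) hc

theorem IsAmp.hasDerivAt_oscInt {δ : ℝ} (hδ₀ : 0 ≤ δ) (hδ₁ : δ < 1)
    {f g : ℝ → E n → E n → ℂ} {O : Set ℝ} (hO : IsOpen O)
    (hf : IsAmp δ fun t : O => f t) (hg : IsAmp δ fun t : O => g t)
    (hfg : ∀ t ∈ O, ∀ y η, HasDerivAt (fun r => f r y η) (g t y η) t) {t : ℝ} (ht : t ∈ O) :
    HasDerivAt (fun r => oscInt (f r)) (oscInt (g t)) t := by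
  obtain ⟨p, hf⟩ := hf
  obtain ⟨p', hg⟩ := hg
  obtain ⟨L, hL⟩ := exists_order hδ₁ (max p p') n
  exact NonSmoothSymbol.hasDerivAt_oscInt hδ₀ (by norm_num) (by norm_num) hO
    ((hf L).mono fun i l f h => h.mono (add_le_add (le_max_left _ _) le_rfl) le_rfl)
    ((hg L).mono fun i l f h => h.mono (add_le_add (le_max_right _ _) le_rfl) le_rfl)
    hL (by norm_num) hfg ht

theorem IsAmp.oscInt_coord_mul {δ : ℝ} (hδ₀ : 0 ≤ δ) (hδ₁ : δ < 1) {f f' : Fam n T} {j : Fin n}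
    (hf : IsAmp δ f) (hf' : IsAmp δ f') (h : DerivFst j f f') (t : T) :
    oscInt (fun y η => (η j : ℂ) * f t y η) = -Complex.I * oscInt (f' t) := by
  have ha := (hf.coord_mul hδ₀ j).hasOscInt hδ₀ hδ₁ t
  have hb := hf'.hasOscInt hδ₀ hδ₁ t
  obtain ⟨p, hf⟩ := hf
  obtain ⟨p', hf'⟩ := hf'
  obtain ⟨L, hL⟩ := exists_order hδ₁ (max p p') n
  exact NonSmoothSymbol.oscInt_coord_mul hδ₀
    ((hf L).mono fun i l f h => h.mono (add_le_add (le_max_left _ p') le_rfl) le_rfl)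
    (by linarith) (by norm_num) h
    ((hf' 0).base.mono (add_le_add (le_max_right p _) le_rfl) le_rfl :
      AmpB δ (max p p') (1 / 4) 0 0 f') t ha hb

theorem HasOscInt.add {f g : E n → E n → ℂ} {a b : ℂ} (hf : HasOscInt f a) (hg : HasOscInt g b) :
    HasOscInt (fun y η => f y η + g y η) (a + b) := by
  intro χ hχ
  have e : ∀ ε, oscIntegrand χ (fun y η => f y η + g y η) ε =
      fun p => oscIntegrand χ f ε p + oscIntegrand χ g ε p := fun ε => by
    funext p; simp only [oscIntegrand]; ring
  refine ⟨fun ε hε => ?_, ?_⟩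
  · rw [e]; exact ((hf χ hχ).1 ε hε).add ((hg χ hχ).1 ε hε)
  · refine ((hf χ hχ).2.add (hg χ hχ).2).congr' ?_
    filter_upwards [self_mem_nhdsWithin] with ε hε
    rw [e, integral_add ((hf χ hχ).1 ε hε) ((hg χ hχ).1 ε hε), mul_add]

theorem HasOscInt.const_mul {f : E n → E n → ℂ} {a : ℂ} (hf : HasOscInt f a) (c : ℂ) :
    HasOscInt (fun y η => c * f y η) (c * a) := by
  intro χ hχ
  have e : ∀ ε, oscIntegrand χ (fun y η => c * f y η) ε =
      fun p => c * oscIntegrand χ f ε p := fun ε => by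
    funext p; simp only [oscIntegrand]; ring
  refine ⟨fun ε hε => ?_, ?_⟩
  · rw [e]; exact ((hf χ hχ).1 ε hε).const_mul c
  · refine ((hf χ hχ).2.const_mul c).congr fun ε => ?_
    rw [e, integral_const_mul]; ring

theorem HasOscInt.sum {ι : Type*} (s : Finset ι) {f : ι → E n → E n → ℂ} {a : ι → ℂ}
    (hf : ∀ i ∈ s, HasOscInt (f i) (a i)) :
    HasOscInt (fun y η => ∑ i ∈ s, f i y η) (∑ i ∈ s, a i) := by
  classical
  induction s using Finset.induction_on with
  | empty =>
    intro χ _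
    have e : ∀ ε, oscIntegrand χ (fun (_ _ : E n) => (0 : ℂ)) ε = 0 := fun ε => by
      funext p; simp [oscIntegrand]
    simp only [Finset.sum_empty]
    simp_rw [e]
    exact ⟨fun _ _ => integrable_zero _ _ _, by simp⟩
  | insert i s hi ih =>
    simp only [Finset.sum_insert hi]
    exact (hf i (Finset.mem_insert_self i s)).add (ih fun i hi => hf i (Finset.mem_insert_of_mem hi))

/-! ### Comparison of Japanese brackets -/

/-- With `ζ = ξ + μ η`, where `|μ| ≤ A ⟨ξ⟩^δ`, the brackets of `ξ` and `ζ` are comparable up to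
powers of `⟨η⟩`. -/
theorem jb_add_smul_le {δ A μ : ℝ} (hδ₁ : δ < 1) (hA : 0 ≤ A) (ξ η : E n)
    (hμ : |μ| ≤ A * jb ξ ^ δ) : jb (ξ + μ • η) ≤ (1 + A) * (jb ξ * jb η) := by
  have h1 : jb ξ ^ δ ≤ jb ξ := by
    simpa using jb_rpow_le ξ hδ₁.le
  have h2 := norm_le_jb η
  have h3 := one_le_jb η
  have h4 := jb_pos ξ
  refine (jb_add_le _ _).trans ?_
  rw [norm_smul, Real.norm_eq_abs]
  have h5 : |μ| * ‖η‖ ≤ A * jb ξ * jb η :=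
    mul_le_mul (hμ.trans (mul_le_mul_of_nonneg_left h1 hA)) h2 (norm_nonneg _) (by positivity)
  nlinarith

/-- Either the shift is small compared with `ξ`, and the brackets of `ξ` and `ξ + μ η` are
comparable, or `⟨ξ⟩^{1 - δ}` is bounded by a multiple of `⟨η⟩`. -/
theorem jb_le_add_smul {δ A μ : ℝ} (hδ₁ : δ < 1) (hA : 0 ≤ A) (ξ η : E n)
    (hμ : |μ| ≤ A * jb ξ ^ δ) :
    jb ξ ≤ (2 + (2 * A) ^ (1 / (1 - δ))) * (jb (ξ + μ • η) * jb η ^ (1 / (1 - δ))) := by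
  have hκ : 0 < 1 / (1 - δ) := by have : 0 < 1 - δ := by linarith
                                  positivity
  have h2 := norm_le_jb η
  have h3 := one_le_jb_rpow η hκ.le
  have h4 := jb_pos ξ
  have h5 := one_le_jb (ξ + μ • η)
  have h6 : 0 ≤ (2 * A) ^ (1 / (1 - δ)) := by positivity
  have h7 : |μ| * ‖η‖ ≤ A * jb ξ ^ δ * jb η :=
    mul_le_mul hμ h2 (norm_nonneg _) (by positivity)
  have h8 : jb ξ ≤ jb (ξ + μ • η) + |μ| * ‖η‖ := by
    have := jb_add_le (ξ + μ • η) (-(μ • η))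
    rwa [add_neg_cancel_right, norm_neg, norm_smul, Real.norm_eq_abs] at this
  have h10 : 1 ≤ jb (ξ + μ • η) * jb η ^ (1 / (1 - δ)) := one_le_mul_of_one_le_of_one_le h5 h3
  rcases le_or_gt (A * jb ξ ^ δ * jb η) (jb ξ / 2) with h | h
  · have h9 : jb (ξ + μ • η) ≤ jb (ξ + μ • η) * jb η ^ (1 / (1 - δ)) :=
      le_mul_of_one_le_right (jb_pos _).le h3
    nlinarith [mul_nonneg h6 (zero_le_one.trans h10)]
  · have h9 : jb ξ ^ (1 - δ) ≤ 2 * A * jb η := by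
      rw [Real.rpow_sub h4, Real.rpow_one, div_le_iff₀ (jb_rpow_pos _ _)]
      linarith
    have h11 : jb ξ ≤ (2 * A) ^ (1 / (1 - δ)) * jb η ^ (1 / (1 - δ)) := by
      have := Real.rpow_le_rpow (jb_rpow_pos _ _).le h9 hκ.le
      rw [Real.mul_rpow (by positivity) (jb_pos _).le, ← Real.rpow_mul h4.le,
        mul_one_div_cancel (by linarith), Real.rpow_one] at this
      exact this
    have h12 : jb η ^ (1 / (1 - δ)) ≤ jb (ξ + μ • η) * jb η ^ (1 / (1 - δ)) :=
      le_mul_of_one_le_left (by positivity) h5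
    nlinarith [mul_le_mul_of_nonneg_left h12 h6]

/-- A version of Peetre's inequality. -/
theorem exists_jb_add_smul_rpow_le (n : ℕ) {δ A : ℝ} (hδ₀ : 0 ≤ δ) (hδ₁ : δ < 1) (hA : 0 ≤ A)
    (s : ℝ) :
    ∃ C : ℝ, 0 ≤ C ∧ ∀ (ξ η : E n) (μ : ℝ), |μ| ≤ A * jb ξ ^ δ →
      jb (ξ + μ • η) ^ s ≤ C * (jb ξ ^ s * jb η ^ (1 / (1 - δ) * |s|)) := by
  have hκ : 1 ≤ 1 / (1 - δ) := by rw [le_div_iff₀ (by linarith)]; linarith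
  have h6 : 0 ≤ (2 * A) ^ (1 / (1 - δ)) := by positivity
  rcases le_total 0 s with hs | hs
  · refine ⟨(1 + A) ^ s, by positivity, fun ξ η μ hμ => ?_⟩
    rw [abs_of_nonneg hs]
    have h1 := jb_pos ξ
    have h2 := jb_pos η
    refine (Real.rpow_le_rpow (jb_pos _).le (jb_add_smul_le hδ₁ hA ξ η hμ) hs).trans ?_
    rw [Real.mul_rpow (by positivity) (by positivity), Real.mul_rpow h1.le h2.le]
    have := jb_rpow_le η (le_mul_of_one_le_left hs hκ)
    gcongr
  · refine ⟨(2 + (2 * A) ^ (1 / (1 - δ))) ^ (-s), by positivity, fun ξ η μ hμ => ?_⟩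
    rw [abs_of_nonpos hs]
    have h1 := jb_pos ξ
    have h2 := jb_rpow_pos η (1 / (1 - δ))
    have h3 := jb_pos (ξ + μ • η)
    have h4 := Real.rpow_le_rpow (z := -s) h1.le (jb_le_add_smul hδ₁ hA ξ η hμ) (by linarith)
    rw [Real.mul_rpow (by positivity) (by positivity), Real.mul_rpow h3.le h2.le,
      ← Real.rpow_mul (jb_pos η).le, Real.rpow_neg h1.le, Real.rpow_neg h3.le] at h4
    have h5 := jb_rpow_pos ξ s
    have h7 := jb_rpow_pos (ξ + μ • η) s
    set D := (2 + (2 * A) ^ (1 / (1 - δ))) ^ (-s)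
    set P := jb η ^ (1 / (1 - δ) * -s)
    calc jb (ξ + μ • η) ^ s = jb (ξ + μ • η) ^ s * jb ξ ^ s * (jb ξ ^ s)⁻¹ := by field_simp
      _ ≤ jb (ξ + μ • η) ^ s * jb ξ ^ s * (D * ((jb (ξ + μ • η) ^ s)⁻¹ * P)) := by gcongr
      _ = D * (jb ξ ^ s * P) := by field_simp

theorem jb₂_add_smul_le {δ A μ : ℝ} (hδ₁ : δ < 1) (hA : 0 ≤ A) (ξ η : E n)
    (hμ : |μ| ≤ A * jb ξ ^ δ) : jb₂ (ξ + μ • η) ξ ≤ (2 + A) * (jb ξ * jb η) := by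
  have h1 := jb_add_smul_le hδ₁ hA ξ η hμ
  have h2 := jb₂_le (ξ + μ • η) ξ
  have h3 : jb ξ ≤ jb ξ * jb η := le_mul_of_one_le_right (jb_pos ξ).le (one_le_jb η)
  linarith

/-! ### Amplitudes obtained from symbols -/

/-- A family of functions indexed by pairs of multi-indices that is closed under partial derivatives
gives regular families. -/
theorem Reg.of_family {L₀ J₀ : ℕ} {B : ℕ → ℕ → Fam n T → Prop}
    {G : MultiIndex n → MultiIndex n → Fam n T}
    (hF : ∀ a b, len a ≤ J₀ → len b < L₀ → ∀ j, DerivFst j (G a b) (G a (b + ej j)))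
    (hS : ∀ a b, len a < J₀ → len b ≤ L₀ → ∀ j, DerivSnd j (G a b) (G (a + ej j) b))
    (hB : ∀ a b, len a ≤ J₀ → len b ≤ L₀ → B (len b) (len a) (G a b)) :
    Reg L₀ J₀ B (G 0 0) := by
  have key : ∀ N L J a b, L + J = N → len b + L ≤ L₀ → len a + J ≤ J₀ →
      Reg L J (fun i l => B (i + len b) (l + len a)) (G a b) := by
    intro N
    induction N with
    | zero =>
      intro L J a b h h1 h2
      refine Reg.intro ?_ (by omega) (by omega)
      simpa using hB a b (by omega) (by omega)
    | succ N ih =>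
      intro L J a b h h1 h2
      refine Reg.intro (by simpa using hB a b (by omega) (by omega)) ?_ ?_
      · rintro L' rfl j
        refine ⟨_, hF a b (by omega) (by omega) j, ?_⟩
        have := ih L' J a (b + ej j) (by omega) (by rw [len_add_ej]; omega) h2
        refine this.mono fun i l f h => ?_
        rwa [len_add_ej, show i + (len b + 1) = i + 1 + len b by ring] at h
      · rintro J' rfl j
        refine ⟨_, hS a b (by omega) (by omega) j, ?_⟩
        have := ih L J' (a + ej j) b (by omega) h1 (by rw [len_add_ej]; omega)
        refine this.mono fun i l f h => ?_
        rwa [len_add_ej, show l + (len a + 1) = l + 1 + len a by ring] at h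
  simpa [len_zero] using key _ L₀ J₀ 0 0 rfl (by rw [len_zero]; omega) (by rw [len_zero]; omega)

theorem hasLineDerivAt_comp_affine {f : E n → ℂ} {f' : ℂ} {z y v : E n} {ν : ℝ}
    (h : HasLineDerivAt ℝ f f' (z + ν • y) v) :
    HasLineDerivAt ℝ (fun y => f (z + ν • y)) (ν * f') y v := by
  have h1 : HasDerivAt (fun r : ℝ => f (z + ν • y + r • v)) f' (ν * 0) := by
    rw [mul_zero]; exact h
  have h2 : HasDerivAt (fun r : ℝ => ν * r) (ν * 1) 0 := (hasDerivAt_id 0).const_mul ν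
  have h3 := h1.scomp (0 : ℝ) h2
  rw [mul_one, Complex.real_smul] at h3
  refine HasDerivAt.congr_of_eventuallyEq h3 (Eventually.of_forall fun r => ?_)
  simp only [Function.comp]
  congr 1
  module

/-- A family `H a b` of functions of `(ζ, x')` that plays the role of `∂_ζ^a ∂_{x'}^b H`, with the
estimates of a double symbol, where the last covariable is fixed to be `ξ t`. The number `K t` is an
additional bound. -/
structure AmpFam (W : (E n → ℝ) → Prop) (δ ρ s b₀ : ℝ) (K : T → ℝ) (ξ : T → E n)
    (H : MultiIndex n → MultiIndex n → Fam n T) : Prop where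
  cont : ∀ a b, len a ≤ n + 1 → ∀ t, Continuous fun p : E n × E n => H a b t p.1 p.2
  deriv_fst : ∀ a b, len a < n + 1 → ∀ j, DerivFst j (H a b) (H (a + ej j) b)
  deriv_snd : ∀ a b, len a ≤ n + 1 → ∀ j, DerivSnd j (H a b) (H a (b + ej j))
  bound : ∀ a b, len a ≤ n + 1 → ∃ C : E n → ℝ, W C ∧ (∀ x', 0 ≤ C x') ∧ ∀ t ζ x',
    ‖H a b t ζ x'‖ ≤ C x' * (K t * (jb ζ ^ (s - ρ * len a) * jb₂ ζ (ξ t) ^ (δ * (b₀ + len b))))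

/-- The multi-indices of length at most `N`. -/
def lenLE (n N : ℕ) : Finset (MultiIndex n) := (Finset.range (N + 1)).biUnion fun l => ofLen n l

theorem mem_ofLen {N : ℕ} {γ : MultiIndex n} : γ ∈ ofLen n N ↔ len γ = N := by
  simp [ofLen, len]

theorem mem_lenLE {N : ℕ} {γ : MultiIndex n} : γ ∈ lenLE n N ↔ len γ ≤ N := by
  simp [lenLE, mem_ofLen]

/-- One weight that controls the translations of finitely many weights. -/
theorem WeightClass.smear_family {W : (E n → ℝ) → Prop} (hW : WeightClass W) {q : ℝ} (hq : 0 < q)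
    (J L : ℕ) (C : MultiIndex n → MultiIndex n → E n → ℝ)
    (hC : ∀ a b, len a ≤ J → W (C a b)) (hC0 : ∀ a b, len a ≤ J → ∀ z, 0 ≤ C a b z) :
    ∃ ψ, W ψ ∧ (∀ z, 0 < ψ z) ∧ ∀ a b, len a ≤ J → len b ≤ L → ∀ z y,
      C a b (z + y) ≤ ψ z * jb y ^ q := by
  obtain ⟨ψ, h1, h2, h3⟩ := hW.smear (q := q) (C := ∑ a ∈ lenLE n J, ∑ b ∈ lenLE n L, C a b)
    (hW.finset_sum _ _ fun a ha => hW.finset_sum _ _ fun b _ => hC a b (mem_lenLE.1 ha)) hq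
  refine ⟨ψ, h1, h2, fun a b ha hb z y => le_trans ?_ ((le_abs_self _).trans (h3 z y))⟩
  simp only [Finset.sum_apply]
  exact (Finset.single_le_sum (f := fun b => C a b (z + y)) (fun b _ => hC0 a b ha _)
    (mem_lenLE.2 hb)).trans (Finset.single_le_sum
      (f := fun a => ∑ b ∈ lenLE n L, C a b (z + y))
      (fun a ha => Finset.sum_nonneg fun b _ => hC0 a b (mem_lenLE.1 ha) _) (mem_lenLE.2 ha))

/-- The order in `η` of the amplitudes obtained from a family of derivatives. -/
noncomputable def ampOrder (n : ℕ) (δ ρ s b₀ : ℝ) : ℝ :=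
  1 / (1 - δ) * (|s| + |ρ| * (n + 1)) + δ * b₀

/-- The substitution `y ↦ λ⁻¹ y`, `η ↦ λ η` with `λ` comparable to `⟨ξ⟩^δ` turns a double symbol
into an amplitude that satisfies estimates with constants proportional to the expected bound for the
oscillatory integral. -/
theorem AmpFam.reg_scaled {W : (E n → ℝ) → Prop} (hW : WeightClass W) {δ ρ s b₀ : ℝ}
    (hδ₀ : 0 ≤ δ) (hδ₁ : δ < 1) (hδρ : δ ≤ ρ) (hb₀ : 0 ≤ b₀) {K : T → ℝ} (hK : ∀ t, 0 < K t)
    {ξ : T → E n} {H : MultiIndex n → MultiIndex n → Fam n T} (h : AmpFam W δ ρ s b₀ K ξ H)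
    {θ l : T → ℝ} {A : ℝ} (hA : 1 ≤ A) (hθ : ∀ t, |θ t| ≤ 1) (hl : ∀ t, 1 ≤ l t)
    (hl₁ : ∀ t, l t ≤ A * jb (ξ t) ^ δ) (hl₂ : ∀ t, jb (ξ t) ^ δ ≤ A * l t)
    (z : T → E n) (L : ℕ) : ∃ ψ, W ψ ∧ (∀ z, 0 < ψ z) ∧
      Reg L (n + 1) (AmpB δ (ampOrder n δ ρ s b₀) (1 / 4)) (fun t y η =>
        (((ψ (z t) * (K t * jb (ξ t) ^ (s + δ * b₀)))⁻¹ : ℝ) : ℂ) *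
          H 0 0 t (ξ t + (θ t * l t) • η) (z t + (l t)⁻¹ • y)) := by
  have hA0 : 0 ≤ A := zero_le_one.trans hA
  have hb := h.bound
  choose! C hC hC0 hCb using hb
  obtain ⟨ψ, hψ, hψ0, hψC⟩ := hW.smear_family (q := 1 / 4) (by norm_num) (n + 1) L C
    (fun a b ha => hC a b ha) (fun a b ha => hC0 a b ha)
  refine ⟨ψ, hψ, hψ0, ?_⟩
  set c : T → ℝ := fun t => (ψ (z t) * (K t * jb (ξ t) ^ (s + δ * b₀)))⁻¹ with hc
  have hμ : ∀ t, |θ t * l t| ≤ A * jb (ξ t) ^ δ := fun t => by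
    rw [abs_mul, abs_of_pos (zero_lt_one.trans_le (hl t))]
    exact (mul_le_of_le_one_left (zero_le_one.trans (hl t)) (hθ t)).trans (hl₁ t)
  -- the derivatives after the substitution: by the chain rule, each derivative in `η` produces a
  -- factor `θ λ` and each derivative in `y` a factor `λ⁻¹`
  let G : MultiIndex n → MultiIndex n → Fam n T := fun a b t y η =>
    ((c t * (θ t * l t) ^ len a * (l t)⁻¹ ^ len b : ℝ) : ℂ) *
      H a b t (ξ t + (θ t * l t) • η) (z t + (l t)⁻¹ • y)
  have hG : G 0 0 = fun t y η => ((c t : ℝ) : ℂ) *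
      H 0 0 t (ξ t + (θ t * l t) • η) (z t + (l t)⁻¹ • y) := by
    funext t y η
    simp only [G, len_zero, pow_zero, mul_one]
  rw [← hG]
  refine Reg.of_family ?_ ?_ ?_
  · intro a b ha hb j t y η
    have h1 := hasLineDerivAt_comp_affine (h.deriv_snd a b ha j t (ξ t + (θ t * l t) • η)
      (z t + (l t)⁻¹ • y))
    refine HasDerivAt.congr_deriv (HasDerivAt.const_mul
      ((c t * (θ t * l t) ^ len a * (l t)⁻¹ ^ len b : ℝ) : ℂ) h1) ?_
    simp only [G, len_add_ej]
    push_cast; ring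
  · intro a b ha hb j t y η
    have h1 := hasLineDerivAt_comp_affine (h.deriv_fst a b ha j t (ξ t + (θ t * l t) • η)
      (z t + (l t)⁻¹ • y))
    refine HasDerivAt.congr_deriv (HasDerivAt.const_mul
      ((c t * (θ t * l t) ^ len a * (l t)⁻¹ ^ len b : ℝ) : ℂ) h1) ?_
    simp only [G, len_add_ej]
    push_cast; ring
  · intro a b ha hb
    obtain ⟨P, hP, hPb⟩ := exists_jb_add_smul_rpow_le n hδ₀ hδ₁ hA0 (s - ρ * len a)
    refine ⟨fun t => continuous_const.mul ((h.cont a b ha t).comp (f := fun p : E n × E n =>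
      (ξ t + (θ t * l t) • p.2, z t + (l t)⁻¹ • p.1)) (by fun_prop)),
      P * A ^ len a * A ^ len b * (2 + A) ^ (δ * (b₀ + len b)), by positivity,
      fun t y η => ?_⟩
    set ζ := ξ t + (θ t * l t) • η with hζ
    have hl0 : 0 < l t := zero_lt_one.trans_le (hl t)
    have hX := jb_pos (ξ t)
    have hY := jb_pos η
    have hDb : 0 ≤ δ * (b₀ + len b) := by positivity
    -- the estimate for the symbol, with all brackets expressed by `⟨ξ⟩` and `⟨η⟩`
    have e1 : ‖H a b t ζ (z t + (l t)⁻¹ • y)‖ ≤ ψ (z t) * jb y ^ (1 / 4 : ℝ) * (K t *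
        ((P * (jb (ξ t) ^ (s - ρ * len a) * jb η ^ (1 / (1 - δ) * |s - ρ * len a|))) *
        ((2 + A) ^ (δ * (b₀ + len b)) * (jb (ξ t) ^ (δ * (b₀ + len b)) *
          jb η ^ (δ * (b₀ + len b)))))) := by
      have g1 : C a b (z t + (l t)⁻¹ • y) ≤ ψ (z t) * jb y ^ (1 / 4 : ℝ) := by
        refine (hψC a b ha hb _ _).trans (mul_le_mul_of_nonneg_left ?_ (hψ0 _).le)
        refine Real.rpow_le_rpow (jb_pos _).le (jb_mono ?_) (by norm_num)
        rw [norm_smul, norm_inv, Real.norm_of_nonneg hl0.le]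
        exact mul_le_of_le_one_left (norm_nonneg _) (inv_le_one_of_one_le₀ (hl t))
      have g2 : jb₂ ζ (ξ t) ^ (δ * (b₀ + len b)) ≤ (2 + A) ^ (δ * (b₀ + len b)) *
          (jb (ξ t) ^ (δ * (b₀ + len b)) * jb η ^ (δ * (b₀ + len b))) := by
        rw [← Real.mul_rpow hX.le hY.le, ← Real.mul_rpow (by positivity) (by positivity)]
        exact Real.rpow_le_rpow (zero_le_one.trans (one_le_jb₂ _ _))
          (jb₂_add_smul_le hδ₁ hA0 _ _ (hμ t)) hDb
      have g3 := hPb (ξ t) η _ (hμ t)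
      have g4 : 0 ≤ jb₂ ζ (ξ t) ^ (δ * (b₀ + len b)) :=
        Real.rpow_nonneg (zero_le_one.trans (one_le_jb₂ _ _)) _
      refine (hCb a b ha t ζ _).trans ?_
      have := jb_rpow_pos ζ (s - ρ * len a)
      have := hK t
      have := hψ0 (z t)
      have := jb_rpow_pos y (1 / 4)
      gcongr
    -- the powers of `λ` compensate the loss or gain of powers of `⟨ξ⟩`
    have e2 : l t ^ len a * jb (ξ t) ^ (-(ρ * len a)) ≤ A ^ len a := by
      calc l t ^ len a * jb (ξ t) ^ (-(ρ * len a))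
          ≤ (A * jb (ξ t) ^ δ) ^ len a * jb (ξ t) ^ (-(δ * len a)) := by
            refine mul_le_mul (pow_le_pow_left₀ hl0.le (hl₁ t) _) (jb_rpow_le _ ?_)
              (jb_rpow_pos _ _).le (by positivity)
            exact neg_le_neg (mul_le_mul_of_nonneg_right hδρ (Nat.cast_nonneg _))
        _ = A ^ len a := by
          rw [mul_pow, ← Real.rpow_natCast (jb (ξ t) ^ δ), ← Real.rpow_mul hX.le, mul_assoc,
            ← jb_rpow_add, add_neg_cancel, Real.rpow_zero, mul_one]
    have e3 : (l t)⁻¹ ^ len b * jb (ξ t) ^ (δ * len b) ≤ A ^ len b := by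
      rw [Real.rpow_mul hX.le, Real.rpow_natCast, ← mul_pow]
      refine pow_le_pow_left₀ (by positivity) ?_ _
      rw [inv_mul_le_iff₀ hl0, mul_comm]
      exact hl₂ t
    have e4 : jb η ^ (1 / (1 - δ) * |s - ρ * len a|) * jb η ^ (δ * (b₀ + len b)) ≤
        jb η ^ (ampOrder n δ ρ s b₀ + δ * len b) := by
      rw [← jb_rpow_add]
      refine jb_rpow_le _ ?_
      have h1 : |s - ρ * len a| ≤ |s| + |ρ| * (n + 1) := by
        refine (abs_sub _ _).trans (add_le_add le_rfl ?_)
        rw [abs_mul, Nat.abs_cast]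
        exact mul_le_mul_of_nonneg_left (by exact_mod_cast ha) (abs_nonneg _)
      have h2 : 0 ≤ 1 / (1 - δ) := by
        have : 0 < 1 - δ := by linarith
        positivity
      have := mul_le_mul_of_nonneg_left h1 h2
      unfold ampOrder
      linarith
    have e5 : jb (ξ t) ^ (s - ρ * len a) * jb (ξ t) ^ (δ * (b₀ + len b)) =
        jb (ξ t) ^ (s + δ * b₀) * jb (ξ t) ^ (-(ρ * len a)) * jb (ξ t) ^ (δ * len b) := by
      rw [← jb_rpow_add, ← jb_rpow_add, ← jb_rpow_add]; congr 1; ring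
    have hn : ‖((c t * (θ t * l t) ^ len a * (l t)⁻¹ ^ len b : ℝ) : ℂ)‖ ≤
        c t * l t ^ len a * (l t)⁻¹ ^ len b := by
      have hc0 : 0 ≤ c t := by
        have := hψ0 (z t); have := hK t
        positivity
      rw [Complex.norm_real, norm_mul, norm_mul, Real.norm_of_nonneg hc0, norm_pow, norm_pow,
        norm_inv, norm_mul, Real.norm_of_nonneg hl0.le, Real.norm_eq_abs]
      have := mul_le_of_le_one_left hl0.le (hθ t)
      gcongr
    calc ‖G a b t y η‖ = ‖((c t * (θ t * l t) ^ len a * (l t)⁻¹ ^ len b : ℝ) : ℂ)‖ *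
          ‖H a b t ζ (z t + (l t)⁻¹ • y)‖ := norm_mul _ _
      _ ≤ _ := mul_le_mul hn e1 (norm_nonneg _) ((norm_nonneg _).trans hn)
      _ = (c t * (ψ (z t) * (K t * jb (ξ t) ^ (s + δ * b₀)))) * (P *
            (l t ^ len a * jb (ξ t) ^ (-(ρ * len a))) *
            ((l t)⁻¹ ^ len b * jb (ξ t) ^ (δ * len b)) * (2 + A) ^ (δ * (b₀ + len b)) *
            ((jb η ^ (1 / (1 - δ) * |s - ρ * len a|) * jb η ^ (δ * (b₀ + len b))) *
              jb y ^ (1 / 4 : ℝ))) := by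
          linear_combination (c t * l t ^ len a * (l t)⁻¹ ^ len b * ψ (z t) * jb y ^ (1 / 4 : ℝ) *
            K t * P * jb η ^ (1 / (1 - δ) * |s - ρ * len a|) * (2 + A) ^ (δ * (b₀ + len b)) *
            jb η ^ (δ * (b₀ + len b))) * e5
      _ = P * (l t ^ len a * jb (ξ t) ^ (-(ρ * len a))) *
            ((l t)⁻¹ ^ len b * jb (ξ t) ^ (δ * len b)) * (2 + A) ^ (δ * (b₀ + len b)) *
            ((jb η ^ (1 / (1 - δ) * |s - ρ * len a|) * jb η ^ (δ * (b₀ + len b))) *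
              jb y ^ (1 / 4 : ℝ)) := by
          rw [hc, inv_mul_cancel₀, one_mul]
          have := hψ0 (z t); have := hK t
          positivity
      _ ≤ _ := by
          have := jb_rpow_pos (ξ t) (-(ρ * len a))
          have := jb_rpow_pos (ξ t) (δ * len b)
          have := jb_rpow_pos y (1 / 4)
          gcongr

theorem abs_jb_rpow_le {R : ℝ} {ξ : E n} (h : ‖ξ‖ ≤ R) (s : ℝ) : jb ξ ^ s ≤ (1 + R) ^ |s| :=
  (jb_rpow_le ξ (le_abs_self s)).trans (Real.rpow_le_rpow (jb_pos ξ).le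
    ((jb_le_one_add ξ).trans (by linarith)) (abs_nonneg s))

/-- Over bounded sets of covariables, the double symbols define families of amplitudes. -/
theorem AmpFam.isAmp {W : (E n → ℝ) → Prop} (hW : WeightClass W) {δ ρ s b₀ : ℝ}
    (hδ₀ : 0 ≤ δ) (hδ₁ : δ < 1) (hδρ : δ ≤ ρ) (hb₀ : 0 ≤ b₀) {K : T → ℝ} (hK : ∀ t, 0 < K t)
    {ξ : T → E n} {H : MultiIndex n → MultiIndex n → Fam n T} (h : AmpFam W δ ρ s b₀ K ξ H)
    {θ : T → ℝ} (hθ : ∀ t, |θ t| ≤ 1) {R K₀ : ℝ} (hR : 0 ≤ R) (hξ : ∀ t, ‖ξ t‖ ≤ R)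
    (hK₀ : ∀ t, K t ≤ K₀) (z : T → E n) :
    IsAmp δ (fun t y η => H 0 0 t (ξ t + θ t • η) (z t + y)) := by
  refine ⟨ampOrder n δ ρ s b₀, fun L => ?_⟩
  have hA : (1 : ℝ) ≤ (1 + R) ^ δ := Real.one_le_rpow (by linarith) hδ₀
  -- no scaling is needed here, since the constants may depend on `R`
  obtain ⟨ψ, hψ, hψ0, hreg⟩ := h.reg_scaled hW hδ₀ hδ₁ hδρ hb₀ hK (l := fun _ => 1) hA hθ
    (fun _ => le_rfl) (fun t => one_le_mul_of_one_le_of_one_le hA (one_le_jb_rpow _ hδ₀))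
    (fun t => by
      rw [mul_one]
      exact Real.rpow_le_rpow (jb_pos _).le ((jb_le_one_add _).trans (by linarith [hξ t])) hδ₀) z L
  obtain ⟨P, hP⟩ := hW.bdd hψ
  have h1 := hreg.const_mul (B' := AmpB δ (ampOrder n δ ρ s b₀) (1 / 4))
    (fun t => ((ψ (z t) * (K t * jb (ξ t) ^ (s + δ * b₀)) : ℝ) : ℂ))
    (fun i l f hf => hf.const_mul (K := P * (K₀ * (1 + R) ^ |s + δ * b₀|)) fun t => by
      have g1 := hψ0 (z t)
      have g2 := hK t
      have g3 := (le_abs_self _).trans (hP (z t))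
      have g4 := hK₀ t
      have g5 := abs_jb_rpow_le (hξ t) (s + δ * b₀)
      have g6 := jb_rpow_pos (ξ t) (s + δ * b₀)
      rw [Complex.norm_real, Real.norm_of_nonneg (by positivity)]
      exact mul_le_mul g3 (mul_le_mul g4 g5 g6.le (g2.le.trans g4)) (by positivity)
        (g1.le.trans g3))
  convert! h1 using 1
  funext t y η
  have g1 := hψ0 (z t)
  have g2 := hK t
  have g6 := jb_rpow_pos (ξ t) (s + δ * b₀)
  rw [← mul_assoc, ← Complex.ofReal_mul, mul_inv_cancel₀ (by positivity), Complex.ofReal_one,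
    one_mul, mul_one, inv_one, one_smul]

/-- The oscillatory integrals satisfy the expected bounds. -/
theorem AmpFam.exists_norm_oscInt_le {W : (E n → ℝ) → Prop} (hW : WeightClass W) {δ ρ s b₀ : ℝ}
    (hδ₀ : 0 ≤ δ) (hδ₁ : δ < 1) (hδρ : δ ≤ ρ) (hb₀ : 0 ≤ b₀) {K : T → ℝ} (hK : ∀ t, 0 < K t)
    {ξ : T → E n} {H : MultiIndex n → MultiIndex n → Fam n T} (h : AmpFam W δ ρ s b₀ K ξ H)
    {θ : T → ℝ} (hθ : ∀ t, |θ t| ≤ 1) (z : T → E n) :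
    ∃ D, W D ∧ (∀ z, 0 ≤ D z) ∧ ∀ t,
      ‖oscInt (fun y η => H 0 0 t (ξ t + θ t • η) (z t + y))‖ ≤
        D (z t) * (K t * jb (ξ t) ^ (s + δ * b₀)) := by
  obtain ⟨L, hL⟩ := exists_order hδ₁ (ampOrder n δ ρ s b₀) n
  -- the scaling with `λ = ⟨ξ⟩^δ`, which is reversed in the end
  obtain ⟨ψ, hψ, hψ0, hreg⟩ := h.reg_scaled hW hδ₀ hδ₁ hδρ hb₀ hK
    (l := fun t => jb (ξ t) ^ δ) le_rfl hθ (fun t => one_le_jb_rpow _ hδ₀)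
    (fun t => by rw [one_mul]) (fun t => by rw [one_mul]) z L
  obtain ⟨h1, ⟨C, hC, h2⟩, -⟩ := exists_hasOscInt hδ₀ (s := 1 / 2) (by norm_num) (by norm_num)
    hreg hL (by norm_num)
  refine ⟨fun x => ψ x * C, hW.dom C hψ fun x => ?_, fun x => mul_nonneg (hψ0 x).le hC,
    fun t => ?_⟩
  · rw [abs_mul, abs_of_nonneg hC, mul_comm]
  have g1 := hψ0 (z t)
  have g2 := hK t
  have g6 := jb_rpow_pos (ξ t) (s + δ * b₀)
  have g7 := jb_rpow_pos (ξ t) δ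
  set N := ψ (z t) * (K t * jb (ξ t) ^ (s + δ * b₀)) with hN
  have hN0 : 0 < N := by positivity
  have h3 := ((h1 t).scale (Units.mk0 _ g7.ne')).const_mul (N : ℂ)
  have h4 : (fun y η : E n => (N : ℂ) * (((N⁻¹ : ℝ) : ℂ) *
      H 0 0 t (ξ t + (θ t * jb (ξ t) ^ δ) • ((jb (ξ t) ^ δ)⁻¹ • η))
        (z t + (jb (ξ t) ^ δ)⁻¹ • (jb (ξ t) ^ δ) • y))) =
      fun y η => H 0 0 t (ξ t + θ t • η) (z t + y) := by
    funext y η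
    rw [← mul_assoc, ← Complex.ofReal_mul, mul_inv_cancel₀ hN0.ne', Complex.ofReal_one, one_mul,
      smul_smul, smul_smul, inv_mul_cancel₀ g7.ne', one_smul, mul_assoc, mul_inv_cancel₀ g7.ne',
      mul_one]
  rw [Units.val_mk0, h4] at h3
  rw [h3.oscInt_eq, norm_mul, Complex.norm_real, Real.norm_of_nonneg hN0.le]
  calc N * _ ≤ N * C := mul_le_mul_of_nonneg_left (h2 t) hN0.le
    _ = _ := by rw [hN]; ring

/-! ### Functions with continuous partial derivatives -/

theorem hasDerivAt_line {f f' : E n → ℂ} {v : E n} (h : ∀ x, HasLineDerivAt ℝ f (f' x) x v)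
    (x : E n) (t : ℝ) : HasDerivAt (fun r : ℝ => f (x + r • v)) (f' (x + t • v)) t := by
  have h2 : HasDerivAt (fun r : ℝ => f (x + t • v + r • v)) (f' (x + t • v)) (t - t) := by
    rw [sub_self]; exact h _
  refine (h2.comp_sub_const t t).congr_of_eventuallyEq (Eventually.of_forall fun r => ?_)
  simp only
  congr 1
  module

/-- The chain rule on the diagonal for functions with continuous partial derivatives. -/
theorem hasDerivAt_diag {U U₁ U₂ : ℝ → ℝ → ℂ} (h₁ : ∀ s t, HasDerivAt (fun r => U r t) (U₁ s t) s)
    (h₂ : ∀ s t, HasDerivAt (fun r => U s r) (U₂ s t) t)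
    (c₁ : Continuous fun p : ℝ × ℝ => U₁ p.1 p.2) (c₂ : Continuous fun p : ℝ × ℝ => U₂ p.1 p.2)
    (t : ℝ) : HasDerivAt (fun r => U r r) (U₁ t t + U₂ t t) t := by
  have h := hasStrictFDerivAt_uncurry_coprod (𝕜 := ℝ) (u := (t, t)) (f := U)
    (f₁ := fun s r => ContinuousLinearMap.toSpanSingleton ℝ (U₁ s r))
    (f₂ := fun s r => ContinuousLinearMap.toSpanSingleton ℝ (U₂ s r))
    (Eventually.of_forall fun v => (h₁ v.1 v.2).hasFDerivAt)
    (Eventually.of_forall fun v => (h₂ v.1 v.2).hasFDerivAt)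
    ((ContinuousLinearMap.toSpanSingletonCLE (𝕜 := ℝ)).continuous.comp c₁).continuousAt
    ((ContinuousLinearMap.toSpanSingletonCLE (𝕜 := ℝ)).continuous.comp c₂).continuousAt
  have h' := HasFDerivAt.comp_hasDerivAt (f := fun r : ℝ => (r, r)) t h.hasFDerivAt
    ((hasDerivAt_id t).prodMk (hasDerivAt_id t))
  refine HasDerivAt.congr_deriv h' ?_
  simp [Function.HasUncurry.uncurry]

theorem norm_le_of_forall_coord {u h : E n} (hu : ∀ i, ‖u i‖ ≤ ‖h i‖) : ‖u‖ ≤ ‖h‖ := by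
  rw [EuclideanSpace.norm_eq, EuclideanSpace.norm_eq]
  exact Real.sqrt_le_sqrt (Finset.sum_le_sum fun i _ => pow_le_pow_left₀ (norm_nonneg _) (hu i) 2)

/-- A mean value estimate that uses partial derivatives only: one changes one coordinate at a
time. -/
theorem norm_sub_sum_le {f : E n → ℂ} {g : Fin n → E n → ℂ} {c : Fin n → ℂ} {R ε : ℝ} {x h : E n}
    (hf : ∀ j x, HasLineDerivAt ℝ f (g j x) x (bv j)) (hR : ‖h‖ ≤ R)
    (hc : ∀ j y, ‖y‖ ≤ R → ‖g j (x + y) - c j‖ ≤ ε) :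
    ‖f (x + h) - f x - ∑ j, (h j : ℂ) * c j‖ ≤ n * ε * ‖h‖ := by
  classical
  have key : ∀ s : Finset (Fin n),
      ‖f (x + ∑ j ∈ s, h j • bv j) - f x - ∑ j ∈ s, (h j : ℂ) * c j‖ ≤ s.card * ε * ‖h‖ := by
    intro s
    induction s using Finset.induction_on with
    | empty => simp
    | insert i s hi ih =>
      set u := ∑ j ∈ s, h j • (bv j : E n) with hu
      have hd : ∀ r : ℝ, HasDerivAt
          (fun r : ℝ => f (x + u + (h i * r) • bv i) - ((h i * r : ℝ) : ℂ) * c i)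
          ((h i : ℂ) * (g i (x + u + (h i * r) • bv i) - c i)) r := by
        intro r
        have h1 : HasDerivAt (fun r : ℝ => h i * r) (h i) r := by
          simpa using (hasDerivAt_id r).const_mul (h i)
        have h2 := (hasDerivAt_line (hf i) (x + u) (h i * r)).scomp r h1
        have h3 := (h1.ofReal_comp.mul_const (c i))
        refine (h2.sub h3).congr_deriv ?_
        rw [Complex.real_smul]; ring
      have hb : ∀ r ∈ Set.Ico (0 : ℝ) 1,
          ‖(h i : ℂ) * (g i (x + u + (h i * r) • bv i) - c i)‖ ≤ ε * ‖h‖ := by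
        intro r hr
        rw [norm_mul, Complex.norm_real, mul_comm]
        refine mul_le_mul ?_ (PiLp.norm_apply_le h i) (norm_nonneg _) ?_
        · rw [add_assoc]
          refine hc i _ ((norm_le_of_forall_coord fun l => ?_).trans hR)
          have e1 : (u + (h i * r) • bv i : E n) l =
              (if l ∈ s then h l else 0) + if l = i then h i * r else 0 := by
            simp [hu, Pi.single_apply, bv]
          rw [e1]
          by_cases hl : l = i
          · subst hl
            rw [if_neg hi, if_pos rfl, zero_add, norm_mul]
            refine mul_le_of_le_one_right (norm_nonneg _) ?_
            rw [Real.norm_of_nonneg hr.1]; exact hr.2.le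
          · rw [if_neg hl, add_zero]
            split_ifs
            · exact le_rfl
            · simp
        · exact (norm_nonneg _).trans (hc i 0 (by simpa using (norm_nonneg h).trans hR))
      have h4 := norm_image_sub_le_of_norm_deriv_le_segment_01'
        (fun r _ => (hd r).hasDerivWithinAt) hb
      rw [Finset.sum_insert hi, Finset.sum_insert hi, Finset.card_insert_of_notMem hi]
      have e2 : f (x + (h i • bv i + u)) - f x - ((h i : ℂ) * c i + ∑ j ∈ s, (h j : ℂ) * c j) =
          ((f (x + u + (h i * 1) • bv i) - ((h i * 1 : ℝ) : ℂ) * c i) -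
            (f (x + u + (h i * 0) • bv i) - ((h i * 0 : ℝ) : ℂ) * c i)) +
            (f (x + u) - f x - ∑ j ∈ s, (h j : ℂ) * c j) := by
        rw [mul_one, mul_zero, zero_smul, add_zero, show x + (h i • bv i + u) = x + u + h i • bv i
          by abel]
        push_cast; ring
      rw [e2]
      refine (norm_add_le _ _).trans ((add_le_add h4 ih).trans (le_of_eq ?_))
      push_cast
      ring
  have h1 := key Finset.univ
  have h2 : ∑ j, h j • (bv j : E n) = h := by
    ext l; simp [Pi.single_apply, bv]
  rwa [h2, Finset.card_univ, Fintype.card_fin] at h1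

/-- Continuous partial derivatives imply Fréchet differentiability. -/
theorem hasFDerivAt_of_partials {f : E n → ℂ} {g : Fin n → E n → ℂ}
    (hf : ∀ j x, HasLineDerivAt ℝ f (g j x) x (bv j)) (hg : ∀ j, Continuous (g j)) (x : E n) :
    HasFDerivAt f (∑ j, (EuclideanSpace.proj j : E n →L[ℝ] ℝ).smulRight (g j x)) x := by
  rw [hasFDerivAt_iff_isLittleO_nhds_zero, Asymptotics.isLittleO_iff]
  intro ε hε
  have h1 : ∀ᶠ y in 𝓝 (0 : E n), ∀ j, ‖g j (x + y) - g j x‖ < ε / (n + 1) := by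
    rw [eventually_all]
    intro j
    have h2 : ContinuousAt (fun y => ‖g j (x + y) - g j x‖) 0 :=
      Continuous.continuousAt (by have := hg j; fun_prop)
    refine h2.eventually (gt_mem_nhds ?_)
    simp only [add_zero, sub_self, norm_zero]
    positivity
  obtain ⟨R, hR, hb⟩ := Metric.eventually_nhds_iff.1 h1
  filter_upwards [Metric.closedBall_mem_nhds (0 : E n) (half_pos hR)] with h hh
  rw [mem_closedBall_zero_iff] at hh
  have h3 := norm_sub_sum_le (x := x) (c := fun j => g j x) hf hh
    (fun j y hy => (hb (by rw [dist_zero_right]; linarith) j).le)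
  have e1 : (∑ j, (EuclideanSpace.proj j : E n →L[ℝ] ℝ).smulRight (g j x)) h =
      ∑ j, (h j : ℂ) * g j x := by
    simp
  rw [e1]
  refine h3.trans (mul_le_mul_of_nonneg_right ?_ (norm_nonneg _))
  rw [mul_div_assoc', div_le_iff₀ (by positivity)]
  nlinarith

theorem contDiff_succ_of_partials {f : E n → ℂ} {g : Fin n → E n → ℂ} {l : ℕ}
    (hf : ∀ j x, HasLineDerivAt ℝ f (g j x) x (bv j)) (hg : ∀ j, ContDiff ℝ l (g j)) :
    ContDiff ℝ (l + 1 : ℕ) f := by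
  have := (contDiff_succ_iff_hasFDerivAt (𝕜 := ℝ) (n := l) (f := f)).2
    ⟨_, ContDiff.sum fun j _ => contDiff_const.smulRight (hg j), fun x =>
      hasFDerivAt_of_partials hf (fun j => (hg j).continuous) x⟩
  exact_mod_cast this

/-- Interpolation between a bound for a function and a bound for its partial derivatives. -/
theorem norm_sub_le_of_bounds {f : E n → ℂ} {g : Fin n → E n → ℂ} {A B X τ : ℝ} (hX : 0 < X)
    (hB : 0 ≤ B) (hτ₀ : 0 ≤ τ) (hτ₁ : τ ≤ 1)
    (hf : ∀ j x, HasLineDerivAt ℝ f (g j x) x (bv j)) (hA : ∀ x, ‖f x‖ ≤ A)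
    (hg : ∀ j x, ‖g j x‖ ≤ B * X) (x y : E n) :
    ‖f x - f y‖ ≤ (2 * A + n * B) * X ^ τ * ‖x - y‖ ^ τ := by
  have hA0 : 0 ≤ A := (norm_nonneg _).trans (hA 0)
  rw [mul_assoc, ← Real.mul_rpow hX.le (norm_nonneg _)]
  set Y := X * ‖x - y‖ with hY
  have hY0 : 0 ≤ Y := by positivity
  -- points at a distance of at most `X⁻¹` are compared by means of the derivatives, the others by
  -- means of the bound for the function
  rcases le_or_gt Y 1 with h | h
  · have h1 := norm_sub_sum_le (x := y) (h := x - y) (c := fun _ => 0) (ε := B * X) hf le_rfl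
      (fun j z _ => by simpa using hg j _)
    simp only [mul_zero, Finset.sum_const_zero, sub_zero, add_sub_cancel] at h1
    have h2 : Y ≤ Y ^ τ := by
      rcases hY0.eq_or_lt with h0 | h0
      · rw [← h0]; positivity
      · simpa using Real.rpow_le_rpow_of_exponent_ge h0 h hτ₁
    calc ‖f x - f y‖ ≤ n * B * Y := by rw [hY]; linarith
      _ ≤ (2 * A + n * B) * Y ^ τ := by
        refine mul_le_mul (by linarith) h2 hY0 (by positivity)
  · have h1 : 1 ≤ Y ^ τ := Real.one_le_rpow h.le hτ₀
    calc ‖f x - f y‖ ≤ A + A := (norm_sub_le _ _).trans (add_le_add (hA x) (hA y))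
      _ ≤ (2 * A + n * B) * 1 := by nlinarith [mul_nonneg (Nat.cast_nonneg (α := ℝ) n) hB]
      _ ≤ _ := mul_le_mul_of_nonneg_left h1 (by positivity)

/-! ### The oscillatory integrals of a family of derivatives -/

/-- The amplitude `f(x, ξ + θη, z + y, ξ)`, where the base point `z` of the third argument is
independent of `x`. -/
def ampl (f : Fun4 n) (θ : ℝ) (x z ξ : E n) : E n → E n → ℂ :=
  fun y η => f x (ξ + θ • η) (z + y) ξ

/-- The oscillatory integral of `f(x, ξ + θη, z + y, ξ)`. -/
noncomputable def oscV (f : Fun4 n) (θ : ℝ) (x z ξ : E n) : ℂ := oscInt (ampl f θ x z ξ)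

/-- The range of the parameter `θ`. -/
abbrev Theta : Type := Set.Icc (-1 : ℝ) 1

theorem Theta.abs_le (θ : Theta) : |(θ : ℝ)| ≤ 1 := _root_.abs_le.2 θ.2

theorem norm_bv (j : Fin n) : ‖(bv j : E n)‖ = 1 := by simp [bv]

namespace SymFam

variable {k : ℕ} {τ : ℝ≥0} {m₁ m₂ ρ δ : ℝ} {M₁ M₂ : ℕ∞} {W : (E n → ℝ) → Prop}
  {F : MultiIndex n → MultiIndex n → MultiIndex n → MultiIndex n → Fun4 n}

theorem order_le {α a : MultiIndex n} {l : ℕ} (hα : ((len α + l : ℕ) : ℕ∞) ≤ M₁) (ha : len a ≤ l) :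
    (len (α + a) : ℕ∞) ≤ M₁ := by
  refine le_trans ?_ hα
  rw [len_add]
  exact_mod_cast Nat.add_le_add_left ha _

/-- Fixing the first and the last variable of a family of derivatives. The additional `n + 1`
derivatives in `ξ` are the ones needed for the integrability in `y`. -/
theorem ampFam (hF : SymFam k τ m₁ m₂ ρ δ M₁ M₂ W F) {β α β' α' : MultiIndex n} (hβ : len β ≤ k)
    (hα : ((len α + (n + 1) : ℕ) : ℕ∞) ≤ M₁) (hα' : (len α' : ℕ∞) ≤ M₂) (x ξ : T → E n) :
    AmpFam W δ ρ (m₁ - ρ * len α + δ * len β) (len β') (fun t => jb (ξ t) ^ (m₂ - ρ * len α')) ξ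
      (fun a b t ζ x' => F β (α + a) (β' + b) α' (x t) ζ x' (ξ t)) where
  cont a b ha t := (hF.cont β (α + a) (β' + b) α' hβ (order_le hα ha) hα').comp
    (f := fun p : E n × E n => (x t, p.1, p.2, ξ t)) (by fun_prop)
  deriv_fst a b ha j t ζ x' := by
    rw [← add_assoc]
    refine hF.deriv_ξ β (α + a) (β' + b) α' hβ ?_ hα' j (x t) ζ x' (ξ t)
    have := order_le (a := a + ej j) hα (by rw [len_add_ej]; exact ha)
    rwa [← add_assoc, len_add_ej] at this
  deriv_snd a b ha j t ζ x' := by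
    rw [← add_assoc]
    exact hF.deriv_x' β (α + a) (β' + b) α' hβ (order_le hα ha) hα' j (x t) ζ x' (ξ t)
  bound a b ha := by
    obtain ⟨C, hC, hC0, h⟩ := hF.bound β (α + a) (β' + b) α' hβ (order_le hα ha) hα'
    refine ⟨C, hC, hC0, fun t ζ x' => (h (x t) ζ x' (ξ t)).trans (le_of_eq ?_)⟩
    rw [len_add, len_add]
    have e1 : m₁ - ρ * ((len α + len a : ℕ) : ℝ) + δ * len β =
        m₁ - ρ * len α + δ * len β - ρ * len a := by push_cast; ring
    rw [e1]
    push_cast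
    ring

variable (hW : WeightClass W) (hδ₀ : 0 ≤ δ) (hδ₁ : δ < 1) (hδρ : δ ≤ ρ)
  (hF : SymFam k τ m₁ m₂ ρ δ M₁ M₂ W F)

include hW hδ₀ hδ₁ hδρ hF

theorem isAmp {β α β' α' : MultiIndex n} (hβ : len β ≤ k)
    (hα : ((len α + (n + 1) : ℕ) : ℕ∞) ≤ M₁) (hα' : (len α' : ℕ∞) ≤ M₂) {θ : T → ℝ}
    (hθ : ∀ t, |θ t| ≤ 1) (x z : T → E n) {ξ : T → E n} {R : ℝ} (hR : 0 ≤ R) (hξ : ∀ t, ‖ξ t‖ ≤ R) :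
    IsAmp δ (fun t => ampl (F β α β' α') (θ t) (x t) (z t) (ξ t)) := by
  have h := (hF.ampFam (β' := β') hβ hα hα' x ξ).isAmp hW hδ₀ hδ₁ hδρ (Nat.cast_nonneg _)
    (fun t => jb_rpow_pos _ _) hθ hR hξ (fun t => abs_jb_rpow_le (hξ t) _) z
  simp only [add_zero] at h
  exact h

theorem hasOscInt {β α β' α' : MultiIndex n} (hβ : len β ≤ k)
    (hα : ((len α + (n + 1) : ℕ) : ℕ∞) ≤ M₁) (hα' : (len α' : ℕ∞) ≤ M₂) {θ : ℝ} (hθ : |θ| ≤ 1)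
    (x z ξ : E n) : HasOscInt (ampl (F β α β' α') θ x z ξ) (oscV (F β α β' α') θ x z ξ) :=
  (hF.isAmp hW hδ₀ hδ₁ hδρ (T := Unit) hβ hα hα' (fun _ => hθ) (fun _ => x) (fun _ => z)
    (ξ := fun _ => ξ) (norm_nonneg ξ) (fun _ => le_rfl)).hasOscInt hδ₀ hδ₁ ()

theorem continuous_oscV {β α β' α' : MultiIndex n} (hβ : len β ≤ k)
    (hα : ((len α + (n + 1) : ℕ) : ℕ∞) ≤ M₁) (hα' : (len α' : ℕ∞) ≤ M₂) :
    Continuous fun p : Theta × E n × E n × E n =>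
      oscV (F β α β' α') p.1 p.2.1 p.2.2.1 p.2.2.2 := by
  rw [continuous_iff_continuousAt]
  intro p
  have hO : IsOpen {q : Theta × E n × E n × E n | ‖q.2.2.2‖ < ‖p.2.2.2‖ + 1} :=
    isOpen_lt (by fun_prop) continuous_const
  refine ContinuousOn.continuousAt (s := {q : Theta × E n × E n × E n | ‖q.2.2.2‖ < ‖p.2.2.2‖ + 1})
    ?_ (hO.mem_nhds (by simp))
  rw [continuousOn_iff_continuous_domRestrict]
  have h := hF.isAmp hW hδ₀ hδ₁ hδρ (β' := β') hβ hα hα'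
    (T := {q : Theta × E n × E n × E n | ‖q.2.2.2‖ < ‖p.2.2.2‖ + 1})
    (fun t => t.1.1.abs_le) (fun t => t.1.2.1) (fun t => t.1.2.2.1) (ξ := fun t => t.1.2.2.2)
    (R := ‖p.2.2.2‖ + 1) (by positivity) (fun t => (show ‖t.1.2.2.2‖ < ‖p.2.2.2‖ + 1 from t.2).le)
  refine h.continuous_oscInt hδ₀ hδ₁ fun y η => ?_
  exact (hF.cont β α β' α' hβ (natCast_le_of_add_le hα) hα').comp
    (f := fun t : {q : Theta × E n × E n × E n | ‖q.2.2.2‖ < ‖p.2.2.2‖ + 1} =>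
      (t.1.2.1, t.1.2.2.2 + (t.1.1 : ℝ) • η, t.1.2.2.1 + y, t.1.2.2.2)) (by fun_prop)

theorem hasLineDerivAt_oscV_x {β α β' α' : MultiIndex n} (hβ : len β + 1 ≤ k)
    (hα : ((len α + (n + 1) : ℕ) : ℕ∞) ≤ M₁) (hα' : (len α' : ℕ∞) ≤ M₂) {θ : ℝ} (hθ : |θ| ≤ 1)
    (j : Fin n) (x z ξ : E n) :
    HasLineDerivAt ℝ (fun x => oscV (F β α β' α') θ x z ξ)
      (oscV (F (β + ej j) α β' α') θ x z ξ) x (bv j) := by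
  have h1 := hF.isAmp hW hδ₀ hδ₁ hδρ (β' := β') (by omega : len β ≤ k) hα hα'
    (T := (Set.univ : Set ℝ)) (θ := fun _ => θ) (fun _ => hθ) (fun t => x + (t : ℝ) • bv j)
    (fun _ => z) (ξ := fun _ => ξ) (norm_nonneg ξ) (fun _ => le_rfl)
  have h2 := hF.isAmp hW hδ₀ hδ₁ hδρ (β' := β') (by rw [len_add_ej]; exact hβ : len (β + ej j) ≤ k)
    hα hα' (T := (Set.univ : Set ℝ)) (θ := fun _ => θ) (fun _ => hθ) (fun t => x + (t : ℝ) • bv j)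
    (fun _ => z) (ξ := fun _ => ξ) (norm_nonneg ξ) (fun _ => le_rfl)
  have h3 := IsAmp.hasDerivAt_oscInt hδ₀ hδ₁ (O := Set.univ) isOpen_univ
    (f := fun t => ampl (F β α β' α') θ (x + t • bv j) z ξ)
    (g := fun t => ampl (F (β + ej j) α β' α') θ (x + t • bv j) z ξ) h1 h2
    (fun t _ y η => hasDerivAt_line (f := fun x => F β α β' α' x (ξ + θ • η) (z + y) ξ)
      (f' := fun x => F (β + ej j) α β' α' x (ξ + θ • η) (z + y) ξ)
      (fun x => hF.deriv_x β α β' α' hβ (natCast_le_of_add_le hα) hα' j x _ _ _) x t)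
    (Set.mem_univ (0 : ℝ))
  refine HasDerivAt.congr_deriv h3 ?_
  rw [zero_smul, add_zero]; rfl

theorem hasLineDerivAt_oscV_z {β α β' α' : MultiIndex n} (hβ : len β ≤ k)
    (hα : ((len α + (n + 1) : ℕ) : ℕ∞) ≤ M₁) (hα' : (len α' : ℕ∞) ≤ M₂) {θ : ℝ} (hθ : |θ| ≤ 1)
    (j : Fin n) (x z ξ : E n) :
    HasLineDerivAt ℝ (fun z => oscV (F β α β' α') θ x z ξ)
      (oscV (F β α (β' + ej j) α') θ x z ξ) z (bv j) := by
  have h1 := hF.isAmp hW hδ₀ hδ₁ hδρ (β' := β') hβ hα hα'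
    (T := (Set.univ : Set ℝ)) (θ := fun _ => θ) (fun _ => hθ) (fun _ => x)
    (fun t => z + (t : ℝ) • bv j) (ξ := fun _ => ξ) (norm_nonneg ξ) (fun _ => le_rfl)
  have h2 := hF.isAmp hW hδ₀ hδ₁ hδρ (β' := β' + ej j) hβ hα hα'
    (T := (Set.univ : Set ℝ)) (θ := fun _ => θ) (fun _ => hθ) (fun _ => x)
    (fun t => z + (t : ℝ) • bv j) (ξ := fun _ => ξ) (norm_nonneg ξ) (fun _ => le_rfl)
  have h3 := IsAmp.hasDerivAt_oscInt hδ₀ hδ₁ (O := Set.univ) isOpen_univ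
    (f := fun t => ampl (F β α β' α') θ x (z + t • bv j) ξ)
    (g := fun t => ampl (F β α (β' + ej j) α') θ x (z + t • bv j) ξ) h1 h2
    (fun t _ y η => by
      have h := hasDerivAt_line (f := fun z => F β α β' α' x (ξ + θ • η) z ξ)
        (f' := fun z => F β α (β' + ej j) α' x (ξ + θ • η) z ξ)
        (fun z => hF.deriv_x' β α β' α' hβ (natCast_le_of_add_le hα) hα' j x _ z _) (z + y) t
      simp only [ampl]
      simpa only [add_right_comm z y] using h)
    (Set.mem_univ (0 : ℝ))
  refine HasDerivAt.congr_deriv h3 ?_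
  rw [zero_smul, add_zero]; rfl

/-- The variable `ξ` enters both through `ξ + θη` and through the last argument, which gives two
terms. -/
theorem hasLineDerivAt_oscV_ξ {β α β' α' : MultiIndex n} (hβ : len β ≤ k)
    (hα : ((len α + 1 + (n + 1) : ℕ) : ℕ∞) ≤ M₁) (hα' : ((len α' + 1 : ℕ) : ℕ∞) ≤ M₂) {θ : ℝ}
    (hθ : |θ| ≤ 1) (j : Fin n) (x z ξ : E n) :
    HasLineDerivAt ℝ (fun ξ => oscV (F β α β' α') θ x z ξ)
      (oscV (F β (α + ej j) β' α') θ x z ξ + oscV (F β α β' (α' + ej j)) θ x z ξ) ξ (bv j) := by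
  have hα₁ : ((len α + (n + 1) : ℕ) : ℕ∞) ≤ M₁ := le_trans (by exact_mod_cast (by omega)) hα
  have hα₂ : ((len (α + ej j) + (n + 1) : ℕ) : ℕ∞) ≤ M₁ := by rwa [len_add_ej]
  have hα'₁ := natCast_le_of_succ_le hα'
  have hα'₂ : (len (α' + ej j) : ℕ∞) ≤ M₂ := by rwa [len_add_ej]
  have hα₃ : ((len α + 1 : ℕ) : ℕ∞) ≤ M₁ := le_trans (by exact_mod_cast (by omega)) hα
  have hR : ∀ t : Set.Ioo (-1 : ℝ) 1, ‖ξ + (t : ℝ) • (bv j : E n)‖ ≤ ‖ξ‖ + 1 := fun t => by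
    refine (norm_add_le _ _).trans (add_le_add le_rfl ?_)
    rw [norm_smul, norm_bv, mul_one, Real.norm_eq_abs]
    exact (abs_lt.2 t.2).le
  have hn : 0 ≤ ‖ξ‖ + 1 := by positivity
  have h1 := hF.isAmp hW hδ₀ hδ₁ hδρ (β' := β') hβ hα₁ hα'₁
    (T := Set.Ioo (-1 : ℝ) 1) (θ := fun _ => θ) (fun _ => hθ) (fun _ => x) (fun _ => z) hn hR
  have h2 := hF.isAmp hW hδ₀ hδ₁ hδρ (β' := β') hβ hα₂ hα'₁
    (T := Set.Ioo (-1 : ℝ) 1) (θ := fun _ => θ) (fun _ => hθ) (fun _ => x) (fun _ => z) hn hR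
  have h2' := hF.isAmp hW hδ₀ hδ₁ hδρ (β' := β') hβ hα₁ hα'₂
    (T := Set.Ioo (-1 : ℝ) 1) (θ := fun _ => θ) (fun _ => hθ) (fun _ => x) (fun _ => z) hn hR
  have h3 := IsAmp.hasDerivAt_oscInt hδ₀ hδ₁ (O := Set.Ioo (-1 : ℝ) 1) isOpen_Ioo
    (f := fun t => ampl (F β α β' α') θ x z (ξ + t • bv j))
    (g := fun t y η => ampl (F β (α + ej j) β' α') θ x z (ξ + t • bv j) y η +
      ampl (F β α β' (α' + ej j)) θ x z (ξ + t • bv j) y η) h1 (h2.add h2')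
    (fun t _ y η => by
      have h := hasDerivAt_diag
        (U := fun s t => F β α β' α' x (ξ + θ • η + s • bv j) (z + y) (ξ + t • bv j))
        (U₁ := fun s t => F β (α + ej j) β' α' x (ξ + θ • η + s • bv j) (z + y) (ξ + t • bv j))
        (U₂ := fun s t => F β α β' (α' + ej j) x (ξ + θ • η + s • bv j) (z + y) (ξ + t • bv j))
        (fun s t => hasDerivAt_line (f := fun ζ => F β α β' α' x ζ (z + y) (ξ + t • bv j))
          (f' := fun ζ => F β (α + ej j) β' α' x ζ (z + y) (ξ + t • bv j))
          (fun ζ => hF.deriv_ξ β α β' α' hβ hα₃ hα'₁ j x ζ _ _) (ξ + θ • η) s)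
        (fun s t => hasDerivAt_line (f := fun ζ => F β α β' α' x (ξ + θ • η + s • bv j) (z + y) ζ)
          (f' := fun ζ => F β α β' (α' + ej j) x (ξ + θ • η + s • bv j) (z + y) ζ)
          (fun ζ => hF.deriv_ξ' β α β' α' hβ (natCast_le_of_succ_le hα₃) hα' j x _ _ ζ) ξ t)
        ((hF.cont β (α + ej j) β' α' hβ (natCast_le_of_add_le hα₂) hα'₁).comp
          (f := fun p : ℝ × ℝ => (x, ξ + θ • η + p.1 • bv j, z + y, ξ + p.2 • bv j))
          (by fun_prop))
        ((hF.cont β α β' (α' + ej j) hβ (natCast_le_of_add_le hα₁) hα'₂).comp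
          (f := fun p : ℝ × ℝ => (x, ξ + θ • η + p.1 • bv j, z + y, ξ + p.2 • bv j))
          (by fun_prop)) t
      simp only [ampl]
      simpa only [add_right_comm ξ (θ • η)] using h)
    (t := 0) (by norm_num)
  refine HasDerivAt.congr_deriv h3 ?_
  simp only [zero_smul, add_zero]
  exact ((hF.hasOscInt hW hδ₀ hδ₁ hδρ hβ hα₂ hα'₁ hθ x z ξ).add
    (hF.hasOscInt hW hδ₀ hδ₁ hδρ hβ hα₁ hα'₂ hθ x z ξ)).oscInt_eq

theorem exists_norm_oscV_le {β α β' α' : MultiIndex n} (hβ : len β ≤ k)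
    (hα : ((len α + (n + 1) : ℕ) : ℕ∞) ≤ M₁) (hα' : (len α' : ℕ∞) ≤ M₂) :
    ∃ D, W D ∧ (∀ z, 0 ≤ D z) ∧ ∀ (θ : Theta) x z ξ, ‖oscV (F β α β' α') θ x z ξ‖ ≤
      D z * jb ξ ^ (m₁ + m₂ - ρ * (len α + len α') + δ * (len β + len β')) := by
  obtain ⟨D, hD, hD0, h⟩ := (hF.ampFam (β' := β') hβ hα hα'
    (T := Theta × E n × E n × E n) (fun t => t.2.1) (fun t => t.2.2.2)).exists_norm_oscInt_le hW hδ₀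
    hδ₁ hδρ (Nat.cast_nonneg _) (fun t => jb_rpow_pos _ _) (θ := fun t => t.1) (fun t => t.1.abs_le)
    (fun t => t.2.2.1)
  refine ⟨D, hD, hD0, fun θ x z ξ => ?_⟩
  have h1 := h (θ, x, z, ξ)
  simp only [add_zero, ← jb_rpow_add] at h1
  refine h1.trans (le_of_eq ?_)
  congr 2; ring

/-- Hölder continuity in `x`, inherited from the symbol. -/
theorem exists_norm_oscV_sub_le {β α β' α' : MultiIndex n} (hβ : len β ≤ k)
    (hα : ((len α + (n + 1) : ℕ) : ℕ∞) ≤ M₁) (hα' : (len α' : ℕ∞) ≤ M₂) :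
    ∃ C : ℝ, 0 ≤ C ∧ ∀ (θ : Theta) x₁ x₂ z ξ,
      ‖oscV (F β α β' α') θ x₁ z ξ - oscV (F β α β' α') θ x₂ z ξ‖ ≤
        C * jb ξ ^ (m₁ + m₂ - ρ * (len α + len α') + δ * (k + τ + len β')) *
          ‖x₁ - x₂‖ ^ (τ : ℝ) := by
  -- the differences of the symbols at `x₁` and `x₂` satisfy the estimates of a symbol with the
  -- additional factor `‖x₁ - x₂‖^τ`
  have hA : AmpFam (IsBdd (n := n)) δ ρ (m₁ - ρ * len α + δ * (k + τ)) (len β')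
      (fun t : {t : Theta × E n × E n × E n × E n // t.2.1 ≠ t.2.2.1} =>
        ‖t.1.2.1 - t.1.2.2.1‖ ^ (τ : ℝ) * jb t.1.2.2.2.2 ^ (m₂ - ρ * len α'))
      (fun t => t.1.2.2.2.2)
      (fun a b t ζ x' => F β (α + a) (β' + b) α' t.1.2.1 ζ x' t.1.2.2.2.2 -
        F β (α + a) (β' + b) α' t.1.2.2.1 ζ x' t.1.2.2.2.2) := by
    have g1 := fun x ξ => hF.ampFam (β' := β') hβ hα hα'
      (T := {t : Theta × E n × E n × E n × E n // t.2.1 ≠ t.2.2.1}) x ξ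
    refine ⟨fun a b ha t => ((g1 (fun t => t.1.2.1) (fun t => t.1.2.2.2.2)).cont a b ha t).sub
        ((g1 (fun t => t.1.2.2.1) (fun t => t.1.2.2.2.2)).cont a b ha t),
      fun a b ha j t ζ x' => HasDerivAt.sub
        ((g1 (fun t => t.1.2.1) (fun t => t.1.2.2.2.2)).deriv_fst a b ha j t ζ x')
        ((g1 (fun t => t.1.2.2.1) (fun t => t.1.2.2.2.2)).deriv_fst a b ha j t ζ x'),
      fun a b ha j t ζ x' => HasDerivAt.sub
        ((g1 (fun t => t.1.2.1) (fun t => t.1.2.2.2.2)).deriv_snd a b ha j t ζ x')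
        ((g1 (fun t => t.1.2.2.1) (fun t => t.1.2.2.2.2)).deriv_snd a b ha j t ζ x'),
      fun a b ha => ?_⟩
    obtain ⟨C, hC0, h⟩ := hF.holder β (α + a) (β' + b) α' hβ (order_le hα ha) hα'
    refine ⟨fun _ => C, ⟨C, fun _ => (abs_of_nonneg hC0).le⟩, fun _ => hC0,
      fun t ζ x' => (h _ _ _ _ _).trans (le_of_eq ?_)⟩
    rw [len_add, len_add]
    have e1 : m₁ - ρ * ((len α + len a : ℕ) : ℝ) + δ * (k + τ) =
        m₁ - ρ * len α + δ * (k + τ) - ρ * len a := by push_cast; ring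
    rw [e1]
    push_cast
    ring
  obtain ⟨D, ⟨C, hC⟩, -, h⟩ := hA.exists_norm_oscInt_le weightClass_isBdd hδ₀
    hδ₁ hδρ (Nat.cast_nonneg _) (fun t => mul_pos (Real.rpow_pos_of_pos (norm_pos_iff.2
      (sub_ne_zero.2 t.2)) _) (jb_rpow_pos _ _)) (θ := fun t => t.1.1) (fun t => t.1.1.abs_le)
    (fun t => t.1.2.2.2.1)
  refine ⟨C, (abs_nonneg _).trans (hC 0), fun θ x₁ x₂ z ξ => ?_⟩
  have hC0 : 0 ≤ C := (abs_nonneg _).trans (hC 0)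
  by_cases hx : x₁ = x₂
  · rw [hx, sub_self, norm_zero]
    have := jb_rpow_pos ξ (m₁ + m₂ - ρ * (len α + len α') + δ * (k + τ + len β'))
    positivity
  have h1 := h ⟨(θ, x₁, x₂, z, ξ), hx⟩
  simp only [add_zero] at h1
  have h2 := ((hF.hasOscInt hW hδ₀ hδ₁ hδρ hβ hα hα' (β' := β') θ.abs_le x₁ z ξ).add
    ((hF.hasOscInt hW hδ₀ hδ₁ hδρ hβ hα hα' (β' := β') θ.abs_le x₂ z ξ).const_mul (-1))).oscInt_eq
  simp only [neg_one_mul, ← sub_eq_add_neg] at h2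
  rw [← h2]
  refine h1.trans ?_
  have h3 := (le_abs_self _).trans (hC z)
  have e2 : jb ξ ^ (m₁ + m₂ - ρ * (len α + len α') + δ * (k + τ + len β')) =
      jb ξ ^ (m₂ - ρ * len α') * jb ξ ^ (m₁ - ρ * len α + δ * (k + τ) + δ * len β') := by
    rw [← jb_rpow_add]; congr 1; ring
  rw [e2]
  have g1 := jb_rpow_pos ξ (m₂ - ρ * len α')
  have g2 := jb_rpow_pos ξ (m₁ - ρ * len α + δ * (k + τ) + δ * len β')
  have g3 : 0 ≤ ‖x₁ - x₂‖ ^ (τ : ℝ) := by positivity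
  calc _ ≤ C * (‖x₁ - x₂‖ ^ (τ : ℝ) * jb ξ ^ (m₂ - ρ * len α') *
        jb ξ ^ (m₁ - ρ * len α + δ * (k + τ) + δ * len β')) :=
        mul_le_mul_of_nonneg_right h3 (by positivity)
    _ = _ := by ring

end SymFam

/-! ### Families of symbols -/

/-- The requirement on the derivatives of a family of symbols of order `m`, uniformly in the
parameter, with weights in `x` from the class `W`. The last estimate is a Hölder estimate, in which
the power of `⟨ξ⟩` does not depend on the number of derivatives in `x`. -/
def SymB [TopologicalSpace T] (W : (E n → ℝ) → Prop) (τ : ℝ≥0) (m ρ δ e : ℝ) (i l : ℕ)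
    (f : Fam n T) : Prop :=
  (Continuous fun p : T × E n × E n => f p.1 p.2.1 p.2.2) ∧
  (∃ C, W C ∧ (∀ x, 0 ≤ C x) ∧ ∀ t x ξ, ‖f t x ξ‖ ≤ C x * jb ξ ^ (m - ρ * l + δ * i)) ∧
  ∃ C : ℝ, 0 ≤ C ∧ ∀ t x₁ x₂ ξ,
    ‖f t x₁ ξ - f t x₂ ξ‖ ≤ C * jb ξ ^ (e - ρ * l) * ‖x₁ - x₂‖ ^ (τ : ℝ)

section SymB

variable [TopologicalSpace T] [TopologicalSpace T'] {W : (E n → ℝ) → Prop} {τ : ℝ≥0}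
  {m ρ δ e : ℝ} {i l : ℕ} {f g : Fam n T}

theorem SymB.zero (hW : WeightClass W) : SymB W τ m ρ δ e i l (0 : Fam n T) :=
  ⟨continuous_const, ⟨0, hW.zero, fun _ => le_rfl, fun t x ξ => by simp⟩,
    0, le_rfl, fun t x₁ x₂ ξ => by simp⟩

theorem SymB.add (hW : WeightClass W) (hf : SymB W τ m ρ δ e i l f) (hg : SymB W τ m ρ δ e i l g) :
    SymB W τ m ρ δ e i l (f + g) := by
  obtain ⟨hf1, ⟨C, hC, hC0, hf2⟩, D, hD, hf3⟩ := hf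
  obtain ⟨hg1, ⟨C', hC', hC0', hg2⟩, D', hD', hg3⟩ := hg
  refine ⟨hf1.add hg1, ⟨C + C', hW.add hC hC', fun x => add_nonneg (hC0 x) (hC0' x),
    fun t x ξ => ?_⟩, D + D', add_nonneg hD hD', fun t x₁ x₂ ξ => ?_⟩
  · refine (norm_add_le _ _).trans ((add_le_add (hf2 t x ξ) (hg2 t x ξ)).trans (le_of_eq ?_))
    rw [Pi.add_apply, add_mul]
  · have e1 : (f + g) t x₁ ξ - (f + g) t x₂ ξ =
        (f t x₁ ξ - f t x₂ ξ) + (g t x₁ ξ - g t x₂ ξ) := by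
      simp only [Pi.add_apply]; ring
    rw [e1]
    refine (norm_add_le _ _).trans ((add_le_add (hf3 t x₁ x₂ ξ) (hg3 t x₁ x₂ ξ)).trans
      (le_of_eq ?_))
    ring

theorem SymB.const_mul (hW : WeightClass W) (c : ℂ) (hf : SymB W τ m ρ δ e i l f) :
    SymB W τ m ρ δ e i l (fun t x ξ => c * f t x ξ) := by
  obtain ⟨hf1, ⟨C, hC, hC0, hf2⟩, D, hD, hf3⟩ := hf
  refine ⟨continuous_const.mul hf1, ⟨fun x => ‖c‖ * C x, hW.dom ‖c‖ hC fun x => ?_,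
    fun x => mul_nonneg (norm_nonneg _) (hC0 x), fun t x ξ => ?_⟩, ‖c‖ * D,
    mul_nonneg (norm_nonneg _) hD, fun t x₁ x₂ ξ => ?_⟩
  · rw [abs_mul, abs_norm]
  · rw [norm_mul, mul_assoc]
    exact mul_le_mul_of_nonneg_left (hf2 t x ξ) (norm_nonneg _)
  · rw [← mul_sub, norm_mul, mul_assoc, mul_assoc, ← mul_assoc D]
    exact mul_le_mul_of_nonneg_left (hf3 t x₁ x₂ ξ) (norm_nonneg _)

theorem SymB.weight_isBdd (hW : WeightClass W) (hf : SymB W τ m ρ δ e i l f) :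
    SymB IsBdd τ m ρ δ e i l f := by
  obtain ⟨hf1, ⟨C, hC, hC0, hf2⟩, hf3⟩ := hf
  exact ⟨hf1, ⟨C, hW.bdd hC, hC0, hf2⟩, hf3⟩

end SymB

/-- A Hölder estimate from bounds for a function and its first derivatives. -/
theorem exists_norm_sub_le {ι : Type*} {f : ι → E n → ℂ} {g : Fin n → ι → E n → ℂ} {ξ : ι → E n}
    {u δ A τ : ℝ} (hA : 0 ≤ A) (hτ₀ : 0 ≤ τ) (hτ₁ : τ ≤ 1)
    (hf : ∀ j i x, HasLineDerivAt ℝ (f i) (g j i x) x (bv j))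
    (hfA : ∀ i x, ‖f i x‖ ≤ A * jb (ξ i) ^ u)
    (hg : ∀ j, ∃ B, 0 ≤ B ∧ ∀ i x, ‖g j i x‖ ≤ B * jb (ξ i) ^ (u + δ)) :
    ∃ C, 0 ≤ C ∧ ∀ i x y, ‖f i x - f i y‖ ≤ C * jb (ξ i) ^ (u + δ * τ) * ‖x - y‖ ^ τ := by
  choose B hB0 hB using hg
  have hS : 0 ≤ ∑ j, B j := Finset.sum_nonneg fun j _ => hB0 j
  refine ⟨2 * A + n * ∑ j, B j, by positivity, fun i x y => ?_⟩
  have hX := jb_rpow_pos (ξ i) δ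
  have hU := jb_rpow_pos (ξ i) u
  have h := norm_sub_le_of_bounds (f := f i) (g := fun j => g j i) (A := A * jb (ξ i) ^ u)
    (B := (∑ j, B j) * jb (ξ i) ^ u) hX (by positivity) hτ₀ hτ₁ (fun j x => hf j i x) (hfA i)
    (fun j x => by
      refine (hB j i x).trans ?_
      rw [jb_rpow_add, ← mul_assoc]
      have := Finset.single_le_sum (f := B) (fun j _ => hB0 j) (Finset.mem_univ j)
      gcongr) x y
  refine h.trans (le_of_eq ?_)
  rw [← Real.rpow_mul (jb_pos _).le, jb_rpow_add]
  ring

namespace SymFam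

variable {k : ℕ} {τ : ℝ≥0} {m₁ m₂ ρ δ : ℝ} {M₁ M₂ : ℕ∞} {W : (E n → ℝ) → Prop}
  {F : MultiIndex n → MultiIndex n → MultiIndex n → MultiIndex n → Fun4 n}

variable (hW : WeightClass W) (hδ₀ : 0 ≤ δ) (hδ₁ : δ < 1) (hδρ : δ ≤ ρ)
  (hF : SymFam k τ m₁ m₂ ρ δ M₁ M₂ W F)

include hW hδ₀ hδ₁ hδρ hF

theorem hasLineDerivAt_oscV_diag {β α β' α' : MultiIndex n} (hβ : len β + 1 ≤ k)
    (hα : ((len α + (n + 1) : ℕ) : ℕ∞) ≤ M₁) (hα' : (len α' : ℕ∞) ≤ M₂) (θ : Theta)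
    (j : Fin n) (x ξ : E n) :
    HasLineDerivAt ℝ (fun x => oscV (F β α β' α') θ x x ξ)
      (oscV (F (β + ej j) α β' α') θ x x ξ + oscV (F β α (β' + ej j) α') θ x x ξ) x (bv j) := by
  have hβ₁ : len (β + ej j) ≤ k := by rw [len_add_ej]; exact hβ
  have hβ₀ : len β ≤ k := by omega
  have h := hasDerivAt_diag
    (U := fun s t => oscV (F β α β' α') θ (x + s • bv j) (x + t • bv j) ξ)
    (U₁ := fun s t => oscV (F (β + ej j) α β' α') θ (x + s • bv j) (x + t • bv j) ξ)
    (U₂ := fun s t => oscV (F β α (β' + ej j) α') θ (x + s • bv j) (x + t • bv j) ξ)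
    (fun s t => hasDerivAt_line (f := fun x' => oscV (F β α β' α') θ x' (x + t • bv j) ξ)
      (f' := fun x' => oscV (F (β + ej j) α β' α') θ x' (x + t • bv j) ξ)
      (fun x' => hF.hasLineDerivAt_oscV_x hW hδ₀ hδ₁ hδρ hβ hα hα' θ.abs_le j x' _ ξ) x s)
    (fun s t => hasDerivAt_line (f := fun z => oscV (F β α β' α') θ (x + s • bv j) z ξ)
      (f' := fun z => oscV (F β α (β' + ej j) α') θ (x + s • bv j) z ξ)
      (fun z => hF.hasLineDerivAt_oscV_z hW hδ₀ hδ₁ hδρ hβ₀ hα hα' θ.abs_le j _ z ξ) x t)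
    ((hF.continuous_oscV hW hδ₀ hδ₁ hδρ hβ₁ hα hα').comp
      (f := fun p : ℝ × ℝ => (θ, x + p.1 • bv j, x + p.2 • bv j, ξ)) (by fun_prop))
    ((hF.continuous_oscV hW hδ₀ hδ₁ hδρ hβ₀ hα hα').comp
      (f := fun p : ℝ × ℝ => (θ, x + p.1 • bv j, x + p.2 • bv j, ξ)) (by fun_prop)) 0
  simp only [zero_smul, add_zero] at h
  exact h

theorem exists_norm_oscV_le_const {β α β' α' : MultiIndex n} (hβ : len β ≤ k)
    (hα : ((len α + (n + 1) : ℕ) : ℕ∞) ≤ M₁) (hα' : (len α' : ℕ∞) ≤ M₂) :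
    ∃ C : ℝ, 0 ≤ C ∧ ∀ (θ : Theta) x z ξ, ‖oscV (F β α β' α') θ x z ξ‖ ≤
      C * jb ξ ^ (m₁ + m₂ - ρ * (len α + len α') + δ * (len β + len β')) := by
  obtain ⟨D, hD, hD0, h⟩ := hF.exists_norm_oscV_le hW hδ₀ hδ₁ hδρ (β' := β') hβ hα hα'
  obtain ⟨C, hC⟩ := hW.bdd hD
  exact ⟨C, (abs_nonneg _).trans (hC 0), fun θ x z ξ => (h θ x z ξ).trans
    (mul_le_mul_of_nonneg_right ((le_abs_self _).trans (hC z)) (jb_rpow_pos _ _).le)⟩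

/-- Hölder continuity on the diagonal, with a power of `⟨ξ⟩` that is independent of the number of
derivatives in `x`. -/
theorem exists_norm_oscV_diag_sub_le (hτ : τ < 1) {β α β' α' : MultiIndex n} (hβ : len β ≤ k)
    (hα : ((len α + (n + 1) : ℕ) : ℕ∞) ≤ M₁) (hα' : (len α' : ℕ∞) ≤ M₂) {N : ℕ}
    (hN : len β + len β' ≤ k + N) :
    ∃ C : ℝ, 0 ≤ C ∧ ∀ (θ : Theta) x₁ x₂ ξ,
      ‖oscV (F β α β' α') θ x₁ x₁ ξ - oscV (F β α β' α') θ x₂ x₂ ξ‖ ≤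
        C * jb ξ ^ (m₁ + m₂ + δ * (k + N + τ) - ρ * ((len α + len α' : ℕ) : ℝ)) *
          ‖x₁ - x₂‖ ^ (τ : ℝ) := by
  have hτ' : (τ : ℝ) ≤ 1 := by exact_mod_cast hτ.le
  obtain ⟨A, hA, hAb⟩ := hF.exists_norm_oscV_le_const hW hδ₀ hδ₁ hδρ (β' := β') hβ hα hα'
  have hN' : (len β : ℝ) + len β' ≤ k + N := by exact_mod_cast hN
  set u := m₁ + m₂ - ρ * (len α + len α') + δ * (len β + len β') with hu
  have hexp : u + δ * τ ≤ m₁ + m₂ + δ * (k + N + τ) - ρ * ((len α + len α' : ℕ) : ℝ) := by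
    rw [hu]; push_cast
    nlinarith [mul_le_mul_of_nonneg_left hN' hδ₀]
  rcases hβ.lt_or_eq with hlt | heq
  -- interpolation with the derivative along the diagonal
  · obtain ⟨C, hC, h⟩ := exists_norm_sub_le (ι := Theta × E n) (δ := δ) (τ := τ)
      (f := fun i x => oscV (F β α β' α') i.1 x x i.2) (ξ := fun i => i.2) hA τ.2 hτ'
      (fun j i x => hF.hasLineDerivAt_oscV_diag hW hδ₀ hδ₁ hδρ hlt hα hα' i.1 j x i.2)
      (fun i x => hAb i.1 x x i.2) (fun j => by
        obtain ⟨B, hB, h1⟩ := hF.exists_norm_oscV_le_const hW hδ₀ hδ₁ hδρ (β' := β')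
          (by rw [len_add_ej]; exact hlt : len (β + ej j) ≤ k) hα hα'
        obtain ⟨B', hB', h2⟩ := hF.exists_norm_oscV_le_const hW hδ₀ hδ₁ hδρ (β' := β' + ej j)
          hβ hα hα'
        refine ⟨B + B', add_nonneg hB hB', fun i x => (norm_add_le _ _).trans
          ((add_le_add (h1 i.1 x x i.2) (h2 i.1 x x i.2)).trans (le_of_eq ?_))⟩
        rw [len_add_ej, len_add_ej, add_mul]
        congr 3 <;> (rw [hu]; push_cast; ring))
    refine ⟨C, hC, fun θ x₁ x₂ ξ => (h (θ, ξ) x₁ x₂).trans ?_⟩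
    have := jb_rpow_le ξ hexp
    simp only
    gcongr
  -- no further derivative in the first variable exists: there the Hölder continuity of the symbol
  -- is used, and interpolation in the second variable only
  · obtain ⟨C, hC, h⟩ := exists_norm_sub_le (ι := Theta × E n × E n) (δ := δ) (τ := τ)
      (f := fun i z => oscV (F β α β' α') i.1 i.2.1 z i.2.2) (ξ := fun i => i.2.2) hA τ.2 hτ'
      (fun j i z => hF.hasLineDerivAt_oscV_z hW hδ₀ hδ₁ hδρ hβ hα hα' i.1.abs_le j i.2.1 z i.2.2)
      (fun i z => hAb i.1 i.2.1 z i.2.2) (fun j => by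
        obtain ⟨B', hB', h2⟩ := hF.exists_norm_oscV_le_const hW hδ₀ hδ₁ hδρ (β' := β' + ej j)
          hβ hα hα'
        refine ⟨B', hB', fun i z => (h2 i.1 i.2.1 z i.2.2).trans (le_of_eq ?_)⟩
        rw [len_add_ej]
        congr 2
        rw [hu]; push_cast; ring)
    obtain ⟨C', hC', h'⟩ := hF.exists_norm_oscV_sub_le hW hδ₀ hδ₁ hδρ (β' := β') hβ hα hα'
    have hexp' : m₁ + m₂ - ρ * (len α + len α') + δ * (k + τ + len β') ≤
        m₁ + m₂ + δ * (k + N + τ) - ρ * ((len α + len α' : ℕ) : ℝ) := by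
      have : (len β' : ℝ) ≤ N := by rw [heq] at hN'; linarith
      push_cast
      nlinarith [mul_le_mul_of_nonneg_left this hδ₀]
    refine ⟨C' + C, add_nonneg hC' hC, fun θ x₁ x₂ ξ => ?_⟩
    have e1 : oscV (F β α β' α') θ x₁ x₁ ξ - oscV (F β α β' α') θ x₂ x₂ ξ =
        (oscV (F β α β' α') θ x₁ x₁ ξ - oscV (F β α β' α') θ x₂ x₁ ξ) +
        (oscV (F β α β' α') θ x₂ x₁ ξ - oscV (F β α β' α') θ x₂ x₂ ξ) := by ring
    rw [e1]
    refine (norm_add_le _ _).trans ?_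
    rw [add_mul, add_mul]
    refine add_le_add ((h' θ x₁ x₂ x₁ ξ).trans ?_) ((h (θ, x₂, ξ) x₁ x₂).trans ?_)
    · have := jb_rpow_le ξ hexp'
      gcongr
    · have := jb_rpow_le ξ hexp
      simp only
      gcongr

/-- The number `N` accounts for the derivatives in `x'` in addition to the `k` derivatives that are
distributed to both variables. -/
theorem symB_oscV (hτ : τ < 1) {β α β' α' : MultiIndex n} (hβ : len β ≤ k)
    (hα : ((len α + (n + 1) : ℕ) : ℕ∞) ≤ M₁) (hα' : (len α' : ℕ∞) ≤ M₂) {N : ℕ}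
    (hN : len β + len β' ≤ k + N) :
    SymB W τ (m₁ + m₂) ρ δ (m₁ + m₂ + δ * (k + N + τ)) (len β + len β') (len α + len α')
      (fun (θ : Theta) x ξ => oscV (F β α β' α') θ x x ξ) := by
  refine ⟨(hF.continuous_oscV hW hδ₀ hδ₁ hδρ hβ hα hα').comp
    (f := fun p : Theta × E n × E n => (p.1, p.2.1, p.2.1, p.2.2)) (by fun_prop), ?_,
    hF.exists_norm_oscV_diag_sub_le hW hδ₀ hδ₁ hδρ hτ hβ hα hα' hN⟩
  obtain ⟨D, hD, hD0, h⟩ := hF.exists_norm_oscV_le hW hδ₀ hδ₁ hδρ (β' := β') hβ hα hα'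
  refine ⟨D, hD, hD0, fun t x ξ => (h t x x ξ).trans (le_of_eq ?_)⟩
  push_cast
  rfl

/-- The oscillatory integrals form a family of symbols: a derivative in `x` or `ξ` of the restriction
to the diagonal is a sum of two oscillatory integrals of the same kind. -/
theorem reg_oscV (hτ : τ < 1) {N : ℕ} (Q : ℕ) : ∀ (K J : ℕ) (β α β' α' : MultiIndex n), K + J = Q →
    len β + K ≤ k → ((len α + J + (n + 1) : ℕ) : ℕ∞) ≤ M₁ → ((len α' + J : ℕ) : ℕ∞) ≤ M₂ →
    len β + len β' + K ≤ k + N →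
    Reg K J (fun i l => SymB W τ (m₁ + m₂) ρ δ (m₁ + m₂ + δ * (k + N + τ))
      (i + (len β + len β')) (l + (len α + len α')))
      (fun (θ : Theta) x ξ => oscV (F β α β' α') θ x x ξ) := by
  have hbase : ∀ (K J : ℕ) (β α β' α' : MultiIndex n),
      len β + K ≤ k → ((len α + J + (n + 1) : ℕ) : ℕ∞) ≤ M₁ → ((len α' + J : ℕ) : ℕ∞) ≤ M₂ →
      len β + len β' + K ≤ k + N →
      SymB W τ (m₁ + m₂) ρ δ (m₁ + m₂ + δ * (k + N + τ))
        (0 + (len β + len β')) (0 + (len α + len α'))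
        (fun (θ : Theta) x ξ => oscV (F β α β' α') θ x x ξ) := by
    intro K J β α β' α' hβ hα hα' hN
    rw [zero_add, zero_add]
    exact hF.symB_oscV hW hδ₀ hδ₁ hδρ hτ (by omega)
      (le_trans (by exact_mod_cast (by omega)) hα) (natCast_le_of_add_le hα') (by omega)
  induction Q with
  | zero =>
    intro K J β α β' α' hQ hβ hα hα' hN
    exact Reg.intro (hbase K J β α β' α' hβ hα hα' hN) (by omega) (by omega)
  | succ Q ih =>
    intro K J β α β' α' hQ hβ hα hα' hN
    refine Reg.intro (hbase K J β α β' α' hβ hα hα' hN) ?_ ?_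
    · rintro K rfl j
      refine ⟨(fun (θ : Theta) x ξ => oscV (F (β + ej j) α β' α') θ x x ξ) +
        (fun (θ : Theta) x ξ => oscV (F β α (β' + ej j) α') θ x x ξ), fun θ x ξ =>
        hF.hasLineDerivAt_oscV_diag hW hδ₀ hδ₁ hδρ (by omega)
          (le_trans (by exact_mod_cast (by omega)) hα) (natCast_le_of_add_le hα') θ j x ξ,
        Reg.add (fun _ _ _ _ => SymB.add hW)
          ((ih K J (β + ej j) α β' α' (by omega) (by rw [len_add_ej]; omega) hα hα'
            (by rw [len_add_ej]; omega)).mono fun i l f h => ?_)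
          ((ih K J β α (β' + ej j) α' (by omega) (by omega) hα hα'
            (by rw [len_add_ej]; omega)).mono fun i l f h => ?_)⟩
      · rwa [len_add_ej, show i + (len β + 1 + len β') = i + 1 + (len β + len β') by ring] at h
      · rwa [len_add_ej, show i + (len β + (len β' + 1)) = i + 1 + (len β + len β') by ring] at h
    · rintro J rfl j
      have hα₁ : ((len α + 1 + J + (n + 1) : ℕ) : ℕ∞) ≤ M₁ :=
        le_trans (by exact_mod_cast (by omega)) hα
      have hα₂ : ((len α' + 1 + J : ℕ) : ℕ∞) ≤ M₂ := le_trans (by exact_mod_cast (by omega)) hα'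
      refine ⟨(fun (θ : Theta) x ξ => oscV (F β (α + ej j) β' α') θ x x ξ) +
        (fun (θ : Theta) x ξ => oscV (F β α β' (α' + ej j)) θ x x ξ), fun θ x ξ =>
        hF.hasLineDerivAt_oscV_ξ hW hδ₀ hδ₁ hδρ (by omega)
          (le_trans (by exact_mod_cast (by omega)) hα) (natCast_le_of_add_le hα₂) θ.abs_le j x x ξ,
        Reg.add (fun _ _ _ _ => SymB.add hW)
          ((ih K J β (α + ej j) β' α' (by omega) hβ (by rwa [len_add_ej])
            (le_trans (by exact_mod_cast (by omega)) hα') hN).mono fun i l f h => ?_)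
          ((ih K J β α β' (α' + ej j) (by omega) hβ (le_trans (by exact_mod_cast (by omega)) hα)
            (by rwa [len_add_ej]) hN).mono fun i l f h => ?_)⟩
      · rwa [len_add_ej, show l + (len α + 1 + len α') = l + 1 + (len α + len α') by ring] at h
      · rwa [len_add_ej, show l + (len α + (len α' + 1)) = l + 1 + (len α + len α') by ring] at h

end SymFam

/-! ### From regular families to symbol classes -/

theorem sx_zero (a : E n → E n → ℂ) : sx 0 a = a := by
  funext x ξ; simp only [sx, mpd_zero]

theorem sξ_zero (a : E n → E n → ℂ) : sξ 0 a = a := by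
  funext x ξ; simp only [sξ, mpd_zero]

namespace Reg

variable {L J : ℕ} {B : ℕ → ℕ → Fam n T → Prop} {f : Fam n T}

theorem contDiff_fst (h : Reg L J B f)
    (hB : ∀ i l f, B i l f → ∀ t η, Continuous fun y => f t y η) (t : T) (η : E n) :
    ContDiff ℝ L fun y => f t y η := by
  induction L generalizing B f with
  | zero => exact contDiff_zero.2 (hB 0 0 f h.base t η)
  | succ L ih =>
    choose g hg hR using h.fst
    exact contDiff_succ_of_partials (fun j y => hg j t y η)
      fun j => ih (hR j) fun i l f hf => hB _ _ f hf

theorem contDiff_snd (h : Reg L J B f)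
    (hB : ∀ i l f, B i l f → ∀ t y, Continuous fun η => f t y η) (t : T) (y : E n) :
    ContDiff ℝ J fun η => f t y η := by
  induction J generalizing B f with
  | zero => exact contDiff_zero.2 (hB 0 0 f h.base t y)
  | succ J ih =>
    choose g hg hR using h.snd
    exact contDiff_succ_of_partials (fun j η => hg j t y η)
      fun j => ih (hR j) fun i l f hf => hB _ _ f hf

theorem sx (h : Reg L J B f) (hB : ∀ i l f, B i l f → ∀ t η, Continuous fun y => f t y η)
    {β : MultiIndex n} (hβ : len β ≤ L) :
    Reg (L - len β) J (fun i l => B (i + len β) l) (fun t => NonSmoothSymbol.sx β (f t)) := by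
  induction hN : len β generalizing β with
  | zero =>
    rw [eq_zero_of_len_eq_zero hN]
    simpa only [sx_zero, add_zero, Nat.sub_zero] using h
  | succ N ih =>
    obtain ⟨γ, j, rfl, hγ⟩ := exists_eq_add_ej hN
    have h1 := ih (β := γ) (by omega) hγ
    rw [show L - N = (L - (N + 1)) + 1 by omega] at h1
    obtain ⟨g, hg, hR⟩ := h1.fst j
    have h2 : DerivFst j (fun t => NonSmoothSymbol.sx γ (f t))
        (fun t => NonSmoothSymbol.sx (γ + ej j) (f t)) := fun t y η =>
      hasLineDerivAt_mpd ((h.contDiff_fst hB t η).of_le (by exact_mod_cast (by omega))) j y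
    rw [hg.unique h2] at hR
    refine hR.mono fun i l f hf => ?_
    rwa [show i + 1 + N = i + (N + 1) by ring] at hf

theorem sξ (h : Reg L J B f) (hB : ∀ i l f, B i l f → ∀ t y, Continuous fun η => f t y η)
    {α : MultiIndex n} (hα : len α ≤ J) :
    Reg L (J - len α) (fun i l => B i (l + len α)) (fun t => NonSmoothSymbol.sξ α (f t)) := by
  induction hN : len α generalizing α with
  | zero =>
    rw [eq_zero_of_len_eq_zero hN]
    simpa only [sξ_zero, add_zero, Nat.sub_zero] using h
  | succ N ih =>
    obtain ⟨γ, j, rfl, hγ⟩ := exists_eq_add_ej hN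
    have h1 := ih (α := γ) (by omega) hγ
    rw [show J - N = (J - (N + 1)) + 1 by omega] at h1
    obtain ⟨g, hg, hR⟩ := h1.snd j
    have h2 : DerivSnd j (fun t => NonSmoothSymbol.sξ γ (f t))
        (fun t => NonSmoothSymbol.sξ (γ + ej j) (f t)) := fun t y η =>
      hasLineDerivAt_mpd ((h.contDiff_snd hB t y).of_le (by exact_mod_cast (by omega))) j η
    rw [hg.unique h2] at hR
    refine hR.mono fun i l f hf => ?_
    rwa [show l + 1 + N = l + (N + 1) by ring] at hf

end Reg

theorem holderWith_of_norm_sub_le {τ : ℝ≥0} {f : E n → ℂ} {R : ℝ} (hR : 0 ≤ R)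
    (h : ∀ x y, ‖f x - f y‖ ≤ R * ‖x - y‖ ^ (τ : ℝ)) : HolderWith R.toNNReal τ f := by
  intro x y
  rw [edist_dist, edist_dist, dist_eq_norm, dist_eq_norm,
    ENNReal.ofReal_rpow_of_nonneg (norm_nonneg _) τ.coe_nonneg]
  change _ ≤ ENNReal.ofReal R * _
  rw [← ENNReal.ofReal_mul hR]
  exact ENNReal.ofReal_le_ofReal (h x y)

theorem holderNorm₀_le {τ : ℝ≥0} {f : E n → ℂ} {A R : ℝ} (hR : 0 ≤ R) (hA : ∀ x, ‖f x‖ ≤ A)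
    (h : ∀ x y, ‖f x - f y‖ ≤ R * ‖x - y‖ ^ (τ : ℝ)) :
    holderNorm₀ τ f ≤ ENNReal.ofReal (A + R) := by
  rw [ENNReal.ofReal_add ((norm_nonneg _).trans (hA 0)) hR]
  refine add_le_add (iSup_le fun x => ?_) ((holderWith_of_norm_sub_le hR h).eHolderNorm_le.trans
    le_rfl)
  rw [← ofReal_norm]
  exact ENNReal.ofReal_le_ofReal (hA x)

section Symbols

variable [TopologicalSpace T] {W : (E n → ℝ) → Prop} {k : ℕ} {τ : ℝ≥0} {m ρ δ : ℝ} {f : Fam n T}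

theorem SymB.continuous_fst {e : ℝ} {i l : ℕ} (hf : SymB W τ m ρ δ e i l f) (t : T) (ξ : E n) :
    Continuous fun x => f t x ξ :=
  hf.1.comp (f := fun x : E n => (t, x, ξ)) (by fun_prop)

theorem SymB.continuous_snd {e : ℝ} {i l : ℕ} (hf : SymB W τ m ρ δ e i l f) (t : T) (x : E n) :
    Continuous fun ξ => f t x ξ :=
  hf.1.comp (f := fun ξ : E n => (t, x, ξ)) (by fun_prop)

theorem Reg.symB_sx_sξ {e : ℝ} {J : ℕ} (h : Reg k J (SymB W τ m ρ δ e) f) {α β : MultiIndex n}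
    (hα : len α ≤ J) (hβ : len β ≤ k) :
    SymB W τ m ρ δ e (len β) (len α) (fun t => NonSmoothSymbol.sx β (NonSmoothSymbol.sξ α (f t))) := by
  simpa using ((h.sξ (fun i l f hf t y => hf.continuous_snd t y) hα).sx
    (fun i l f hf t η => hf.continuous_fst t η) hβ).base

theorem Reg.symB_sξ_sx {e : ℝ} {J : ℕ} (h : Reg k J (SymB W τ m ρ δ e) f) {α β : MultiIndex n}
    (hα : len α ≤ J) (hβ : len β ≤ k) :
    SymB W τ m ρ δ e (len β) (len α) (fun t => NonSmoothSymbol.sξ α (NonSmoothSymbol.sx β (f t))) := by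
  simpa using ((h.sx (fun i l f hf t y => hf.continuous_fst t y) hβ).sξ
    (fun i l f hf t η => hf.continuous_snd t η) hα).base

/-- The estimates of a symbol, with a constant that is uniform in the parameter. -/
theorem Reg.exists_symbolBound (hW : WeightClass W) (hδ₀ : 0 ≤ δ) {J : ℕ}
    (h : Reg k J (SymB W τ m ρ δ (m + δ * (k + τ))) f) {α : MultiIndex n} (hα : len α ≤ J) :
    ∃ C, ∀ t, SymbolBound k τ m ρ δ α C (f t) := by
  have h1 : ∀ β : MultiIndex n, len β ≤ k → ∃ A : ℝ, 0 ≤ A ∧ ∀ t ξ,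
      (∀ x, ‖NonSmoothSymbol.sx β (NonSmoothSymbol.sξ α (f t)) x ξ‖ ≤
        A * jb ξ ^ (m - ρ * len α + δ * len β)) ∧
      holderNorm₀ τ (fun x => NonSmoothSymbol.sx β (NonSmoothSymbol.sξ α (f t)) x ξ) ≤
        ENNReal.ofReal (A * jb ξ ^ (m - ρ * len α + δ * (k + τ))) := by
    intro β hβ
    obtain ⟨-, ⟨C, hC, hC0, hCb⟩, D, hD, hDb⟩ := (h.symB_sx_sξ hα hβ).weight_isBdd hW
    obtain ⟨K, hK⟩ := hC
    have hK0 : 0 ≤ K := (abs_nonneg _).trans (hK 0)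
    refine ⟨K + D, add_nonneg hK0 hD, fun t ξ => ⟨fun x => (hCb t x ξ).trans ?_, ?_⟩⟩
    · have := jb_rpow_pos ξ (m - ρ * len α + δ * len β)
      have := (le_abs_self _).trans (hK x)
      gcongr
      linarith
    · have hle : m - ρ * len α + δ * len β ≤ m - ρ * len α + δ * (k + τ) := by
        have h1 : (len β : ℝ) ≤ k := by exact_mod_cast hβ
        have h2 : (0 : ℝ) ≤ τ := τ.2
        have := mul_le_mul_of_nonneg_left (by linarith : (len β : ℝ) ≤ k + τ) hδ₀
        linarith
      have hp := jb_rpow_pos ξ (m - ρ * len α + δ * (k + τ))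
      rw [add_mul]
      refine holderNorm₀_le (by positivity) (fun x => (hCb t x ξ).trans ?_) fun x y => ?_
      · exact mul_le_mul ((le_abs_self _).trans (hK x)) (jb_rpow_le ξ hle) (jb_rpow_pos _ _).le hK0
      · have := hDb t x y ξ
        rwa [show m + δ * (k + τ) - ρ * (len α : ℝ) = m - ρ * len α + δ * (k + τ) by ring] at this
  choose! A hA0 hA using h1
  have hle : ∀ β : MultiIndex n, len β ≤ k → A β ≤ ∑ γ ∈ lenLE n k, A γ := fun β hβ =>
    Finset.single_le_sum (f := A) (fun γ hγ => hA0 γ (mem_lenLE.1 hγ)) (mem_lenLE.2 hβ)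
  refine ⟨∑ γ ∈ lenLE n k, A γ, fun t => ⟨fun x ξ => ?_, fun ξ => iSup₂_le fun β hβ => ?_⟩⟩
  · have h0 : len (0 : MultiIndex n) ≤ k := by rw [len_zero]; omega
    have := (hA 0 h0 t ξ).1 x
    simp only [sx_zero, len_zero, Nat.cast_zero, mul_zero, add_zero] at this
    exact this.trans (mul_le_mul_of_nonneg_right (hle 0 h0) (jb_rpow_pos _ _).le)
  · exact (hA β hβ t ξ).2.trans (ENNReal.ofReal_le_ofReal
      (mul_le_mul_of_nonneg_right (hle β hβ) (jb_rpow_pos _ _).le))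

/-- The members of a regular family of symbols of all admissible finite orders in `ξ` belong to the
symbol class. -/
theorem isSymbol_of_reg (hW : WeightClass W) (hδ₀ : 0 ≤ δ) {M : ℕ∞}
    (h : ∀ J : ℕ, (J : ℕ∞) ≤ M → Reg k J (SymB W τ m ρ δ (m + δ * (k + τ))) f) (t : T) :
    IsSymbol k τ m ρ δ M (f t) where
  contDiff_x α hα ξ := ((h _ hα).sξ (fun i l f hf t y => hf.continuous_snd t y) le_rfl).contDiff_fst
    (fun i l f hf t η => hf.continuous_fst t η) t ξ
  contDiff_ξ β hβ x := contDiff_iff_forall_nat_le.2 fun J hJ =>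
    ((h J hJ).sx (fun i l f hf t y => hf.continuous_fst t y) hβ).contDiff_snd
      (fun i l f hf t η => hf.continuous_snd t η) t x
  continuous α β hα hβ := ((h _ hα).symB_sx_sξ le_rfl hβ).1.comp
    (f := fun p : E n × E n => (t, p)) (by fun_prop)
  bound α hα := by
    obtain ⟨C, hC⟩ := (h _ hα).exists_symbolBound hW hδ₀ le_rfl
    exact ⟨C, hC t⟩

theorem isDotSymbol_of_reg (hδ₀ : 0 ≤ δ) {M : ℕ∞}
    (h : ∀ J : ℕ, (J : ℕ∞) ≤ M → Reg k J (SymB IsDecaying τ m ρ δ (m + δ * (k + τ))) f) (t : T) :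
    IsDotSymbol k τ m ρ δ M (f t) where
  toIsSymbol := isSymbol_of_reg weightClass_isDecaying hδ₀ h t
  decay α β hα hβ := by
    obtain ⟨-, ⟨C, hC, -, hCb⟩, -⟩ := (h _ hα).symB_sξ_sx le_rfl hβ
    exact ⟨C, hC, fun x ξ => hCb t x ξ⟩

/-! ### Integration with respect to the parameter -/

/-- Differentiation under the integral sign over a compact interval. -/
theorem hasDerivAt_integral_param {u w : ℝ → ℝ → ℂ} (hu : ∀ r, Continuous fun θ => u θ r)
    (h : ∀ θ r, HasDerivAt (fun r => u θ r) (w θ r) r)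
    (hw : Continuous fun p : ℝ × ℝ => w p.1 p.2) (t : ℝ) :
    HasDerivAt (fun r => ∫ θ in (0 : ℝ)..1, u θ r) (∫ θ in (0 : ℝ)..1, w θ t) t := by
  obtain ⟨C, hC⟩ := (isCompact_uIcc (a := (0 : ℝ)) (b := 1)).prod (isCompact_closedBall t 1)
    |>.exists_bound_of_continuousOn (f := fun z : ℝ × ℝ => w z.1 z.2) hw.continuousOn
  exact (intervalIntegral.hasDerivAt_integral_of_dominated_loc_of_deriv_le (𝕜 := ℝ)
    (μ := volume) (a := 0) (b := 1) (F := fun r θ => u θ r)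
    (F' := fun r θ => w θ r) (x₀ := t) (bound := fun _ => C)
    (Metric.closedBall_mem_nhds t one_pos)
    (Eventually.of_forall fun r => (hu r).aestronglyMeasurable)
    ((hu t).intervalIntegrable _ _)
    (hw.comp (by fun_prop : Continuous fun θ : ℝ => (θ, t))).aestronglyMeasurable
    (Eventually.of_forall fun θ hθ r hr => hC (θ, r) ⟨Set.uIoc_subset_uIcc hθ, hr⟩)
    intervalIntegrable_const (Eventually.of_forall fun θ _ r _ => h θ r)).2

/-- The point of `[-1, 1]` closest to `θ`. It serves to extend families over `[-1, 1]` to all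
`θ : ℝ`. -/
noncomputable def toTheta (θ : ℝ) : Theta := Set.projIcc (-1) 1 (by norm_num) θ

theorem continuous_toTheta : Continuous toTheta := continuous_projIcc (h := by norm_num)

theorem toTheta_of_mem {θ : ℝ} (h : |θ| ≤ 1) : (toTheta θ : ℝ) = θ := by
  rw [toTheta, Set.projIcc_of_mem (by norm_num) (abs_le.1 h)]

/-- The weighted mean of a family of functions over `[0, 1]`. -/
noncomputable def meanFam (w : ℝ → ℂ) (f : Fam n Theta) : Fam n Unit :=
  fun _ x ξ => ∫ θ in (0 : ℝ)..1, w θ * f (toTheta θ) x ξ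

theorem SymB.meanFam (hW : WeightClass W) {e : ℝ} {i l : ℕ} {f : Fam n Theta} {w : ℝ → ℂ}
    (hw : Continuous w) (hf : SymB W τ m ρ δ e i l f) :
    SymB W τ m ρ δ e i l (NonSmoothSymbol.meanFam w f) := by
  obtain ⟨hf1, ⟨C, hC, hC0, hf2⟩, D, hD, hf3⟩ := hf
  obtain ⟨K, hK⟩ := (isCompact_uIcc (a := (0 : ℝ)) (b := 1)).exists_bound_of_continuousOn
    hw.continuousOn
  have hK0 : 0 ≤ K := (norm_nonneg _).trans (hK 0 Set.left_mem_uIcc)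
  have hc : ∀ x ξ, Continuous fun θ => w θ * f (toTheta θ) x ξ := fun x ξ =>
    hw.mul (hf1.comp (f := fun θ : ℝ => (toTheta θ, x, ξ))
      (continuous_toTheta.prodMk continuous_const))
  have hint : ∀ {u : ℝ → ℂ} {A : ℝ}, (∀ θ, ‖u θ‖ ≤ A) →
      ‖∫ θ in (0 : ℝ)..1, w θ * u θ‖ ≤ K * A := fun {u A} hu => by
    have := intervalIntegral.norm_integral_le_of_norm_le_const (a := (0 : ℝ)) (b := 1)
      (f := fun θ => w θ * u θ) (C := K * A) fun θ hθ => by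
        rw [norm_mul]
        exact mul_le_mul (hK θ (Set.uIoc_subset_uIcc hθ)) (hu θ) (norm_nonneg _) hK0
    simpa using this
  refine ⟨?_, ⟨fun x => K * C x, hW.dom K hC fun x => ?_, fun x => mul_nonneg hK0 (hC0 x),
    fun t x ξ => ?_⟩, K * D, mul_nonneg hK0 hD, fun t x₁ x₂ ξ => ?_⟩
  · refine intervalIntegral.continuous_parametric_intervalIntegral_of_continuous'
      (f := fun (p : Unit × E n × E n) θ => w θ * f (toTheta θ) p.2.1 p.2.2) ?_ 0 1
    refine (hw.comp _root_.continuous_snd).mul (hf1.comp (f := fun q : (Unit × E n × E n) × ℝ =>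
      (toTheta q.2, q.1.2.1, q.1.2.2)) ?_)
    exact (continuous_toTheta.comp _root_.continuous_snd).prodMk (by fun_prop)
  · rw [abs_mul, abs_of_nonneg hK0]
  · rw [mul_assoc]
    exact hint fun θ => hf2 _ x ξ
  · have e1 : NonSmoothSymbol.meanFam w f t x₁ ξ - NonSmoothSymbol.meanFam w f t x₂ ξ =
        ∫ θ in (0 : ℝ)..1, w θ * (f (toTheta θ) x₁ ξ - f (toTheta θ) x₂ ξ) := by
      rw [NonSmoothSymbol.meanFam, NonSmoothSymbol.meanFam, ← intervalIntegral.integral_sub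
        ((hc x₁ ξ).intervalIntegrable _ _) ((hc x₂ ξ).intervalIntegrable _ _)]
      simp only [mul_sub]
    rw [e1, mul_assoc, mul_assoc, ← mul_assoc D]
    exact hint fun θ => hf3 _ x₁ x₂ ξ

theorem Reg.meanFam (hW : WeightClass W) {e : ℝ} {L J : ℕ} {f : Fam n Theta} {w : ℝ → ℂ}
    (hw : Continuous w) (hf : Reg L J (SymB W τ m ρ δ e) f) :
    Reg L J (SymB W τ m ρ δ e) (NonSmoothSymbol.meanFam w f) := by
  refine hf.map (Φ := NonSmoothSymbol.meanFam w) (fun i l f h => h.meanFam hW hw) ?_ ?_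
  · intro i l j f g hf hg h t x ξ
    have h1 := hasDerivAt_integral_param (u := fun θ r => w θ * f (toTheta θ) (x + r • bv j) ξ)
      (w := fun θ r => w θ * g (toTheta θ) (x + r • bv j) ξ)
      (fun r => hw.mul (hf.1.comp (f := fun θ : ℝ => (toTheta θ, x + r • bv j, ξ))
        (continuous_toTheta.prodMk continuous_const)))
      (fun θ r => (hasDerivAt_line (fun x => h (toTheta θ) x ξ) x r).const_mul _)
      ((hw.comp continuous_fst).mul (hg.1.comp (f := fun p : ℝ × ℝ =>
        (toTheta p.1, x + p.2 • bv j, ξ)) ((continuous_toTheta.comp continuous_fst).prodMk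
          (by fun_prop)))) 0
    simp only [zero_smul, add_zero] at h1
    exact h1
  · intro i l j f g hf hg h t x ξ
    have h1 := hasDerivAt_integral_param (u := fun θ r => w θ * f (toTheta θ) x (ξ + r • bv j))
      (w := fun θ r => w θ * g (toTheta θ) x (ξ + r • bv j))
      (fun r => hw.mul (hf.1.comp (f := fun θ : ℝ => (toTheta θ, x, ξ + r • bv j))
        (continuous_toTheta.prodMk continuous_const)))
      (fun θ r => (hasDerivAt_line (fun ξ => h (toTheta θ) x ξ) ξ r).const_mul _)
      ((hw.comp continuous_fst).mul (hg.1.comp (f := fun p : ℝ × ℝ =>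
        (toTheta p.1, x, ξ + p.2 • bv j)) ((continuous_toTheta.comp continuous_fst).prodMk
          (by fun_prop)))) 0
    simp only [zero_smul, add_zero] at h1
    exact h1

end Symbols

/-! ### Taylor's formula -/

/-- Taylor's formula with integral remainder for a sequence of functions with
`s_l' = (l + 1) s_{l+1}`. -/
theorem taylor_integral {s : ℕ → ℝ → ℂ} {N : ℕ} (hN : 1 ≤ N)
    (hc : ∀ l ≤ N, ContinuousOn (s l) (Set.Icc 0 1))
    (hd : ∀ l < N, ∀ θ ∈ Set.Ioo (0 : ℝ) 1, HasDerivAt (s l) ((l + 1 : ℂ) * s (l + 1) θ) θ) :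
    s 0 1 = ∑ l ∈ Finset.range N, s l 0 +
      N * ∫ θ in (0 : ℝ)..1, (((1 - θ) ^ (N - 1) : ℝ) : ℂ) * s N θ := by
  have hint : ∀ l ≤ N, ∀ p : ℕ, IntervalIntegrable
      (fun θ : ℝ => (((1 - θ) ^ p : ℝ) : ℂ) * s l θ) volume 0 1 := fun l hl p => by
    refine ContinuousOn.intervalIntegrable ?_
    rw [Set.uIcc_of_le zero_le_one]
    exact ContinuousOn.mul (Continuous.continuousOn (by fun_prop)) (hc l hl)
  induction N, hN using Nat.le_induction with
  | base =>
    have h := intervalIntegral.integral_eq_sub_of_hasDerivAt_of_le zero_le_one (hc 0 (by omega))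
      (fun θ hθ => hd 0 (by omega) θ hθ)
      (by simpa using hint 1 le_rfl 0)
    simp only [Finset.range_one, Finset.sum_singleton, Nat.cast_one, one_mul,
      Nat.sub_self, pow_zero, Complex.ofReal_one]
    simp only [Nat.cast_zero, zero_add, one_mul] at h
    rw [h]; ring
  | succ N hN ih =>
    rw [ih (fun l hl => hc l (by omega)) (fun l hl => hd l (by omega))
      (fun l hl => hint l (by omega)), Finset.sum_range_succ, add_assoc]
    congr 1
    -- integration by parts
    have i₁ : IntervalIntegrable (fun θ : ℝ =>
        -((N : ℂ) * ((((1 - θ) ^ (N - 1) : ℝ) : ℂ) * s N θ))) volume 0 1 :=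
      ((hint N (by omega) (N - 1)).const_mul _).neg
    have i₂ : IntervalIntegrable (fun θ : ℝ =>
        ((N + 1 : ℕ) : ℂ) * ((((1 - θ) ^ N : ℝ) : ℂ) * s (N + 1) θ)) volume 0 1 :=
      (hint (N + 1) le_rfl N).const_mul _
    have h := intervalIntegral.integral_eq_sub_of_hasDerivAt_of_le zero_le_one
      (f := fun θ : ℝ => (((1 - θ) ^ N : ℝ) : ℂ) * s N θ)
      (f' := fun θ : ℝ => -((N : ℂ) * ((((1 - θ) ^ (N - 1) : ℝ) : ℂ) * s N θ)) +
        ((N + 1 : ℕ) : ℂ) * ((((1 - θ) ^ N : ℝ) : ℂ) * s (N + 1) θ))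
      (ContinuousOn.mul (Continuous.continuousOn (by fun_prop)) (hc N (by omega)))
      (fun θ hθ => by
        have h1 : HasDerivAt (fun θ : ℝ => (1 - θ) ^ N) (N * (1 - θ) ^ (N - 1) * (-1)) θ := by
          simpa using! ((hasDerivAt_id θ).const_sub 1).pow N
        refine (h1.ofReal_comp.mul (hd N (by omega) θ hθ)).congr_deriv ?_
        push_cast
        ring)
      (i₁.add i₂)
    rw [intervalIntegral.integral_add i₁ i₂, intervalIntegral.integral_neg,
      intervalIntegral.integral_const_mul, intervalIntegral.integral_const_mul] at h
    have hN0 : N ≠ 0 := by omega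
    simp only [sub_self, zero_pow hN0, sub_zero, one_pow, Complex.ofReal_zero, Complex.ofReal_one,
      zero_mul, one_mul, zero_sub] at h
    rw [Nat.add_sub_cancel]
    linear_combination -h

theorem mfact_add_ej (γ : MultiIndex n) (j : Fin n) :
    mfact (γ + ej j) = (γ j + 1) * mfact γ := by
  have h : ∀ i, ((γ + ej j) i)! = (if i = j then γ j + 1 else 1) * (γ i)! := by
    intro i
    by_cases hi : i = j
    · subst hi
      rw [if_pos rfl, Pi.add_apply, show ej i i = 1 from Pi.single_eq_same i 1, Nat.factorial_succ]
    · rw [if_neg hi, one_mul, Pi.add_apply, show ej j i = 0 from Pi.single_eq_of_ne hi 1, add_zero]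
  simp only [mfact, h, Finset.prod_mul_distrib, Finset.prod_ite_eq', Finset.mem_univ, if_true]

theorem mfact_pos (γ : MultiIndex n) : 0 < mfact γ := Finset.prod_pos fun _ _ => Nat.factorial_pos _

/-- Reordering of a sum over multi-indices of length `l + 1` that are obtained from multi-indices of
length `l` by adding a unit vector. -/
theorem sum_ofLen_add_ej (l : ℕ) (r : MultiIndex n → ℂ) :
    ∑ γ ∈ ofLen n l, (1 / (mfact γ : ℂ)) * ∑ j, r (γ + ej j) =
      (l + 1 : ℂ) * ∑ γ ∈ ofLen n (l + 1), (1 / (mfact γ : ℂ)) * r γ := by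
  have h1 : ∀ γ ∈ ofLen n (l + 1), (l + 1 : ℂ) * ((1 / (mfact γ : ℂ)) * r γ) =
      ∑ j, (γ j : ℂ) * ((1 / (mfact γ : ℂ)) * r γ) := by
    intro γ hγ
    rw [← Finset.sum_mul]
    congr 1
    have h2 := mem_ofLen.1 hγ
    rw [len] at h2
    exact_mod_cast h2.symm
  rw [Finset.mul_sum, Finset.sum_congr rfl h1, Finset.sum_comm]
  simp_rw [Finset.mul_sum]
  rw [Finset.sum_comm]
  refine Finset.sum_congr rfl fun j _ => ?_
  refine Finset.sum_bij_ne_zero (fun γ _ _ => γ + ej j) ?_ ?_ ?_ ?_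
  · intro γ hγ _
    rw [mem_ofLen, len_add_ej, mem_ofLen.1 hγ]
  · intro γ _ _ γ' _ _ h
    exact add_right_cancel h
  · intro γ hγ h0
    have hj : 1 ≤ γ j := by
      by_contra hj
      have : γ j = 0 := by omega
      exact h0 (by rw [this]; simp)
    have hle : ej j ≤ γ := by
      intro i
      by_cases hi : i = j
      · subst hi; rwa [show ej i i = 1 from Pi.single_eq_same i 1]
      · rw [show ej j i = 0 from Pi.single_eq_of_ne hi 1]; exact Nat.zero_le _
    have e1 : γ - ej j + ej j = γ := tsub_add_cancel_of_le hle
    have h2 : len (γ - ej j) = l := by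
      have := mem_ofLen.1 hγ
      rw [← e1, len_add_ej] at this
      omega
    refine ⟨γ - ej j, mem_ofLen.2 h2, fun h3 => h0 ?_, e1⟩
    rw [e1] at h3
    have h4 : (1 / (mfact (γ - ej j) : ℂ)) ≠ 0 :=
      one_div_ne_zero (by exact_mod_cast (mfact_pos _).ne')
    rw [(mul_eq_zero.1 h3).resolve_left h4, mul_zero, mul_zero]
  · intro γ hγ _
    rw [mfact_add_ej, Pi.add_apply, show ej j j = 1 from Pi.single_eq_same j 1]
    have h4 : (mfact γ : ℂ) ≠ 0 := by exact_mod_cast (mfact_pos _).ne'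
    have h5 : ((γ j : ℂ) + 1) ≠ 0 := Nat.cast_add_one_ne_zero (γ j)
    push_cast
    field_simp

namespace SymFam

variable {k : ℕ} {τ : ℝ≥0} {m₁ m₂ ρ δ : ℝ} {M₁ M₂ : ℕ∞} {W : (E n → ℝ) → Prop}
  {F : MultiIndex n → MultiIndex n → MultiIndex n → MultiIndex n → Fun4 n}

variable (hW : WeightClass W) (hδ₀ : 0 ≤ δ) (hδ₁ : δ < 1) (hδρ : δ ≤ ρ)
  (hF : SymFam k τ m₁ m₂ ρ δ M₁ M₂ W F)

include hW hδ₀ hδ₁ hδρ hF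

/-- The derivative with respect to `θ`: each factor `η_j` that is produced by the chain rule is
turned into `-i ∂_{x'_j}` by an integration by parts. -/
theorem hasDerivAt_oscV_theta {β α β' α' : MultiIndex n} (hβ : len β ≤ k)
    (hα : ((len α + 1 + (n + 1) : ℕ) : ℕ∞) ≤ M₁) (hα' : (len α' : ℕ∞) ≤ M₂) {θ : ℝ}
    (hθ : θ ∈ Set.Ioo (-1 : ℝ) 1) (x z ξ : E n) :
    HasDerivAt (fun θ => oscV (F β α β' α') θ x z ξ)
      (∑ j, -Complex.I * oscV (F β (α + ej j) (β' + ej j) α') θ x z ξ) θ := by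
  have hα₁ : ((len α + (n + 1) : ℕ) : ℕ∞) ≤ M₁ := le_trans (by exact_mod_cast (by omega)) hα
  have hα₂ : ∀ j, ((len (α + ej j) + (n + 1) : ℕ) : ℕ∞) ≤ M₁ := fun j => by rwa [len_add_ej]
  have hα₃ : ((len α + 1 : ℕ) : ℕ∞) ≤ M₁ := le_trans (by exact_mod_cast (by omega)) hα
  have hθ' : ∀ t : Set.Ioo (-1 : ℝ) 1, |(t : ℝ)| ≤ 1 := fun t => (abs_lt.2 t.2).le
  have h1 := hF.isAmp hW hδ₀ hδ₁ hδρ (β' := β') hβ hα₁ hα' (T := Set.Ioo (-1 : ℝ) 1) hθ'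
    (fun _ => x) (fun _ => z) (ξ := fun _ => ξ) (norm_nonneg ξ) (fun _ => le_rfl)
  have h2 := fun j β' => hF.isAmp hW hδ₀ hδ₁ hδρ (β' := β') hβ (hα₂ j) hα'
    (T := Set.Ioo (-1 : ℝ) 1) hθ' (fun _ => x) (fun _ => z) (ξ := fun _ => ξ) (norm_nonneg ξ)
    (fun _ => le_rfl)
  have h3 := IsAmp.sum (δ := δ) Finset.univ fun j _ => (h2 j β').coord_mul hδ₀ j
  have e1 : (∑ j, fun (t : Set.Ioo (-1 : ℝ) 1) (y η : E n) => (η j : ℂ) *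
      ampl (F β (α + ej j) β' α') t x z ξ y η) = fun (t : Set.Ioo (-1 : ℝ) 1) (y η : E n) =>
      ∑ j, (η j : ℂ) * ampl (F β (α + ej j) β' α') t x z ξ y η := by
    funext t y η
    simp only [Finset.sum_apply]
  rw [e1] at h3
  have h4 := IsAmp.hasDerivAt_oscInt hδ₀ hδ₁ (O := Set.Ioo (-1 : ℝ) 1) isOpen_Ioo
    (f := fun t => ampl (F β α β' α') t x z ξ)
    (g := fun t y η => ∑ j, (η j : ℂ) * ampl (F β (α + ej j) β' α') t x z ξ y η) h1 h3
    (fun t _ y η => by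
      have g1 := hasFDerivAt_of_partials (f := fun ζ => F β α β' α' x ζ (z + y) ξ)
        (g := fun j ζ => F β (α + ej j) β' α' x ζ (z + y) ξ)
        (fun j ζ => hF.deriv_ξ β α β' α' hβ hα₃ hα' j x ζ (z + y) ξ)
        (fun j => (hF.cont β (α + ej j) β' α' hβ (natCast_le_of_add_le (hα₂ j)) hα').comp
          (f := fun ζ : E n => (x, ζ, z + y, ξ)) (by fun_prop)) (ξ + t • η)
      have g2 : HasDerivAt (fun r : ℝ => ξ + r • η) η t := by
        simpa using ((hasDerivAt_id t).smul_const η).const_add ξ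
      refine (g1.comp_hasDerivAt t g2).congr_deriv ?_
      simp [ampl]) hθ
  refine h4.congr_deriv ?_
  have h5 : ∀ j, HasOscInt (fun y η => (η j : ℂ) * ampl (F β (α + ej j) β' α') θ x z ξ y η)
      (-Complex.I * oscV (F β (α + ej j) (β' + ej j) α') θ x z ξ) := by
    intro j
    have g1 := IsAmp.oscInt_coord_mul hδ₀ hδ₁ (j := j) (h2 j β') (h2 j (β' + ej j))
      (fun t y η => by
        have g2 := hF.deriv_x' β (α + ej j) β' α' hβ (natCast_le_of_add_le (hα₂ j)) hα' j x
          (ξ + (t : ℝ) • η) (z + y) ξ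
        refine HasDerivAt.congr_of_eventuallyEq g2 (Eventually.of_forall fun r => ?_)
        simp only [ampl, add_assoc]) ⟨θ, hθ⟩
    have g3 := ((h2 j β').coord_mul hδ₀ j).hasOscInt hδ₀ hδ₁ ⟨θ, hθ⟩
    rw [g1] at g3
    exact g3
  exact (HasOscInt.sum Finset.univ fun j _ => h5 j).oscInt_eq

/-- For `θ = 0` the amplitude does not depend on `η`, and Fourier inversion applies. -/
theorem oscV_zero {β α β' α' : MultiIndex n} (hβ : len β ≤ k)
    (hα : ((len α + (n + 1) : ℕ) : ℕ∞) ≤ M₁) (hα' : (len α' : ℕ∞) ≤ M₂) (x z ξ : E n) :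
    oscV (F β α β' α') 0 x z ξ = F β α β' α' x ξ z ξ := by
  have hα₁ := natCast_le_of_add_le hα
  obtain ⟨C, hC, hC0, hCb⟩ := hF.bound β α β' α' hβ hα₁ hα'
  obtain ⟨K, hK⟩ := hW.bdd hC
  have h := hF.hasOscInt hW hδ₀ hδ₁ hδρ (β' := β') hβ hα hα' (θ := 0) (by simp) x z ξ
  have e1 : ampl (F β α β' α') 0 x z ξ = fun y _ => F β α β' α' x ξ (z + y) ξ := by
    funext y η
    rw [ampl, zero_smul, add_zero]
  rw [e1] at h
  have h2 := h.eq_apply_zero ((hF.cont β α β' α' hβ hα₁ hα').comp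
    (f := fun y : E n => (x, ξ, z + y, ξ)) (by fun_prop)) (K := K * _) fun y =>
      (hCb x ξ (z + y) ξ).trans (mul_le_mul_of_nonneg_right ((le_abs_self _).trans (hK _))
        (mul_nonneg (mul_nonneg (jb_rpow_pos _ _).le (jb_rpow_pos _ _).le)
          (Real.rpow_nonneg (zero_le_one.trans (one_le_jb₂ _ _)) _)))
  rw [h2, Function.comp_apply, add_zero]

/-- The remainder terms form families of symbols of the expected order. -/
theorem reg_oscV_remainder (hτ : τ < 1) {N J : ℕ} {γ : MultiIndex n} (hγ : len γ = N)
    (hJ₁ : ((N + J + (n + 1) : ℕ) : ℕ∞) ≤ M₁) (hJ₂ : (J : ℕ∞) ≤ M₂) :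
    Reg k J (SymB W τ (m₁ + m₂ - (ρ - δ) * N) ρ δ (m₁ + m₂ - (ρ - δ) * N + δ * (k + τ)))
      (fun (θ : Theta) x ξ => oscV (F 0 γ γ 0) θ x x ξ) := by
  refine (hF.reg_oscV hW hδ₀ hδ₁ hδρ hτ (N := N) (k + J) k J 0 γ γ 0 rfl (by rw [len_zero]; omega)
    (by rwa [hγ]) (by rwa [len_zero, zero_add]) (by rw [len_zero]; omega)).mono fun i l f hf => ?_
  obtain ⟨h1, ⟨C, hC, hC0, h2⟩, D, hD, h3⟩ := hf
  rw [len_zero, hγ] at h2 h3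
  refine ⟨h1, ⟨C, hC, hC0, fun t x ξ => (h2 t x ξ).trans (le_of_eq ?_)⟩, D, hD,
    fun t x₁ x₂ ξ => (h3 t x₁ x₂ ξ).trans (le_of_eq ?_)⟩
  · congr 2; push_cast; ring
  · congr 3; push_cast; ring

end SymFam

/-! ### The remainder of the asymptotic expansion -/

theorem dξDx'_eq (γ : MultiIndex n) (a : Fun4 n) (x ξ x' ξ' : E n) :
    dξDx' γ a x ξ x' ξ' = (-Complex.I) ^ len γ * allDeriv a 0 γ γ 0 x ξ x' ξ' := by
  rw [allDeriv, dx_zero, dξ'_zero, dξDx']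

theorem amplitude_dξDx' (γ : MultiIndex n) (a : Fun4 n) (θ : ℝ) (x ξ : E n) :
    amplitude (dξDx' γ a) θ x ξ =
      fun y η => (-Complex.I) ^ len γ * ampl (allDeriv a 0 γ γ 0) θ x x ξ y η := by
  funext y η
  exact dξDx'_eq γ a _ _ _ _

theorem amplitude_dξDx'_zero (a : Fun4 n) (x ξ : E n) :
    amplitude (dξDx' 0 a) 1 x ξ = fun y η => a x (ξ + η) (x + y) ξ := by
  funext y η
  simp only [amplitude, dξDx', len_zero, pow_zero, one_mul, one_smul, dξ_zero, dx'_zero]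

theorem natCast_le_of_le_redOrder {M₁ M₂ : ℕ∞} {N J : ℕ} (hN : ((N + (n + 1) : ℕ) : ℕ∞) ≤ M₁)
    (hJ : (J : ℕ∞) ≤ redOrder n M₁ M₂ N) :
    ((N + J + (n + 1) : ℕ) : ℕ∞) ≤ M₁ ∧ (J : ℕ∞) ≤ M₂ := by
  refine ⟨?_, hJ.trans (min_le_right _ _)⟩
  have h := hJ.trans (min_le_left _ _)
  have h2 := add_le_of_le_tsub_right_of_le hN h
  refine le_trans (le_of_eq ?_) h2
  push_cast
  ring

namespace SymFam

variable {k : ℕ} {τ : ℝ≥0} {m₁ m₂ ρ δ : ℝ} {M₁ M₂ : ℕ∞} {W : (E n → ℝ) → Prop} {a : Fun4 n}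

/-- The operators `∂_ξ^γ D_{x'}^γ` compose as expected. -/
theorem dξDx'_dξDx' (ha : SymFam k τ m₁ m₂ ρ δ M₁ M₂ W (allDeriv a)) {γ γ' : MultiIndex n}
    (hγ : (len (γ + γ') : ℕ∞) ≤ M₁) : dξDx' γ' (dξDx' γ a) = dξDx' (γ + γ') a := by
  have h0 : ∀ M : ℕ∞, (len (0 : MultiIndex n) : ℕ∞) ≤ M := fun M => by simp [len_zero]
  have h0' : len (0 : MultiIndex n) ≤ k := by rw [len_zero]; exact Nat.zero_le k
  rw [len_add] at hγ
  funext x ξ x' ξ'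
  have h1 : ∀ ζ, dx' γ' (dξDx' γ a) x ζ x' ξ' =
      (-Complex.I) ^ len γ * allDeriv a 0 γ (γ + γ') 0 x ζ x' ξ' := by
    intro ζ
    rw [dx']
    simp only [dξDx'_eq]
    rw [mpd_const_mul, mpd_eq_of_family (G := fun β' z => allDeriv a 0 γ β' 0 x ζ z ξ') (len (γ + γ'))
      (fun β' _ j z => ha.deriv_x' 0 γ β' 0 h0' (natCast_le_of_add_le hγ) (h0 _) j x ζ z ξ') γ' γ
      (by rw [len_add])]
  rw [dξDx', dξ]
  simp only [h1]
  rw [mpd_const_mul, mpd_eq_of_family (G := fun α ζ => allDeriv a 0 α (γ + γ') 0 x ζ x' ξ')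
    (len (γ + γ')) (fun α hα j ζ => ha.deriv_ξ 0 α (γ + γ') 0 h0'
      (le_trans (by rw [len_add] at hα; exact_mod_cast hα) hγ) (h0 _) j x ζ x' ξ') γ' γ
    (by rw [len_add]), dξDx'_eq, len_add, pow_add]
  ring

variable (hW : WeightClass W) (hδ₀ : 0 ≤ δ) (hδ₁ : δ < 1) (hδρ : δ ≤ ρ)
  (ha : SymFam k τ m₁ m₂ ρ δ M₁ M₂ W (allDeriv a))

include hW hδ₀ hδ₁ hδρ ha

/-- The integrals `r_{γ,θ}` are, up to a power of `-i`, the oscillatory integrals of derivatives of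
the symbol on the diagonal `z = x`. -/
theorem rSymb_eq_and_hasOscInt {γ : MultiIndex n} (hγ : ((len γ + (n + 1) : ℕ) : ℕ∞) ≤ M₁) {θ : ℝ}
    (hθ : |θ| ≤ 1) (x ξ : E n) :
    rSymb a γ θ x ξ = (-Complex.I) ^ len γ * oscV (allDeriv a 0 γ γ 0) θ x x ξ ∧
      HasOscInt (amplitude (dξDx' γ a) θ x ξ) (rSymb a γ θ x ξ) := by
  have h := (ha.hasOscInt hW hδ₀ hδ₁ hδρ (β := 0) (β' := γ) (α' := 0)
    (by rw [len_zero]; exact Nat.zero_le k) hγ (by simp [len_zero]) hθ x x ξ).const_mul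
      ((-Complex.I) ^ len γ)
  rw [← amplitude_dξDx'] at h
  exact ⟨h.oscInt_eq, h.hasOscInt_oscInt⟩

theorem rSymb_eq {γ : MultiIndex n} (hγ : ((len γ + (n + 1) : ℕ) : ℕ∞) ≤ M₁) {θ : ℝ}
    (hθ : |θ| ≤ 1) (x ξ : E n) :
    rSymb a γ θ x ξ = (-Complex.I) ^ len γ * oscV (allDeriv a 0 γ γ 0) θ x x ξ :=
  (ha.rSymb_eq_and_hasOscInt hW hδ₀ hδ₁ hδρ hγ hθ x ξ).1

theorem hasOscInt_rSymb {γ : MultiIndex n} (hγ : ((len γ + (n + 1) : ℕ) : ℕ∞) ≤ M₁) {θ : ℝ}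
    (hθ : |θ| ≤ 1) (x ξ : E n) : HasOscInt (amplitude (dξDx' γ a) θ x ξ) (rSymb a γ θ x ξ) :=
  (ha.rSymb_eq_and_hasOscInt hW hδ₀ hδ₁ hδρ hγ hθ x ξ).2

theorem continuousOn_rSymb {γ : MultiIndex n} (hγ : ((len γ + (n + 1) : ℕ) : ℕ∞) ≤ M₁)
    (x ξ : E n) : ContinuousOn (fun θ => rSymb a γ θ x ξ) (Set.Icc 0 1) := by
  have h1 := (ha.continuous_oscV hW hδ₀ hδ₁ hδρ (β := 0) (β' := γ) (α' := 0)
    (by rw [len_zero]; exact Nat.zero_le k) hγ (by simp [len_zero])).comp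
    (f := fun θ : ℝ => (toTheta θ, x, x, ξ)) (continuous_toTheta.prodMk continuous_const)
  refine ((continuous_const (y := (-Complex.I) ^ len γ)).mul h1).continuousOn.congr fun θ hθ => ?_
  have hθ' : |θ| ≤ 1 := abs_le.2 ⟨by linarith [hθ.1], hθ.2⟩
  simp only [Pi.mul_apply, Function.comp_apply, toTheta_of_mem hθ']
  exact ha.rSymb_eq hW hδ₀ hδ₁ hδρ hγ hθ' x ξ

theorem rSymb_zero {γ : MultiIndex n} (hγ : ((len γ + (n + 1) : ℕ) : ℕ∞) ≤ M₁) (x ξ : E n) :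
    rSymb a γ 0 x ξ = dξDx' γ a x ξ x ξ := by
  rw [ha.rSymb_eq hW hδ₀ hδ₁ hδρ hγ (by simp), dξDx'_eq, ha.oscV_zero hW hδ₀ hδ₁ hδρ
    (by rw [len_zero]; exact Nat.zero_le k) hγ (by simp [len_zero])]

/-- A derivative in `θ` raises the length of `γ` by one; this is the relation that makes Taylor's
formula applicable. -/
theorem hasDerivAt_rSymb {γ : MultiIndex n} (hγ : ((len γ + 1 + (n + 1) : ℕ) : ℕ∞) ≤ M₁) {θ : ℝ}
    (hθ : θ ∈ Set.Ioo (-1 : ℝ) 1) (x ξ : E n) :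
    HasDerivAt (fun θ => rSymb a γ θ x ξ) (∑ j, rSymb a (γ + ej j) θ x ξ) θ := by
  have hγ₁ : ((len γ + (n + 1) : ℕ) : ℕ∞) ≤ M₁ := le_trans (by exact_mod_cast (by omega)) hγ
  have h := (ha.hasDerivAt_oscV_theta hW hδ₀ hδ₁ hδρ (β := 0) (β' := γ) (α' := 0)
    (by rw [len_zero]; exact Nat.zero_le k) hγ (by simp [len_zero]) hθ x x ξ).const_mul
      ((-Complex.I) ^ len γ)
  refine (h.congr_of_eventuallyEq ?_).congr_deriv ?_
  · filter_upwards [isOpen_Ioo.mem_nhds hθ] with t ht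
    exact ha.rSymb_eq hW hδ₀ hδ₁ hδρ hγ₁ (abs_lt.2 ht).le x ξ
  · rw [Finset.mul_sum]
    refine Finset.sum_congr rfl fun j _ => ?_
    rw [ha.rSymb_eq hW hδ₀ hδ₁ hδρ (by rwa [len_add_ej]) (abs_lt.2 hθ).le, len_add_ej, pow_succ,
      mul_assoc]

theorem reg_rSymb (hτ : τ < 1) {N J : ℕ} {γ : MultiIndex n} (hγ : len γ = N)
    (hJ₁ : ((N + J + (n + 1) : ℕ) : ℕ∞) ≤ M₁) (hJ₂ : (J : ℕ∞) ≤ M₂) :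
    Reg k J (SymB W τ (m₁ + m₂ - (ρ - δ) * N) ρ δ (m₁ + m₂ - (ρ - δ) * N + δ * (k + τ)))
      (fun θ : Theta => rSymb a γ θ) := by
  have h := (ha.reg_oscV_remainder hW hδ₀ hδ₁ hδρ hτ hγ hJ₁ hJ₂).const_mul
    (fun _ => (-Complex.I) ^ len γ) fun i l f hf => hf.const_mul hW _
  have hγ₁ : ((len γ + (n + 1) : ℕ) : ℕ∞) ≤ M₁ :=
    le_trans (by rw [hγ]; exact_mod_cast (by omega)) hJ₁
  convert h using 1
  funext θ x ξ
  exact ha.rSymb_eq hW hδ₀ hδ₁ hδρ hγ₁ θ.abs_le x ξ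

theorem intervalIntegrable_remIntegrand {N : ℕ} (hN : ((N + (n + 1) : ℕ) : ℕ∞) ≤ M₁)
    {γ : MultiIndex n} (hγ : len γ = N) (x ξ : E n) :
    IntervalIntegrable (remIntegrand a N γ x ξ) volume 0 1 := by
  refine ContinuousOn.intervalIntegrable ?_
  rw [Set.uIcc_of_le zero_le_one]
  exact (Continuous.continuousOn (by fun_prop)).mul
    (ha.continuousOn_rSymb hW hδ₀ hδ₁ hδρ (by rwa [hγ]) x ξ)

/-- The expansion, by Taylor's formula in `θ` for `∑_{|γ| = l} r_{γ,θ} / γ!`. -/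
theorem reduced_eq {N : ℕ} (hN : 1 ≤ N) (hNM : ((N + (n + 1) : ℕ) : ℕ∞) ≤ M₁) (x ξ : E n) :
    reduced a x ξ = taylorSum a N x ξ + remainder a N x ξ := by
  have hle : ∀ l, l ≤ N → ∀ γ ∈ ofLen n l, ((len γ + (n + 1) : ℕ) : ℕ∞) ≤ M₁ := by
    intro l hl γ hγ
    rw [mem_ofLen.1 hγ]
    exact le_trans (by exact_mod_cast (by omega)) hNM
  have h := taylor_integral
    (s := fun l θ => ∑ γ ∈ ofLen n l, (1 / (mfact γ : ℂ)) * rSymb a γ θ x ξ) hN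
    (fun l hl => continuousOn_finsetSum _ fun γ hγ =>
      continuousOn_const.mul (ha.continuousOn_rSymb hW hδ₀ hδ₁ hδρ (hle l hl γ hγ) x ξ))
    (fun l hl θ hθ => by
      rw [← sum_ofLen_add_ej l fun γ => rSymb a γ θ x ξ]
      refine HasDerivAt.fun_sum fun γ hγ => (ha.hasDerivAt_rSymb hW hδ₀ hδ₁ hδρ ?_
        ⟨by linarith [hθ.1], hθ.2⟩ x ξ).const_mul _
      rw [mem_ofLen.1 hγ]
      exact le_trans (by exact_mod_cast (by omega)) hNM)
  have h0 : ofLen n 0 = {0} := by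
    ext γ
    rw [mem_ofLen, Finset.mem_singleton]
    refine ⟨fun h => funext fun j => ?_, fun h => by rw [h, len_zero]⟩
    rw [len, Finset.sum_eq_zero_iff] at h
    exact h j (Finset.mem_univ j)
  have e1 : rSymb a 0 1 x ξ = reduced a x ξ := by
    rw [rSymb, amplitude_dξDx'_zero, reduced]
  have e2 : (mfact (0 : MultiIndex n) : ℂ) = 1 := by simp [mfact]
  simp only [h0, Finset.sum_singleton, e1, e2, div_one, one_mul] at h
  rw [h, taylorSum, remainder]
  congr 1
  · refine Finset.sum_congr rfl fun l hl => Finset.sum_congr rfl fun γ hγ => ?_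
    rw [ha.rSymb_zero hW hδ₀ hδ₁ hδρ (hle l (Finset.mem_range.1 hl).le γ hγ)]
  · rw [← intervalIntegral.integral_finsetSum fun γ hγ =>
      ha.intervalIntegrable_remIntegrand hW hδ₀ hδ₁ hδρ hNM (mem_ofLen.1 hγ) x ξ]
    congr 2
    funext θ
    rw [Finset.mul_sum]
    refine Finset.sum_congr rfl fun γ _ => ?_
    rw [remIntegrand]
    push_cast
    ring

end SymFam

/-- The remainder inherits the estimates of the `r_{γ,θ}`, since it is a sum of means over `θ`. -/
theorem reg_remainder {k : ℕ} {τ : ℝ≥0} {m ρ δ e : ℝ} {W : (E n → ℝ) → Prop} {a : Fun4 n}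
    (hW : WeightClass W) {N J : ℕ} (h : ∀ γ : MultiIndex n, len γ = N →
      Reg k J (SymB W τ m ρ δ e) (fun θ : Theta => rSymb a γ θ)) :
    Reg k J (SymB W τ m ρ δ e) (fun _ : Unit => remainder a N) := by
  have h0 : ∀ γ : MultiIndex n,
      Continuous fun θ : ℝ => (((1 - θ) ^ (N - 1) / mfact γ : ℝ) : ℂ) := fun γ =>
    Complex.continuous_ofReal.comp (((continuous_const.sub continuous_id).pow _).div_const _)
  have h1 := (Reg.sum (ofLen n N) _ (fun i l => SymB.zero hW)
    (fun i l f g hf hg => SymB.add hW hf hg)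
    fun γ hγ => (h γ (mem_ofLen.1 hγ)).meanFam hW (h0 γ)).const_mul
    (B' := SymB W τ m ρ δ e) (fun _ => (N : ℂ)) fun i l f hf => hf.const_mul hW _
  convert h1 using 1
  funext t x ξ
  rw [remainder, Finset.sum_apply, Finset.sum_apply, Finset.sum_apply]
  congr 1
  refine Finset.sum_congr rfl fun γ _ => intervalIntegral.integral_congr fun θ hθ => ?_
  rw [Set.uIcc_of_le zero_le_one] at hθ
  have hθ' : |θ| ≤ 1 := abs_le.2 ⟨by linarith [hθ.1], hθ.2⟩
  simp only [remIntegrand, toTheta_of_mem hθ']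

end NonSmoothSymbol

theorem mainTheorem4 (n : ℕ) (hn : 1 ≤ n) (ρ δ : ℝ) (hδ₀ : 0 ≤ δ) (hδρ : δ ≤ ρ) (hρ : ρ ≤ 1)
    (hδ₁ : δ < 1) (m₁ m₂ : ℝ) (M₁ M₂ : ℕ∞) (hM₁ : ((n + 1 : ℕ) : ℕ∞) < M₁)
    (k : ℕ) (τ : ℝ≥0) (hτ₀ : 0 < τ) (hτ₁ : τ < 1)
    (a : Fun4 n) (ha : IsDoubleSymbol k τ m₁ m₂ ρ δ M₁ M₂ a) :
    -- the oscillatory integrals defining `a_L` and `r_{γ,θ}` exist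
    (∀ x ξ, HasOscInt (fun y η => a x (ξ + η) (x + y) ξ) (reduced a x ξ)) ∧
    (∀ γ : MultiIndex n, ((len γ + (n + 1) : ℕ) : ℕ∞) ≤ M₁ → ∀ θ : ℝ, |θ| ≤ 1 → ∀ x ξ,
      HasOscInt (amplitude (dξDx' γ a) θ x ξ) (rSymb a γ θ x ξ)) ∧
    ∀ N : ℕ, 1 ≤ N → ((N + (n + 1) : ℕ) : ℕ∞) ≤ M₁ →
      -- the integrals in `R_N` exist, and the expansion holds
      (∀ γ : MultiIndex n, len γ = N → ∀ x ξ,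
        IntervalIntegrable (remIntegrand a N γ x ξ) volume 0 1) ∧
      (∀ x ξ, reduced a x ξ = taylorSum a N x ξ + remainder a N x ξ) ∧
      -- the remainder is a symbol
      IsSymbol k τ (m₁ + m₂ - (ρ - δ) * N) ρ δ (redOrder n M₁ M₂ N) (remainder a N) ∧
      -- the family `r_{γ,θ}` is bounded
      (∀ γ : MultiIndex n, len γ = N →
        IsBoundedSymbolSet k τ (m₁ + m₂ - (ρ - δ) * N) ρ δ (redOrder n M₁ M₂ N)
          {r | ∃ θ : ℝ, |θ| ≤ 1 ∧ r = rSymb a γ θ}) ∧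
      -- decay of the remainder
      ((∀ γ : MultiIndex n, len γ = 1 →
          IsHatDoubleSymbol k τ (m₁ - ρ) (m₂ + δ) ρ δ (M₁ - 1) M₂ (dξDx' γ a)) →
        IsDotSymbol k τ (m₁ + m₂ - (ρ - δ) * N) ρ δ (redOrder n M₁ M₂ N) (remainder a N)) := by
  have hF := ha.symFam weightClass_isBdd ha.bound
  have hJ : ∀ N : ℕ, ((N + (n + 1) : ℕ) : ℕ∞) ≤ M₁ → ∀ γ : MultiIndex n, len γ = N → ∀ J : ℕ,
      (J : ℕ∞) ≤ redOrder n M₁ M₂ N →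
      Reg k J (SymB IsBdd τ (m₁ + m₂ - (ρ - δ) * N) ρ δ (m₁ + m₂ - (ρ - δ) * N + δ * (k + τ)))
        (fun θ : Theta => rSymb a γ θ) := fun N hNM γ hγ J hJ => by
    obtain ⟨h1, h2⟩ := natCast_le_of_le_redOrder hNM hJ
    exact hF.reg_rSymb weightClass_isBdd hδ₀ hδ₁ hδρ hτ₁ hγ h1 h2
  refine ⟨fun x ξ => ?_, fun γ hγ θ hθ x ξ =>
    hF.hasOscInt_rSymb weightClass_isBdd hδ₀ hδ₁ hδρ hγ hθ x ξ, fun N hN hNM =>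
    ⟨fun γ hγ x ξ => hF.intervalIntegrable_remIntegrand weightClass_isBdd hδ₀ hδ₁ hδρ hNM hγ x ξ,
    fun x ξ => hF.reduced_eq weightClass_isBdd hδ₀ hδ₁ hδρ hN hNM x ξ,
    isSymbol_of_reg weightClass_isBdd hδ₀
      (fun J h => reg_remainder weightClass_isBdd fun γ hγ => hJ N hNM γ hγ J h) (),
    fun γ hγ => ⟨?_, fun α hα => ?_⟩, fun hb => ?_⟩⟩
  · rw [reduced, ← amplitude_dξDx'_zero]
    exact hF.hasOscInt_rSymb weightClass_isBdd hδ₀ hδ₁ hδρ (by rw [len_zero, zero_add]; exact hM₁.le)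
      (by simp) x ξ
  · rintro r ⟨θ, hθ, rfl⟩
    exact isSymbol_of_reg weightClass_isBdd hδ₀ (hJ N hNM γ hγ) ⟨θ, abs_le.1 hθ⟩
  · obtain ⟨C, hC⟩ := (hJ N hNM γ hγ _ hα).exists_symbolBound weightClass_isBdd hδ₀ le_rfl
    refine ⟨C, ?_⟩
    rintro r ⟨θ, hθ, rfl⟩
    exact hC ⟨θ, abs_le.1 hθ⟩
  · obtain ⟨N, rfl⟩ : ∃ N', N = N' + 1 := ⟨N - 1, by omega⟩
    refine isDotSymbol_of_reg hδ₀ (fun J h => reg_remainder weightClass_isDecaying fun γ hγ => ?_) ()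
    obtain ⟨h1, h2⟩ := natCast_le_of_le_redOrder hNM h
    -- one of the derivatives is moved into the symbol, which then belongs to the hatted class
    obtain ⟨γ', j, rfl, hγ'⟩ := exists_eq_add_ej hγ
    have hG := (hb (ej j) (len_ej j)).toIsDoubleSymbol.symFam weightClass_isDecaying
      (hb (ej j) (len_ej j)).decay
    have h3 := hG.reg_rSymb weightClass_isDecaying hδ₀ hδ₁ hδρ hτ₁ (J := J) hγ'
      (ENat.le_sub_of_add_le_right ENat.one_ne_top (le_trans (by push_cast; exact le_of_eq (by ring)) h1)) h2
    have e1 : ∀ θ : Theta, rSymb (dξDx' (ej j) a) γ' θ = rSymb a (γ' + ej j) θ := fun θ => by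
      funext x ξ
      rw [rSymb, hF.dξDx'_dξDx', add_comm (ej j), rSymb]
      rw [add_comm, hγ]
      exact natCast_le_of_add_le hNM
    have e2 : m₁ - ρ + (m₂ + δ) - (ρ - δ) * N = m₁ + m₂ - (ρ - δ) * (N + 1 : ℕ) := by
      push_cast; ring
    simp only [e1, e2] at h3
    exact h3
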